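/- **Theorem 3.4.** Let $r,p\ge 1$. Let $A_n$ ($n\ge 1$) be nonsingular and $B_n$ ($n\ge 0$) Hermitian complex $r\times r$ matrices, and let the $r\times r$ matrix polynomials $P_n(x)$ be given by $$xP_n(x)=A_{n+1}P_{n+1}(x)+B_nP_n(x)+A_n^*P_{n-1}(x)\quad(n\ge 0),\qquad P_{-1}\equiv 0,\quad P_0\equiv I_r .$$ Assume that for each $j\in\{0,\dots,p-1\}$ the limits $$\lim_{n\to\infty}A_{pn+j}=A^{(j)},\qquad \lim_{n\to\infty}B_{pn+j}=B^{(j)}$$ exist and that each $A^{(j)}$ is nonsingular. Let $M>0$ be such that all zeros of all polynomials $\det P_n(x)$ lie in the real interval $[-M,M]$. For $x\in\mathbb C$ and $z\in\mathbb C\setminus\{0\}$ let $$F(z,x)=\begin{pmatrix} B^{(0)}-xI_r & A^{(1)} & & & zA^{(0)*}\\ A^{(1)*} & B^{(1)}-xI_r & A^{(2)} & & \\ & A^{(2)*} & \ddots & \ddots & \\ & & \ddots & \ddots & A^{(p-1)}\\ z^{-1}A^{(0)} & & & A^{(p-1)*} & B^{(p-1)}-xI_r\end{pmatrix}_{pr\times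 pr}$$ (if $p\le 2$, the two corner blocks are added to the blocks already standing there; thus $F(z,x)=zA^{(0)*}+B^{(0)}-xI_r+z^{-1}A^{(0)}$ for $p=1$). Put $d(z,x)=\dim\ker F(z,x)$ and let $m_1(z,x)$ be the multiplicity of $z$ as a zero of the polynomial $Z\mapsto Z^r\det F(Z,x)$. For every $x\in\mathbb C$ this polynomial has $2r$ zeros counted with multiplicity; list them as $z_1(x),\dots,z_{2r}(x)$ with $|z_1(x)|\le\dots\le|z_{2r}(x)|$ (ties broken arbitrarily). Let $S\subset\mathbb C$ be the set of those $x$ for which there do not exist vectors $\mathbf v_1(x),\dots,\mathbf v_{2r}(x)\in\mathbb C^{pr}$ of Euclidean norm $1$ such that, for all $k$, $F(z_k(x),x)\mathbf v_k(x)=0$ and $$\dim\operatorname{span}\{\mathbf v_l(x): z_l(x)=z_k(x)\}=d(z_k(x),x)=m_1(z_k(x),x).$$ The set $S$ is finite. For $x\notin S$ choose such vectors, and write $\mathbf v_{k,j}(x)\in\mathbb C^r$, $j=0,\dots,p-1$, for the consecutive blocks of $\mathbf v_k(x)$. Then for every $j\in\{0,\dots,p-1\}$ and every $x\in\mathbb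 C\setminus([-M,M]\cup S)$ the limit $$L_j(x)=\lim_{n\to\infty}P_{pn+j}(x)P_{pn+j+p}(x)^{-1}$$ exists and is diagonalizable; the vectors $\mathbf v_{1,j}(x),\dots,\mathbf v_{r,j}(x)$ form a basis of $\mathbb C^r$, and $$L_j(x)\,\mathbf v_{k,j}(x)=z_k(x)\,\mathbf v_{k,j}(x),\qquad k=1,\dots,r .$$ On compact subsets of $\mathbb C\setminus([-M,M]\cup S)$ the convergence $P_{pn+j}(x)P_{pn+j+p}(x)^{-1}\to L_j(x)$ is uniform in $x$, and $P_{pn+j}(x)P_{pn+j+p}(x)^{-1}\mathbf v_{k,j}(x)\to z_k(x)\mathbf v_{k,j}(x)$ uniformly in $x$ and $k\in\{1,\dots,r\}$. Moreover, $$\lim_{n\to\infty}\frac{\det P_n(x)}{\det P_{n+p}(x)}=z_1(x)\cdots z_r(x)$$ uniformly for $x$ in compact subsets of $\mathbb C\setminus[-M,M]$. -/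

import Mathlib

open Filter Topology
open scoped Matrix Polynomial

noncomputable section

namespace MatrixRatio

/-- The `r × r` matrix polynomials `P n`, as functions of `x`, generated by
`x P n = A (n+1) P (n+1) + B n P n + (A n)ᴴ P (n-1)` for `n ≥ 0`, with `P (-1) = 0` and `P 0 = 1`
(the recurrence is solved for `P (n+1)`). The matrix `A 0` plays no role. -/
def matPoly {r : ℕ} (A B : ℕ → Matrix (Fin r) (Fin r) ℂ) :
    ℕ → ℂ → Matrix (Fin r) (Fin r) ℂ
  | 0, _ => 1
  | 1, x => (A 1)⁻¹ * (x • (1 : Matrix (Fin r) (Fin r) ℂ) - B 0)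
  | (n + 2), x => (A (n + 2))⁻¹ *
      (x • matPoly A B (n + 1) x - B (n + 1) * matPoly A B (n + 1) x
        - (A (n + 1))ᴴ * matPoly A B n x)

/-- The recurrence at `n = 0`. -/
theorem matPoly_recurrence_zero {r : ℕ} (A B : ℕ → Matrix (Fin r) (Fin r) ℂ)
    (hA : ∀ n, IsUnit (A (n + 1)).det) (x : ℂ) :
    x • matPoly A B 0 x = A 1 * matPoly A B 1 x + B 0 * matPoly A B 0 x := by
  have h := hA 0
  simp only [zero_add] at h
  simp [matPoly, Matrix.mul_nonsing_inv_cancel_left _ _ h]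

/-- The recurrence at `n + 1`. -/
theorem matPoly_recurrence_succ {r : ℕ} (A B : ℕ → Matrix (Fin r) (Fin r) ℂ)
    (hA : ∀ n, IsUnit (A (n + 1)).det) (n : ℕ) (x : ℂ) :
    x • matPoly A B (n + 1) x =
      A (n + 2) * matPoly A B (n + 2) x + B (n + 1) * matPoly A B (n + 1) x
        + (A (n + 1))ᴴ * matPoly A B n x := by
  have h := hA (n + 1)
  rw [matPoly.eq_3, Matrix.mul_nonsing_inv_cancel_left _ _ h]
  abel

/-- The interval `[-M, M]` of the real line, as a subset of `ℂ`. -/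
def realInterval (M : ℝ) : Set ℂ := Complex.ofReal '' Set.Icc (-M) M

section Symbol

variable {r p : ℕ} (a b : Fin p → Matrix (Fin r) (Fin r) ℂ)

/-- The block tridiagonal part: diagonal blocks `b i`, blocks `a (i+1)` in position `(i, i+1)`
and blocks `(a i)ᴴ` in position `(i, i-1)`. Rows and columns are indexed by
(block, index in the block). -/
def tridiag : Matrix (Fin p × Fin r) (Fin p × Fin r) ℂ := fun s t =>
  (if s.1 = t.1 then b s.1 s.2 t.2 else 0)
    + (if (s.1 : ℕ) + 1 = t.1 then a t.1 s.2 t.2 else 0)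
    + (if (s.1 : ℕ) = (t.1 : ℕ) + 1 then (a s.1)ᴴ s.2 t.2 else 0)

/-- The matrix with block `a 0` in the lower left corner, position `(p-1, 0)`, and zeros
elsewhere. -/
def corner : Matrix (Fin p × Fin r) (Fin p × Fin r) ℂ := fun s t =>
  if (s.1 : ℕ) + 1 = p ∧ (t.1 : ℕ) = 0 then a t.1 s.2 t.2 else 0

/-- The symbol `F(z, x)`: the block tridiagonal part minus `x`, plus `z (a 0)ᴴ` in the upper right
corner and `z⁻¹ a 0` in the lower left corner. For `p ≤ 2` the corner blocks are added to the
blocks that are already there; for `p = 1`, `F(z, x) = z (a 0)ᴴ + b 0 - x + z⁻¹ a 0`. -/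
def symbol (z x : ℂ) : Matrix (Fin p × Fin r) (Fin p × Fin r) ℂ :=
  tridiag a b - x • (1 : Matrix (Fin p × Fin r) (Fin p × Fin r) ℂ)
    + z • (corner a)ᴴ + z⁻¹ • corner a

/-- The polynomial `Z ^ r * det F(Z, x)` in the variable `Z`: the last block row (`r` rows) of
`F(Z, x)` is multiplied by `Z`, which removes the only negative power of `Z`. -/
def rootPoly (x : ℂ) : ℂ[X] :=
  (Matrix.diagonal (fun s : Fin p × Fin r => if (s.1 : ℕ) + 1 = p then (Polynomial.X : ℂ[X]) else 1)
      * ((tridiag a b - x • (1 : Matrix (Fin p × Fin r) (Fin p × Fin r) ℂ)).map Polynomial.C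
        + (Polynomial.X : ℂ[X]) • ((corner a)ᴴ).map Polynomial.C)
    + (corner a).map Polynomial.C).det

/-- `rootPoly` is indeed `z ^ r * det F(z, x)`. -/
theorem eval_rootPoly (hp : 0 < p) (x z : ℂ) (hz : z ≠ 0) :
    (rootPoly a b x).eval z = z ^ r * (symbol a b z x).det := by
  have key : (Matrix.diagonal
      (fun s : Fin p × Fin r => if (s.1 : ℕ) + 1 = p then z else 1) * symbol a b z x) =
      (Polynomial.evalRingHom z).mapMatrix
      (Matrix.diagonal
        (fun s : Fin p × Fin r => if (s.1 : ℕ) + 1 = p then (Polynomial.X : ℂ[X]) else 1)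
      * ((tridiag a b - x • (1 : Matrix (Fin p × Fin r) (Fin p × Fin r) ℂ)).map Polynomial.C
        + (Polynomial.X : ℂ[X]) • ((corner a)ᴴ).map Polynomial.C)
    + (corner a).map Polynomial.C) := by
    ext s t
    simp only [symbol, Matrix.diagonal_mul, Matrix.add_apply, Matrix.smul_apply, smul_eq_mul,
      RingHom.mapMatrix_apply, Matrix.map_apply, Polynomial.coe_evalRingHom, Polynomial.eval_add,
      Polynomial.eval_mul, Polynomial.eval_C, Polynomial.eval_X]
    by_cases h : (s.1 : ℕ) + 1 = p
    · simp only [h, if_true, Polynomial.eval_X]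
      field_simp
    · simp [h, corner]
  have hprod : (∏ s : Fin p × Fin r, if (s.1 : ℕ) + 1 = p then z else 1) = z ^ r := by
    rw [Fintype.prod_prod_type]
    rw [Finset.prod_eq_single (⟨p - 1, by omega⟩ : Fin p)]
    · simp [Nat.sub_add_cancel hp]
    · intro i _ hi
      have h : ¬ ((i : ℕ) + 1 = p) := by
        intro h
        apply hi
        ext
        simp only
        omega
      simp [h]
    · simp
  rw [rootPoly, ← Polynomial.coe_evalRingHom, RingHom.map_det, ← key, Matrix.det_mul,
    Matrix.det_diagonal, hprod]

/-- The geometric multiplicity `d(z, x)`: the dimension of the null space of `F(z, x)`. -/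
def geomMult (z x : ℂ) : ℕ :=
  Module.finrank ℂ (LinearMap.ker (symbol a b z x).mulVecLin)

/-- The algebraic multiplicity `m₁(z, x)`: the order of `z` as a zero of `Z ^ r * det F(Z, x)`. -/
def algMult (z x : ℂ) : ℕ := (rootPoly a b x).rootMultiplicity z

/-- `z 0, …, z (2r-1)` are the roots of `det F(Z, x)`, listed with their multiplicities and
ordered by increasing modulus (ties are broken arbitrarily). -/
structure IsOrderedRoots (x : ℂ) (z : Fin (2 * r) → ℂ) : Prop where
  roots_eq : Finset.univ.val.map z = (rootPoly a b x).roots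
  norm_monotone : Monotone fun k => ‖z k‖

/-- `v k` is a null vector of `F(z k, x)` of Euclidean norm one, and for each `k` the
vectors `v l` with `z l = z k` span a space whose dimension is both the geometric and the algebraic
multiplicity of `z k`. -/
structure IsNullSystem (x : ℂ) (z : Fin (2 * r) → ℂ) (v : Fin (2 * r) → Fin p × Fin r → ℂ) :
    Prop where
  null : ∀ k, symbol a b (z k) x *ᵥ v k = 0
  norm_one : ∀ k, ‖(WithLp.toLp 2 (v k) : EuclideanSpace ℂ (Fin p × Fin r))‖ = 1
  finrank_eq : ∀ k, Module.finrank ℂ (Submodule.span ℂ (v '' {l | z l = z k})) =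
    geomMult a b (z k) x
  geom_eq_alg : ∀ k, geomMult a b (z k) x = algMult a b (z k) x

/-- The set `S` of those `x` for which such null vectors do not exist. -/
def exceptionalSet : Set ℂ :=
  {x | ¬ ∃ z v, IsOrderedRoots a b x z ∧ IsNullSystem a b x z v}

end Symbol

/-- A square matrix is diagonalizable if it is similar to a diagonal matrix. -/
def IsDiagonalizable {r : ℕ} (L : Matrix (Fin r) (Fin r) ℂ) : Prop :=
  ∃ (V : Matrix (Fin r) (Fin r) ℂ) (d : Fin r → ℂ), IsUnit V.det ∧ L = V * Matrix.diagonal d * V⁻¹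

/-- The position of the `k`-th of the `r` smallest roots in the list of all `2r` roots. -/
def small {r : ℕ} (k : Fin r) : Fin (2 * r) := Fin.castLE (by omega) k

/-- The `j`-th block, a vector of length `r`, of a vector of length `p r`. -/
def block {r p : ℕ} (w : Fin p × Fin r → ℂ) (j : Fin p) : Fin r → ℂ := fun i => w (j, i)

/-- The ratio `P (pn+j) (P (pn+j+p))⁻¹` at `x`. -/
def ratio {r p : ℕ} (A B : ℕ → Matrix (Fin r) (Fin r) ℂ) (j : Fin p) (n : ℕ) (x : ℂ) :
    Matrix (Fin r) (Fin r) ℂ :=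
  matPoly A B (p * n + j) x * (matPoly A B (p * n + j + p) x)⁻¹

end MatrixRatio

end

open MatrixRatio

/-! Convergence. Put G_n = P_n (A_{n+1} P_{n+1})⁻¹ (`greenBlock`), the last diagonal block of (x -
J)⁻¹, where J is the block Jacobi matrix truncated to n + 1 blocks. J is Hermitian and its
eigenvalues are zeros of det P_{n+1}, hence lie in [-M, M]; so at distance δ from the interval the
resolvent is bounded by 1/δ. Used for all truncations at once, this bound forces the vectors P_k ξ
to grow geometrically in the mean square, that is, P_k (A_{n+1} P_{n+1})⁻¹ decays geometrically in n
- k (`norm_matPoly_mul_inv_le`). A Wronskian of P_n and P_{n+s} writes G_{n+s} - G_n as a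
geometrically damped sum of differences of coefficients at distance s. For s a multiple of p these
differences tend to 0, so G_{pn+k} converges uniformly (`norm_greenBlock_sub_le`,
`uniformCauchySeqOn_greenBlock`). The ratio P_m P_{m+p}⁻¹ is a product of p factors G A and
converges too.

Identification of the limit. The limits ρ_k of G_{pn+k} are p-periodic in k and solve a Riccati
equation, which is what is needed to factor -F(z, x) as lower times block diagonal times upper
(`neg_symbol_eq_mul`), in the manner of Wiener and Hopf. Taking determinants, Z^r det F is a
constant times charpoly(T) charpoly((T'ᴴ)⁻¹), with T the limit ratio over one period at x and T' the
one at the conjugate of x (`rootPoly_eq_mul_charpoly`). By the decay estimate T and T' have spectral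
radius below 1, so the r smallest roots are the eigenvalues of T and the others lie outside the
closed unit disk. At a small root the left factors are invertible, so a null vector of F is one of
the right factor, and its j-th block is an eigenvector of L_j. One block determines the whole null
vector, so independence passes to the blocks (`IsNullSystem.block_eigenvectors`).

Finiteness of S. For |z| = 1 the matrix H(z) = F(z, x) + x is Hermitian, hence annihilated by every
polynomial vanishing on its spectrum. Take q(x, z) vanishing on the zeros of det F, with simple
zeros in z for all but finitely many x. Then q(H(z), z) = 0 on the circle and, by analytic
continuation, for all z ≠ 0. So F(z, x) divides q(x, z) times the identity, F⁻¹ has at most simple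
poles in z for generic x, and simple poles mean equal multiplicities (`exists_geomMult_eq_algMult`).
-/

namespace MatrixRatio

/-! ### Squarefree parts of bivariate polynomials -/

section GenericSeparability

open Polynomial

lemma exists_clear_denominators (g : (FractionRing ℂ[X])[X]) :
    ∃ (g' : ℂ[X][X]) (b : ℂ[X]), b ≠ 0 ∧
      g'.map (algebraMap ℂ[X] (FractionRing ℂ[X])) = C (algebraMap _ _ b) * g := by
  obtain ⟨b, hb, h⟩ := IsLocalization.integerNormalization_spec (nonZeroDivisors ℂ[X]) g
  refine ⟨_, b, nonZeroDivisors.ne_zero hb, h.trans ?_⟩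
  rw [← Polynomial.smul_eq_C_mul, algebraMap_smul]

/-- The zero set of a nonzero bivariate polynomial `f` is contained in the zero set of a bivariate
polynomial `q` whose zeros in the second variable are simple for almost all values of the first. -/
lemma exists_generically_separable (f : ℂ[X][X]) (hf : f ≠ 0) :
    ∃ (q : ℂ[X][X]) (w : ℂ[X]), w ≠ 0 ∧
      (∀ x z, (f.map (evalRingHom x)).eval z = 0 → (q.map (evalRingHom x)).eval z = 0) ∧
      ∀ x, w.eval x ≠ 0 → ∀ z, (q.map (evalRingHom x)).eval z = 0 →
        (derivative (q.map (evalRingHom x))).eval z ≠ 0 := by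
  classical
  let φ : ℂ[X] →+* FractionRing ℂ[X] := algebraMap _ _
  have hφ : Function.Injective φ := IsFractionRing.injective _ _
  have hφm : Function.Injective (Polynomial.map φ) := Polynomial.map_injective _ hφ
  have hF : f.map φ ≠ 0 := (Polynomial.map_ne_zero_iff hφ).2 hf
  -- Over the field of fractions the radical is squarefree, hence separable in characteristic zero.
  -- Two identities survive clearing denominators: f divides a power of q0 (`e1`), and the Bézout
  -- relation of q0 with its derivative (`e2`).
  set q0 := UniqueFactorizationMonoid.radical (f.map φ) with hq0
  obtain ⟨m, h0, hm⟩ := UniqueFactorizationMonoid.exists_dvd_radical_self_pow hF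
  have hsep : q0.Separable := PerfectField.separable_iff_squarefree.2
    UniqueFactorizationMonoid.squarefree_radical
  obtain ⟨u0, v0, huv⟩ := hsep
  obtain ⟨q1, b1, hb1, hq1⟩ := exists_clear_denominators q0
  obtain ⟨h1, b2, hb2, hh1⟩ := exists_clear_denominators h0
  obtain ⟨u1, c1, hc1, hu1⟩ := exists_clear_denominators u0
  obtain ⟨v1, c2, hc2, hv1⟩ := exists_clear_denominators v0
  have e1 : f * h1 * C b1 ^ m = C b2 * q1 ^ m := by
    apply hφm
    simp only [Polynomial.map_mul, Polynomial.map_pow, Polynomial.map_C]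
    simp only [φ] at hm ⊢
    rw [hq1, hh1, mul_pow, ← hq0] at *
    rw [hm]; ring
  have e2 : C c2 * u1 * q1 + C c1 * v1 * derivative q1 = C (c1 * c2 * b1) := by
    apply hφm
    simp only [Polynomial.map_mul, Polynomial.map_add, Polynomial.map_C, ← Polynomial.derivative_map]
    simp only [φ]
    rw [hq1, hu1, hv1, derivative_C_mul]
    simp only [map_mul]
    linear_combination (C (algebraMap ℂ[X] (FractionRing ℂ[X]) c1) * C (algebraMap ℂ[X] (FractionRing ℂ[X]) c2) * C (algebraMap ℂ[X] (FractionRing ℂ[X]) b1)) * huv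
  -- At zeros of b2 the identity `e1` says nothing about q1. The extra factor b2 makes q vanish
  -- there for every z, so the inclusion of zero sets holds for all x, and w excludes those x from
  -- the simplicity claim.
  refine ⟨C b2 * q1, b2 * (c1 * c2 * b1), by simp [*], ?_, ?_⟩
  · intro x z hz
    have := congrArg (fun t => (Polynomial.map (evalRingHom x) t).eval z) e1
    simp only [Polynomial.map_mul, eval_mul, hz, zero_mul, Polynomial.map_pow, eval_pow] at this
    simp only [Polynomial.map_mul, eval_mul]
    rcases mul_eq_zero.1 this.symm with h | h
    · rw [h, zero_mul]
    · rw [eq_zero_of_pow_eq_zero h, mul_zero]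
  · intro x hw z hz hd
    have := congrArg (fun t => (Polynomial.map (evalRingHom x) t).eval z) e2
    simp only [Polynomial.map_mul, Polynomial.map_add, eval_add, eval_mul, Polynomial.map_C,
      eval_C, coe_evalRingHom, ← Polynomial.derivative_map] at this hw hz hd
    rw [derivative_C_mul, eval_mul, eval_C] at hd
    have hb : b2.eval x ≠ 0 := left_ne_zero_of_mul hw
    rw [(mul_eq_zero.1 hz).resolve_left hb, (mul_eq_zero.1 hd).resolve_left hb] at this
    apply right_ne_zero_of_mul hw
    rw [← this]; ring

end GenericSeparability

/-! ### Simple poles of the inverse and equality of multiplicities -/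

section Multiplicity

variable {n : Type*} [Fintype n]

open Polynomial

lemma eval_divByMonic_eq_derivative (p : ℂ[X]) (z : ℂ) :
    (p /ₘ (X - C z)).eval z = (derivative p).eval z := by
  have h := congrArg (fun t => (derivative t).eval z) (X_sub_C_mul_divByMonic_eq_sub_modByMonic p z)
  simp only [derivative_mul, modByMonic_X_sub_C_eq_C_eval] at h
  simpa using h

/-- There is a basis of `ℂⁿ` indexed by `n`, a part of which is a basis of a given subspace. -/
lemma exists_basis_adapted (K : Submodule ℂ (n → ℂ)) :
    ∃ (b : Module.Basis n ℂ (n → ℂ)) (s : n → Prop), (∀ i, s i → b i ∈ K) ∧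
      Nat.card {i // s i} = Module.finrank ℂ K ∧
      K ≤ Submodule.span ℂ (b '' {i | s i}) := by
  obtain ⟨K', hK⟩ := K.exists_isCompl
  let bK := Module.finBasis ℂ K
  let bK' := Module.finBasis ℂ K'
  let b0 := (bK.prod bK').map (Submodule.prodEquivOfIsCompl K K' hK)
  have hcard : Fintype.card (Fin (Module.finrank ℂ K) ⊕ Fin (Module.finrank ℂ K')) =
      Fintype.card n := by
    rw [← Module.finrank_eq_card_basis b0, Module.finrank_fintype_fun_eq_card]
  let σ := Fintype.equivOfCardEq hcard
  have hb0 : ∀ i, b0 (Sum.inl i) = bK i := fun i => by simp [b0]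
  refine ⟨b0.reindex σ, fun i => ∃ k, σ.symm i = Sum.inl k, ?_, ?_, ?_⟩
  · rintro i ⟨k, hk⟩
    rw [Module.Basis.reindex_apply, hk, hb0]
    exact (bK k).2
  · refine Eq.trans ?_ (Nat.card_fin _)
    refine Nat.card_congr (Equiv.ofBijective
      (fun k : Fin _ => (⟨σ (Sum.inl k), k, by simp⟩ : {i // ∃ k, σ.symm i = Sum.inl k}))
      ⟨fun k l h => ?_, ?_⟩).symm
    · simpa using h
    · rintro ⟨i, k, hk⟩
      exact ⟨k, by simp [← hk]⟩
  · intro y hy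
    have h := congrArg (Submodule.subtype K) (bK.sum_repr ⟨y, hy⟩)
    simp only [map_sum, map_smul, Submodule.subtype_apply] at h
    rw [← h]
    refine Submodule.sum_mem _ fun k _ => Submodule.smul_mem _ _ (Submodule.subset_span ?_)
    exact ⟨σ (Sum.inl k), ⟨k, by simp⟩, by simp [hb0]⟩

/-- If a polynomial matrix `G` has, to first order at `z`, a right inverse with a simple pole, then
the order of the zero `z` of `det G` is the dimension of the null space of `G z`. -/
lemma rootMultiplicity_det_eq_finrank_ker [DecidableEq n] (G : Matrix n n ℂ[X]) (z : ℂ) (N₀ N₁ : Matrix n n ℂ)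
    (h₀ : G.map (eval z) * N₀ = 0)
    (h₁ : IsUnit (G.map (fun p => (derivative p).eval z) * N₀ + G.map (eval z) * N₁).det) :
    G.det.rootMultiplicity z = Module.finrank ℂ (LinearMap.ker (G.map (eval z)).mulVecLin) := by
  classical
  set G₀ := G.map (eval z) with hG₀
  set G₁ := G.map (fun p => (derivative p).eval z) with hG₁
  set K := LinearMap.ker G₀.mulVecLin with hK
  obtain ⟨b, s, hbs, hcard, hspan⟩ := exists_basis_adapted K
  let B : Matrix n n ℂ := Matrix.of fun i j => b j i
  have hBdet : IsUnit B.det := by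
    have : B = (Pi.basisFun ℂ n).toMatrix b := by
      ext i j; simp [B, Module.Basis.toMatrix_apply]
    rw [this]
    have := (Pi.basisFun ℂ n).invertibleToMatrix b
    exact Matrix.isUnit_det_of_invertible _
  let GB : Matrix n n ℂ[X] := G * B.map C
  have hGBe : ∀ i j, (GB i j).eval z = (G₀ *ᵥ b j) i := by
    intro i j
    simp [GB, Matrix.mul_apply, Matrix.mulVec, dotProduct, eval_finsetSum, B, hG₀]
  have hGBd : ∀ i j, (derivative (GB i j)).eval z = (G₁ *ᵥ b j) i := by
    intro i j
    simp [GB, Matrix.mul_apply, Matrix.mulVec, dotProduct, eval_finsetSum, B, hG₁]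
  -- In a basis adapted to the kernel K of G z, the columns belonging to K vanish at z. Pulling X -
  -- z out of each of them leaves `Gt`, and the order of the zero of det G is dim K exactly when det
  -- `Gt` does not vanish at z.
  let Gt : Matrix n n ℂ[X] := Matrix.of fun i j => if s j then GB i j /ₘ (X - C z) else GB i j
  have hfac : GB = Gt * Matrix.diagonal (fun j => if s j then X - C z else 1) := by
    ext1 i j
    rw [Matrix.mul_diagonal]
    by_cases hs : s j
    · simp only [Gt, hs, if_true, Matrix.of_apply]
      rw [mul_comm, mul_divByMonic_eq_iff_isRoot.2]
      rw [IsRoot.def, hGBe]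
      have := hbs j hs
      rw [hK, LinearMap.mem_ker, Matrix.mulVecLin_apply] at this
      rw [this]; rfl
    · simp [Gt, hs]
  -- A left null vector y of `Gt` at z annihilates the range of G₀ and the image G₁ K. The columns
  -- of N₀ lie in K, so y would annihilate the invertible matrix G₁ N₀ + G₀ N₁.
  have hGt : (Gt.det).eval z ≠ 0 := by
    rw [← coe_evalRingHom, RingHom.map_det, RingHom.mapMatrix_apply]
    intro hdet
    obtain ⟨y, hy0, hy⟩ := Matrix.exists_vecMul_eq_zero_iff.2 hdet
    have hcol : ∀ j, y ⬝ᵥ (if s j then G₁ *ᵥ b j else G₀ *ᵥ b j) = 0 := by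
      intro j
      have := congrFun hy j
      simp only [Matrix.vecMul, Pi.zero_apply] at this
      rw [← this]
      congr 1
      ext i
      by_cases hs : s j
      · simp [Gt, hs, eval_divByMonic_eq_derivative, hGBd]
      · simp [Gt, hs, hGBe]
    have hyG₀ : y ᵥ* G₀ = 0 := by
      have : y ᵥ* (G₀ * B) = 0 := by
        ext j
        have e : (y ᵥ* (G₀ * B)) j = y ⬝ᵥ (G₀ *ᵥ b j) := by
          simp only [Matrix.vecMul]; congr 1
        rw [e]
        by_cases hs : s j
        · have := hbs j hs
          rw [hK, LinearMap.mem_ker, Matrix.mulVecLin_apply] at this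
          simp [this]
        · simpa [hs] using hcol j
      rw [← Matrix.vecMul_vecMul] at this
      have h2 := congrArg (fun t => t ᵥ* B⁻¹) this
      simpa [Matrix.vecMul_vecMul, Matrix.mul_nonsing_inv_cancel_right _ _ hBdet] using h2
    have hyG₁ : ∀ w ∈ K, y ⬝ᵥ (G₁ *ᵥ w) = 0 := by
      intro w hw
      refine Submodule.span_induction ?_ ?_ ?_ ?_ (hspan hw)
      · rintro _ ⟨j, hj, rfl⟩
        have := hcol j
        rwa [if_pos (show s j from hj)] at this
      · simp
      · intro u v _ _ hu hv
        simp [Matrix.mulVec_add, hu, hv]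
      · intro c u _ hu
        simp [Matrix.mulVec_smul, hu]
    have hfin : y ᵥ* (G₁ * N₀ + G₀ * N₁) = 0 := by
      rw [Matrix.vecMul_add, ← Matrix.vecMul_vecMul y G₀, hyG₀, Matrix.zero_vecMul, add_zero]
      ext j
      have : N₀.col j ∈ K := by
        rw [hK, LinearMap.mem_ker, Matrix.mulVecLin_apply]
        ext i
        exact congrFun (congrFun h₀ i) j
      exact hyG₁ _ this
    apply hy0
    have h2 := congrArg (fun t => t ᵥ* (G₁ * N₀ + G₀ * N₁)⁻¹) hfin
    simpa [Matrix.vecMul_vecMul, Matrix.mul_nonsing_inv _ h₁] using h2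
  have hdet : G.det * C B.det = Gt.det * (X - C z) ^ (Module.finrank ℂ K) := by
    have h1 := congrArg Matrix.det hfac
    rw [Matrix.det_mul, Matrix.det_mul, Matrix.det_diagonal] at h1
    have h2 : (B.map C).det = C B.det := by
      rw [RingHom.map_det, RingHom.mapMatrix_apply]
    rw [h2] at h1
    rw [h1, Finset.prod_ite, Finset.prod_const_one, mul_one, Finset.prod_const, ← hcard,
      Nat.card_eq_fintype_card, Fintype.card_subtype]
  have hGt0 : Gt.det ≠ 0 := by
    intro h; rw [h] at hGt; simp at hGt
  have hB0 : B.det ≠ 0 := hBdet.ne_zero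
  have hne : Gt.det * (X - C z) ^ (Module.finrank ℂ K) ≠ 0 :=
    mul_ne_zero hGt0 (pow_ne_zero _ (X_sub_C_ne_zero z))
  have h3 := rootMultiplicity_mul (x := z) hne
  rw [rootMultiplicity_X_sub_C_pow, rootMultiplicity_eq_zero (p := Gt.det) hGt, zero_add,
    ← hdet, rootMultiplicity_mul (hdet ▸ hne), rootMultiplicity_C, add_zero] at h3
  exact h3

end Multiplicity
end MatrixRatio

namespace MatrixRatio

/-! ### The symbol as a polynomial matrix, Hermitian on the unit circle -/

section Symbol

open Polynomial

variable {r p : ℕ} (a b : Fin p → Matrix (Fin r) (Fin r) ℂ)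

lemma tridiag_isHermitian (hb : ∀ i, (b i).IsHermitian) : (tridiag a b).IsHermitian := by
  ext ⟨i, k⟩ ⟨j, l⟩
  simp only [Matrix.conjTranspose_apply, tridiag, star_add]
  have h1 : star (if j = i then b j l k else 0) = if i = j then b i k l else 0 := by
    by_cases h : i = j
    · subst h; simpa using (hb i).apply k l
    · simp [h, Ne.symm h]
  have h2 : star (if (j : ℕ) + 1 = i then a i l k else 0) =
      if (i : ℕ) = (j : ℕ) + 1 then star (a i l k) else 0 := by
    by_cases h : (i : ℕ) = (j : ℕ) + 1
    · simp [h]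
    · simp [h, Ne.symm h]
  have h3 : star (if (j : ℕ) = (i : ℕ) + 1 then star (a j k l) else 0) =
      if (i : ℕ) + 1 = j then a j k l else 0 := by
    by_cases h : (i : ℕ) + 1 = j
    · simp [h]
    · simp [h, Ne.symm h]
  rw [h1, h2, h3]
  ring

/-- The symbol without the spectral parameter, `F(z, x) + x`. -/
noncomputable def floquetMatrix (z : ℂ) : Matrix (Fin p × Fin r) (Fin p × Fin r) ℂ :=
  tridiag a b + z • (corner a)ᴴ + z⁻¹ • corner a

lemma symbol_eq_floquetMatrix_sub (z x : ℂ) :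
    symbol a b z x = floquetMatrix a b z - x • 1 := by
  rw [symbol, floquetMatrix]; abel

/-- On the unit circle z⁻¹ is the conjugate of z, so the two corner terms are adjoint to each other.
-/
lemma floquetMatrix_isHermitian (hb : ∀ i, (b i).IsHermitian) (z : ℂ) (hz : ‖z‖ = 1) :
    (floquetMatrix a b z).IsHermitian := by
  have hinv : z⁻¹ = star z := by
    rw [Complex.inv_def, Complex.normSq_eq_norm_sq, hz]; simp
  rw [Matrix.IsHermitian, floquetMatrix, Matrix.conjTranspose_add, Matrix.conjTranspose_add,
    (tridiag_isHermitian a b hb).eq, Matrix.conjTranspose_smul, Matrix.conjTranspose_smul,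
    Matrix.conjTranspose_conjTranspose, hinv, star_star]
  abel

/-- The root polynomial as a polynomial with polynomial coefficients in the parameter `x`. -/
noncomputable def rootPolyParam : ℂ[X][X] :=
  (Matrix.diagonal (fun s : Fin p × Fin r => if (s.1 : ℕ) + 1 = p then (X : ℂ[X][X]) else 1)
      * ((tridiag a b).map (fun c => C (C c)) -
          (C X : ℂ[X][X]) • (1 : Matrix (Fin p × Fin r) (Fin p × Fin r) ℂ[X][X])
        + (X : ℂ[X][X]) • ((corner a)ᴴ).map (fun c => C (C c)))
    + (corner a).map (fun c => C (C c))).det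

/-- The polynomial matrix `diag(1, …, 1, Z) F(Z, x)` in the variable `Z`. -/
noncomputable def symbolPoly (x : ℂ) : Matrix (Fin p × Fin r) (Fin p × Fin r) ℂ[X] :=
  Matrix.diagonal (fun s : Fin p × Fin r => if (s.1 : ℕ) + 1 = p then (X : ℂ[X]) else 1)
      * ((tridiag a b - x • (1 : Matrix (Fin p × Fin r) (Fin p × Fin r) ℂ)).map C
        + (X : ℂ[X]) • ((corner a)ᴴ).map C)
    + (corner a).map C

lemma rootPoly_eq_det_symbolPoly (x : ℂ) : rootPoly a b x = (symbolPoly a b x).det := rfl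

lemma rootPolyParam_map (x : ℂ) :
    (rootPolyParam a b).map (evalRingHom x) = rootPoly a b x := by
  rw [rootPolyParam, rootPoly, ← Polynomial.coe_mapRingHom, RingHom.map_det]
  congr 1
  ext1 s t
  rw [RingHom.mapMatrix_apply, Matrix.map_apply]
  simp only [Matrix.map_apply, Matrix.add_apply, Matrix.diagonal_mul, Matrix.sub_apply,
    Matrix.smul_apply, smul_eq_mul, coe_mapRingHom, Polynomial.map_add, Polynomial.map_mul,
    Polynomial.map_sub, Polynomial.map_C, Polynomial.map_X, coe_evalRingHom, eval_C, eval_X]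
  have h1 : ((1 : Matrix (Fin p × Fin r) (Fin p × Fin r) ℂ[X][X]) s t).map (evalRingHom x) =
      if s = t then 1 else 0 := by
    rw [Matrix.one_apply]; split_ifs <;> simp
  have h2 : (if (s.1 : ℕ) + 1 = p then (X : ℂ[X][X]) else 1).map (evalRingHom x) =
      if (s.1 : ℕ) + 1 = p then X else 1 := by
    split_ifs <;> simp
  rw [h1, h2, Matrix.one_apply]
  split_ifs <;> simp

lemma symbolPoly_map_eval (x z : ℂ) (hz : z ≠ 0) :
    (symbolPoly a b x).map (eval z) =
      Matrix.diagonal (fun s : Fin p × Fin r => if (s.1 : ℕ) + 1 = p then z else 1) *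
        symbol a b z x := by
  ext s t
  simp only [symbolPoly, symbol, Matrix.diagonal_mul, Matrix.add_apply, Matrix.smul_apply,
    smul_eq_mul, Matrix.map_apply, eval_add, eval_mul, eval_C, eval_X]
  by_cases h : (s.1 : ℕ) + 1 = p
  · simp only [h, if_true, eval_X]
    field_simp
  · simp [h, corner]

lemma isUnit_det_diagonal_last (z : ℂ) (hz : z ≠ 0) :
    IsUnit (Matrix.diagonal
      (fun s : Fin p × Fin r => if (s.1 : ℕ) + 1 = p then z else 1)).det := by
  rw [Matrix.det_diagonal, isUnit_iff_ne_zero, Finset.prod_ne_zero_iff]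
  intro s _
  split_ifs <;> simp [hz]

lemma geomMult_eq_finrank_ker_symbolPoly (x z : ℂ) (hz : z ≠ 0) :
    geomMult a b z x =
      Module.finrank ℂ (LinearMap.ker ((symbolPoly a b x).map (eval z)).mulVecLin) := by
  have hD := isUnit_det_diagonal_last (r := r) (p := p) z hz
  have : LinearMap.ker ((symbolPoly a b x).map (eval z)).mulVecLin =
      LinearMap.ker (symbol a b z x).mulVecLin := by
    ext v
    rw [LinearMap.mem_ker, LinearMap.mem_ker, Matrix.mulVecLin_apply, Matrix.mulVecLin_apply,
      symbolPoly_map_eval a b x z hz, ← Matrix.mulVec_mulVec]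
    constructor
    · intro h
      have h2 := congrArg (fun t => (Matrix.diagonal
        (fun s : Fin p × Fin r => if (s.1 : ℕ) + 1 = p then z else 1))⁻¹ *ᵥ t) h
      simpa only [Matrix.mulVec_mulVec, ← Matrix.mul_assoc, Matrix.nonsing_inv_mul _ hD,
        Matrix.one_mul, Matrix.mulVec_zero, Matrix.one_mulVec] using h2
    · intro h
      rw [h, Matrix.mulVec_zero]
  rw [this, geomMult]

end Symbol

section Hermitian

open Polynomial

variable {n : Type*} [Fintype n] [DecidableEq n]

lemma aeval_mulVec_of_mulVec_eq_smul {A : Matrix n n ℂ} {μ : ℂ} {w : n → ℂ}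
    (h : A *ᵥ w = μ • w) (g : ℂ[X]) : aeval A g *ᵥ w = g.eval μ • w := by
  induction g using Polynomial.induction_on' with
  | add f g hf hg => simp [Matrix.add_mulVec, hf, hg, add_smul]
  | monomial k c =>
    have hk : A ^ k *ᵥ w = μ ^ k • w := by
      induction k with
      | zero => simp
      | succ k ih => rw [pow_succ', ← Matrix.mulVec_mulVec, ih, Matrix.mulVec_smul, h, smul_smul,
          pow_succ]
    rw [aeval_monomial, ← Matrix.mulVec_mulVec, hk, eval_monomial, Algebra.algebraMap_eq_smul_one]
    simp [smul_smul, Matrix.smul_mulVec]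

/-- Diagonalizability makes zeros of g on the spectrum sufficient, without regard to multiplicity.
This improves on Cayley–Hamilton and allows det F to be replaced by a squarefree polynomial. -/
lemma aeval_eq_zero_of_isHermitian {A : Matrix n n ℂ} (hA : A.IsHermitian) (g : ℂ[X])
    (hg : ∀ μ : ℂ, (A - μ • (1 : Matrix n n ℂ)).det = 0 → g.eval μ = 0) : aeval A g = 0 := by
  have key : aeval A g * (hA.eigenvectorUnitary : Matrix n n ℂ) = 0 := by
    ext i j
    have hj := hA.mulVec_eigenvectorBasis j
    have hj' : A *ᵥ (hA.eigenvectorBasis j).ofLp =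
        ((hA.eigenvalues j : ℝ) : ℂ) • (hA.eigenvectorBasis j).ofLp := by
      rw [hj]; rfl
    have hdet : (A - ((hA.eigenvalues j : ℝ) : ℂ) • (1 : Matrix n n ℂ)).det = 0 := by
      refine Matrix.exists_mulVec_eq_zero_iff.1 ⟨(hA.eigenvectorBasis j).ofLp, ?_, ?_⟩
      · intro h0
        have := hA.eigenvectorBasis.orthonormal.1 j
        rw [show hA.eigenvectorBasis j = 0 from by ext i; exact congrFun h0 i] at this
        simp at this
      · rw [Matrix.sub_mulVec, hj', Matrix.smul_mulVec, Matrix.one_mulVec, sub_self]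
    have h := aeval_mulVec_of_mulVec_eq_smul hj' g
    rw [hg _ hdet, zero_smul] at h
    have h2 := congrFun h i
    rw [Matrix.mul_apply]
    simpa [Matrix.mulVec, dotProduct, Matrix.IsHermitian.eigenvectorUnitary_apply] using h2
  have hU : (hA.eigenvectorUnitary : Matrix n n ℂ) * star (hA.eigenvectorUnitary : Matrix n n ℂ)
      = 1 := Unitary.mul_star_self_of_mem hA.eigenvectorUnitary.2
  calc aeval A g = aeval A g * ((hA.eigenvectorUnitary : Matrix n n ℂ) *
        star (hA.eigenvectorUnitary : Matrix n n ℂ)) := by rw [hU, mul_one]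
    _ = 0 := by rw [← mul_assoc, key, zero_mul]

end Hermitian

/-! ### Geometric and algebraic multiplicity agree for generic x -/

section Exceptional

open Polynomial
open scoped Matrix.Norms.L2Operator

variable {r p : ℕ} (a b : Fin p → Matrix (Fin r) (Fin r) ℂ)

lemma differentiableAt_aeval_floquetMatrix (g : ℂ[X]) {z : ℂ} (hz : z ≠ 0)
    (s t : Fin p × Fin r) :
    DifferentiableAt ℂ (fun z => aeval (floquetMatrix a b z) g s t) z := by
  have hH : DifferentiableAt ℂ (fun z => floquetMatrix a b z) z := by
    unfold floquetMatrix
    refine DifferentiableAt.add (DifferentiableAt.add (differentiableAt_const _)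
      (differentiableAt_id.smul_const _)) ((differentiableAt_inv hz).smul_const _)
  have h : DifferentiableAt ℂ (fun z => aeval (floquetMatrix a b z) g) z := by
    simp only [aeval_eq_sum_range]
    exact DifferentiableAt.fun_sum fun i _ => (hH.fun_pow i).fun_const_smul _
  exact ((Matrix.entryLinearMap ℂ ℂ s t).toContinuousLinearMap.differentiableAt).comp z h

/-- The value at the matrix `F(z, x) + x` of a bivariate polynomial in `x` (inner variable)
and `z` (outer variable). -/
noncomputable def floquetEval (q : ℕ → ℂ[X]) (N : ℕ) (z : ℂ) :
    Matrix (Fin p × Fin r) (Fin p × Fin r) ℂ :=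
  ∑ i ∈ Finset.range N, z ^ i • aeval (floquetMatrix a b z) (q i)

lemma differentiableAt_floquetEval (q : ℕ → ℂ[X]) (N : ℕ) {z : ℂ} (hz : z ≠ 0)
    (s t : Fin p × Fin r) :
    DifferentiableAt ℂ (fun z => floquetEval a b q N z s t) z := by
  simp only [floquetEval, Matrix.sum_apply, Matrix.smul_apply, smul_eq_mul]
  exact DifferentiableAt.fun_sum fun i _ =>
    (differentiableAt_id.fun_pow i).fun_mul (differentiableAt_aeval_floquetMatrix a b (q i) hz s t)

lemma frequently_norm_eq_one : ∃ᶠ z : ℂ in 𝓝[≠] 1, ‖z‖ = 1 := by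
  have hc : Tendsto (fun t : ℝ => Complex.exp (t * Complex.I)) (𝓝[≠] 0) (𝓝[≠] 1) := by
    rw [tendsto_nhdsWithin_iff]
    constructor
    · have : Continuous fun t : ℝ => Complex.exp (t * Complex.I) := by fun_prop
      have := this.tendsto 0
      simp only [Complex.ofReal_zero, zero_mul, Complex.exp_zero] at this
      exact this.mono_left nhdsWithin_le_nhds
    · have hlt : ∀ᶠ t : ℝ in 𝓝[≠] 0, |t| < 1 := by
        refine nhdsWithin_le_nhds ?_
        exact (continuous_abs.tendsto (0 : ℝ)).eventually (gt_mem_nhds (by simp))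
      filter_upwards [hlt, self_mem_nhdsWithin] with t ht ht0
      intro h1
      obtain ⟨n, hn⟩ := Complex.exp_eq_one_iff.1 (Set.mem_singleton_iff.1 h1)
      have h2 : (t : ℂ) = n * (2 * Real.pi) := by
        have := Complex.I_ne_zero
        field_simp at hn
        linear_combination hn
      have h3 : t = n * (2 * Real.pi) := by exact_mod_cast h2
      have hn0 : n ≠ 0 := by rintro rfl; simp at h3; exact ht0 h3
      have : (1 : ℝ) ≤ |(n : ℝ)| := by exact_mod_cast Int.one_le_abs hn0
      rw [h3, abs_mul, abs_of_pos (a := 2 * Real.pi) (by positivity)] at ht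
      nlinarith [Real.pi_gt_three]
  exact hc.frequently (Eventually.frequently (Eventually.of_forall fun t =>
    Complex.norm_exp_ofReal_mul_I t))

/-- The entries are analytic on the punctured plane, which is connected, and the circle accumulates
at 1: the identity theorem applies. -/
lemma floquetEval_eq_zero (q : ℕ → ℂ[X]) (N : ℕ)
    (h : ∀ z : ℂ, ‖z‖ = 1 → floquetEval a b q N z = 0) (z : ℂ) (hz : z ≠ 0) :
    floquetEval a b q N z = 0 := by
  ext s t
  have hd : DifferentiableOn ℂ (fun z => floquetEval a b q N z s t) {0}ᶜ := fun z hz =>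
    (differentiableAt_floquetEval a b q N hz s t).differentiableWithinAt
  have ha := hd.analyticOnNhd isOpen_compl_singleton
  have hconn : IsPreconnected ({0}ᶜ : Set ℂ) :=
    (isConnected_compl_singleton_of_one_lt_rank (by simp) 0).isPreconnected
  refine ha.eqOn_of_preconnected_of_frequently_eq (analyticOnNhd_const (v := (0 : ℂ))) hconn
    (z₀ := 1) (by simp) ?_ hz
  exact frequently_norm_eq_one.mono fun z hz => by rw [h z hz]; rfl

/-- Write q_i = (X - x) g_i + q_i(x) and substitute H = F + x for X. Since q annihilates H, F times
the sum of zⁱ g_i(H) is -q(x, z); hence the minus sign. The result is an adjugate of F relative to q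
instead of det F. -/
lemma symbol_mul_floquetEval_divByMonic (q : ℕ → ℂ[X]) (N : ℕ) (x z : ℂ)
    (h : floquetEval a b q N z = 0) :
    symbol a b z x * floquetEval a b (fun i => -(q i /ₘ (X - C x))) N z =
      (∑ i ∈ Finset.range N, z ^ i * (q i).eval x) • 1 := by
  have key : ∀ i, symbol a b z x * aeval (floquetMatrix a b z) (-(q i /ₘ (X - C x))) =
      (q i).eval x • 1 - aeval (floquetMatrix a b z) (q i) := by
    intro i
    have h1 := congrArg (aeval (floquetMatrix a b z))
      (X_sub_C_mul_divByMonic_eq_sub_modByMonic (q i) x)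
    rw [map_mul, map_sub, map_sub, aeval_X, aeval_C, modByMonic_X_sub_C_eq_C_eval, aeval_C,
      Algebra.algebraMap_eq_smul_one, Algebra.algebraMap_eq_smul_one, ← symbol_eq_floquetMatrix_sub] at h1
    rw [map_neg, mul_neg, h1, neg_sub]
  simp only [floquetEval] at h ⊢
  rw [Finset.mul_sum]
  simp only [Matrix.mul_smul, key, smul_sub, Finset.sum_sub_distrib, h, sub_zero, smul_smul,
    Finset.sum_smul]

/-- The geometric and the algebraic multiplicity agree at all roots outside a finite set of
parameters. -/
theorem exists_geomMult_eq_algMult (hb : ∀ i, (b i).IsHermitian) (hne : rootPolyParam a b ≠ 0)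
    (hp : 0 < p) :
    ∃ w : ℂ[X], w ≠ 0 ∧ ∀ x, w.eval x ≠ 0 → ∀ z, z ≠ 0 → (rootPoly a b x).eval z = 0 →
      geomMult a b z x = algMult a b z x := by
  obtain ⟨q, w, hw, hroot, hsep⟩ := exists_generically_separable _ hne
  simp only [rootPolyParam_map] at hroot
  set N := q.natDegree + 1 with hN
  have hqeval : ∀ x z, (q.map (evalRingHom x)).eval z =
      ∑ i ∈ Finset.range N, z ^ i * (q.coeff i).eval x := by
    intro x z
    rw [eval_eq_sum_range' (n := N) (Nat.lt_succ_of_le natDegree_map_le)]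
    refine Finset.sum_congr rfl fun i _ => ?_
    rw [coeff_map, coe_evalRingHom, mul_comm]
  have hunit : ∀ z : ℂ, ‖z‖ = 1 → floquetEval a b q.coeff N z = 0 := by
    intro z hz
    have hz0 : z ≠ 0 := by rintro rfl; simp at hz
    have h1 : floquetEval a b q.coeff N z =
        aeval (floquetMatrix a b z) (∑ i ∈ Finset.range N, C (z ^ i) * q.coeff i) := by
      rw [map_sum, floquetEval]
      refine Finset.sum_congr rfl fun i _ => ?_
      rw [map_mul, aeval_C, Algebra.algebraMap_eq_smul_one, Matrix.smul_mul, Matrix.one_mul]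
    rw [h1]
    refine aeval_eq_zero_of_isHermitian (floquetMatrix_isHermitian a b hb z hz) _ fun μ hμ => ?_
    rw [← symbol_eq_floquetMatrix_sub] at hμ
    have h2 := hroot μ z (by rw [eval_rootPoly a b hp μ z hz0, hμ, mul_zero])
    rw [hqeval] at h2
    simpa [eval_finsetSum] using h2
  have hzero := floquetEval_eq_zero a b q.coeff N hunit
  refine ⟨w, hw, fun x hx z hz hrt => ?_⟩
  set qx := q.map (evalRingHom x) with hqx
  have hqz : qx.eval z = 0 := hroot x z hrt
  have hqz' : (derivative qx).eval z ≠ 0 := hsep x hx z hqz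
  set Nf : ℂ → Matrix (Fin p × Fin r) (Fin p × Fin r) ℂ :=
    floquetEval a b (fun i => -(q.coeff i /ₘ (X - C x))) N with hNf
  have hmul : ∀ y : ℂ, y ≠ 0 → (symbolPoly a b x).map (eval y) * Nf y =
      qx.eval y • Matrix.diagonal
        (fun s : Fin p × Fin r => if (s.1 : ℕ) + 1 = p then y else 1) := by
    intro y hy
    rw [symbolPoly_map_eval a b x y hy, Matrix.mul_assoc, hNf,
      symbol_mul_floquetEval_divByMonic a b q.coeff N x y (hzero y hy), ← hqeval, Matrix.mul_smul,
      Matrix.mul_one]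
  -- N₁ is the derivative of `Nf` at z. Differentiating `hmul` at z, where q(x, ·) vanishes, removes
  -- the derivative of the diagonal factor and leaves q' times an invertible matrix: this is the
  -- first-order hypothesis of `rootMultiplicity_det_eq_finrank_ker`.
  let N₁ : Matrix (Fin p × Fin r) (Fin p × Fin r) ℂ :=
    Matrix.of fun s t => deriv (fun y => Nf y s t) z
  have h₁ : (symbolPoly a b x).map (fun f => (derivative f).eval z) * Nf z +
      (symbolPoly a b x).map (eval z) * N₁ = (derivative qx).eval z • Matrix.diagonal
        (fun s : Fin p × Fin r => if (s.1 : ℕ) + 1 = p then z else 1) := by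
    ext s t
    have hL : HasDerivAt (fun y => ∑ u, (symbolPoly a b x s u).eval y * Nf y u t)
        (∑ u, ((derivative (symbolPoly a b x s u)).eval z * Nf z u t +
          (symbolPoly a b x s u).eval z * N₁ u t)) z :=
      HasDerivAt.fun_sum fun u _ => ((symbolPoly a b x s u).hasDerivAt z).fun_mul
        (differentiableAt_floquetEval a b _ N hz u t).hasDerivAt
    have hdiag : ∃ c, HasDerivAt (fun y => Matrix.diagonal
        (fun s : Fin p × Fin r => if (s.1 : ℕ) + 1 = p then y else 1) s t) c z := by
      by_cases hst : s = t
      · subst hst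
        by_cases hs : (s.1 : ℕ) + 1 = p
        · simp only [Matrix.diagonal_apply_eq, hs, if_true]
          exact ⟨_, hasDerivAt_id z⟩
        · simp only [Matrix.diagonal_apply_eq, hs, if_false]
          exact ⟨_, hasDerivAt_const z 1⟩
      · simp only [Matrix.diagonal_apply_ne _ hst]
        exact ⟨_, hasDerivAt_const z 0⟩
    obtain ⟨c, hc⟩ := hdiag
    have hR := (qx.hasDerivAt z).fun_mul hc
    have heq : (fun y => ∑ u, (symbolPoly a b x s u).eval y * Nf y u t) =ᶠ[𝓝 z] fun y =>
        qx.eval y * Matrix.diagonal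
          (fun s : Fin p × Fin r => if (s.1 : ℕ) + 1 = p then y else 1) s t := by
      filter_upwards [isOpen_ne.mem_nhds hz] with y hy
      have := congrFun (congrFun (hmul y hy) s) t
      simpa [Matrix.mul_apply] using this
    have h2 := (hR.congr_of_eventuallyEq heq).unique hL
    rw [hqz, zero_mul, add_zero] at h2
    simp only [Matrix.add_apply, Matrix.mul_apply, Matrix.map_apply, Matrix.smul_apply,
      smul_eq_mul]
    rw [h2, Finset.sum_add_distrib]
  rw [geomMult_eq_finrank_ker_symbolPoly a b x z hz, algMult, rootPoly_eq_det_symbolPoly]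
  refine (rootMultiplicity_det_eq_finrank_ker _ z (Nf z) N₁ ?_ ?_).symm
  · rw [hmul z hz, hqz, zero_smul]
  · rw [h₁, Matrix.det_smul]
    exact (IsUnit.mk0 _ (pow_ne_zero _ hqz')).mul (isUnit_det_diagonal_last z hz)

end Exceptional
end MatrixRatio

namespace MatrixRatio

/-! ### Ordered roots, systems of null vectors, finiteness of the exceptional set -/

section NullSystem

open Polynomial

variable {r p : ℕ} {a b : Fin p → Matrix (Fin r) (Fin r) ℂ} {x : ℂ}

lemma exists_isOrderedRoots (h : (rootPoly a b x).natDegree = 2 * r) :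
    ∃ z, IsOrderedRoots a b x z := by
  have hcard : (rootPoly a b x).roots.card = 2 * r := by
    rw [← (IsAlgClosed.splits _).natDegree_eq_card_roots, h]
  obtain ⟨l, hl⟩ := Quot.exists_rep (rootPoly a b x).roots
  have hl' : (l : Multiset ℂ) = (rootPoly a b x).roots := hl
  have hlen : l.length = 2 * r := by rw [← hcard, ← hl', Multiset.coe_card]
  let f : Fin (2 * r) → ℂ := fun k => l.get (Fin.cast hlen.symm k)
  let σ := Tuple.sort fun k => ‖f k‖
  refine ⟨f ∘ σ, ?_, Tuple.monotone_sort fun k => ‖f k‖⟩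
  rw [← Multiset.map_map, Multiset.map_univ_val_equiv, ← hl']
  have : f = l.get ∘ finCongr hlen.symm := rfl
  rw [this, ← Multiset.map_map, Multiset.map_univ_val_equiv]
  simp [Fin.univ_def]

lemma IsOrderedRoots.card_eq_algMult {z : Fin (2 * r) → ℂ} (hz : IsOrderedRoots a b x z) (ζ : ℂ) :
    Nat.card {l // z l = ζ} = algMult a b ζ x := by
  classical
  rw [algMult, ← count_roots, ← hz.roots_eq, Multiset.count_map, Nat.card_eq_fintype_card,
    Fintype.card_subtype, Finset.card_def, Finset.filter_val]
  simp only [eq_comm]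

lemma IsOrderedRoots.eval_eq_zero {z : Fin (2 * r) → ℂ} (hz : IsOrderedRoots a b x z)
    (k : Fin (2 * r)) : (rootPoly a b x).eval (z k) = 0 := by
  have : z k ∈ (rootPoly a b x).roots := by
    rw [← hz.roots_eq]
    exact Multiset.mem_map_of_mem z (Finset.mem_univ_val k)
  exact isRoot_of_mem_roots this

lemma exists_isNullSystem {z : Fin (2 * r) → ℂ} (hz : IsOrderedRoots a b x z)
    (h : ∀ k, geomMult a b (z k) x = algMult a b (z k) x) : ∃ v, IsNullSystem a b x z v := by
  -- The choice is made once for each value ζ, not for each index, so that all indices with the same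
  -- root draw from one independent family.
  have key : ∀ ζ, ∃ u : {l // z l = ζ} → Fin p × Fin r → ℂ, LinearIndependent ℂ u ∧
      ∀ l, symbol a b ζ x *ᵥ u l = 0 ∧
        ‖(WithLp.toLp 2 (u l) : EuclideanSpace ℂ (Fin p × Fin r))‖ = 1 := by
    intro ζ
    by_cases hζ : ∃ k, z k = ζ
    · obtain ⟨k, rfl⟩ := hζ
      have hc := (hz.card_eq_algMult (z k)).trans (h k).symm
      let bK := Module.finBasis ℂ (LinearMap.ker (symbol a b (z k) x).mulVecLin)
      let e : {l // z l = z k} ≃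
          Fin (Module.finrank ℂ (LinearMap.ker (symbol a b (z k) x).mulVecLin)) :=
        Finite.equivFinOfCardEq hc
      let u : {l // z l = z k} → Fin p × Fin r → ℂ := fun l => (bK (e l) : Fin p × Fin r → ℂ)
      have hu : LinearIndependent ℂ u :=
        (bK.linearIndependent.map' (Submodule.subtype _) (Submodule.ker_subtype _)).comp e
          e.injective
      have hnorm : ∀ l, ‖(WithLp.toLp 2 (u l) : EuclideanSpace ℂ (Fin p × Fin r))‖ ≠ 0 := by
        intro l h0
        have := norm_eq_zero.1 h0
        exact hu.ne_zero l (by simpa using this)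
      let w : {l // z l = z k} → ℂˣ := fun l => Units.mk0
        ((‖(WithLp.toLp 2 (u l) : EuclideanSpace ℂ (Fin p × Fin r))‖ : ℂ)⁻¹)
        (inv_ne_zero (by exact_mod_cast hnorm l))
      refine ⟨w • u, hu.units_smul w, fun l => ⟨?_, ?_⟩⟩
      · have h0 : symbol a b (z k) x *ᵥ u l = 0 := (bK (e l)).2
        change symbol a b (z k) x *ᵥ ((w l : ℂ) • u l) = 0
        rw [Matrix.mulVec_smul, h0, smul_zero]
      · change ‖(WithLp.toLp 2 ((w l : ℂ) • u l) : EuclideanSpace ℂ (Fin p × Fin r))‖ = 1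
        rw [WithLp.toLp_smul, norm_smul]
        simp only [w, Units.val_mk0, norm_inv, Complex.norm_real, norm_norm]
        exact inv_mul_cancel₀ (hnorm l)
    · have : IsEmpty {l // z l = ζ} := ⟨fun l => hζ ⟨l.1, l.2⟩⟩
      exact ⟨fun l => isEmptyElim l, linearIndependent_empty_type, fun l => isEmptyElim l⟩
  choose u hu hu' using key
  refine ⟨fun k => u (z k) ⟨k, rfl⟩, fun k => (hu' _ _).1, fun k => (hu' _ _).2, fun k => ?_, h⟩
  have : (fun k => u (z k) ⟨k, rfl⟩) '' {l | z l = z k} = Set.range (u (z k)) := by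
    have hval : ∀ (ζ : ℂ) (l : {l // z l = ζ}), u (z l.1) ⟨l.1, rfl⟩ = u ζ l := by
      rintro _ ⟨l, rfl⟩; rfl
    ext y
    constructor
    · rintro ⟨l, hl, rfl⟩
      exact ⟨⟨l, hl⟩, (hval _ ⟨l, hl⟩).symm⟩
    · rintro ⟨l, rfl⟩
      exact ⟨l.1, l.2, hval _ l⟩
  rw [this, finrank_span_eq_card (hu (z k)), h k, ← Nat.card_eq_fintype_card,
    hz.card_eq_algMult]

lemma IsNullSystem.linearIndependent {z : Fin (2 * r) → ℂ} {v : Fin (2 * r) → Fin p × Fin r → ℂ}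
    (hz : IsOrderedRoots a b x z) (hv : IsNullSystem a b x z v) (k : Fin (2 * r)) :
    LinearIndependent ℂ (fun l : {l // z l = z k} => v l) := by
  rw [linearIndependent_iff_card_eq_finrank_span]
  have : Set.range (fun l : {l // z l = z k} => v l) = v '' {l | z l = z k} := by
    rw [Set.image_eq_range]; rfl
  rw [Set.finrank, this, hv.finrank_eq, hv.geom_eq_alg, ← hz.card_eq_algMult,
    Nat.card_eq_fintype_card]

/-- All exceptional x are zeros of a single nonzero polynomial. The nonvanishing constant
coefficient keeps 0 from being a root, where the symbol has no meaning. -/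
theorem exceptionalSet_finite (hb : ∀ i, (b i).IsHermitian) (hr : 0 < r) (hp : 0 < p)
    (hdeg : ∀ x, (rootPoly a b x).natDegree = 2 * r) (h0 : ∀ x, (rootPoly a b x).coeff 0 ≠ 0) :
    (exceptionalSet a b).Finite := by
  have hne : rootPolyParam a b ≠ 0 := by
    intro h
    have := hdeg 0
    rw [← rootPolyParam_map, h, Polynomial.map_zero, natDegree_zero] at this
    omega
  obtain ⟨w, hw, hw'⟩ := exists_geomMult_eq_algMult a b hb hne hp
  refine (w.rootSet_finite ℂ).subset fun x hx => ?_
  rw [mem_rootSet]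
  refine ⟨hw, ?_⟩
  rw [coe_aeval_eq_eval]
  by_contra hwx
  obtain ⟨z, hz⟩ := exists_isOrderedRoots (hdeg x)
  obtain ⟨v, hv⟩ := exists_isNullSystem hz fun k => by
    refine hw' x hwx _ ?_ (hz.eval_eq_zero k)
    intro hzk
    apply h0 x
    have := hz.eval_eq_zero k
    rwa [hzk, ← coeff_zero_eq_eval_zero] at this
  exact hx ⟨z, v, hz, hv⟩

end NullSystem
end MatrixRatio

namespace MatrixRatio

/-! ### Resolvent bounds for Hermitian matrices -/

section HermitianBound

variable {n : Type*} [Fintype n]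

/-- The Euclidean norm of a vector. -/
noncomputable def euclNorm (v : n → ℂ) : ℝ := ‖(WithLp.toLp 2 v : EuclideanSpace ℂ n)‖

lemma euclNorm_nonneg (v : n → ℂ) : 0 ≤ euclNorm v := norm_nonneg _

lemma euclNorm_sq (v : n → ℂ) : euclNorm v ^ 2 = ∑ i, ‖v i‖ ^ 2 :=
  EuclideanSpace.norm_sq_eq _

lemma euclNorm_sq_prod {m : Type*} [Fintype m] (w : m × n → ℂ) :
    euclNorm w ^ 2 = ∑ i, euclNorm (fun k => w (i, k)) ^ 2 := by
  simp only [euclNorm_sq, Fintype.sum_prod_type]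

variable [DecidableEq n]

/-- In an orthonormal eigenbasis x - H acts by the factors x - λ_i, each of modulus at least δ;
Parseval does the rest. -/
lemma le_euclNorm_sub_mulVec_of_isHermitian {H : Matrix n n ℂ} (hH : H.IsHermitian) {x : ℂ}
    {δ : ℝ} (hδ : 0 ≤ δ) (h : ∀ (t : ℝ) (w : n → ℂ), w ≠ 0 → H *ᵥ w = (t : ℂ) • w → δ ≤ ‖x - t‖)
    (y : n → ℂ) : δ * euclNorm y ≤ euclNorm (x • y - H *ᵥ y) := by
  have hb := hH.eigenvectorBasis.sum_sq_norm_inner_right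
  have hsym := Matrix.isSymmetric_toEuclideanLin_iff.2 hH
  have hinner : ∀ i, inner ℂ (hH.eigenvectorBasis i) (WithLp.toLp 2 (x • y - H *ᵥ y)) =
      (x - hH.eigenvalues i) * inner ℂ (hH.eigenvectorBasis i) (WithLp.toLp 2 y) := by
    intro i
    have h1 : (WithLp.toLp 2 (x • y - H *ᵥ y) : EuclideanSpace ℂ n) =
        x • WithLp.toLp 2 y - Matrix.toEuclideanLin H (WithLp.toLp 2 y) := rfl
    have h2 : Matrix.toEuclideanLin H (hH.eigenvectorBasis i) =
        ((hH.eigenvalues i : ℝ) : ℂ) • hH.eigenvectorBasis i := by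
      ext k
      exact congrFun (hH.mulVec_eigenvectorBasis i) k
    rw [h1, inner_sub_right, inner_smul_right, ← hsym, h2, inner_smul_left, Complex.conj_ofReal,
      sub_mul]
  have hle : ∀ i, δ ≤ ‖x - hH.eigenvalues i‖ := by
    intro i
    refine h _ (hH.eigenvectorBasis i).ofLp ?_ (hH.mulVec_eigenvectorBasis i)
    intro h0
    have := hH.eigenvectorBasis.orthonormal.1 i
    rw [show hH.eigenvectorBasis i = 0 from by ext k; exact congrFun h0 k] at this
    simp at this
  refine le_of_sq_le_sq ?_ (euclNorm_nonneg _)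
  rw [mul_pow, euclNorm, euclNorm, ← hb, ← hb, Finset.mul_sum]
  refine Finset.sum_le_sum fun i _ => ?_
  rw [hinner, norm_mul, mul_pow]
  gcongr
  exact hle i

open scoped Matrix.Norms.L2Operator in
lemma euclNorm_mulVec_le (H : Matrix n n ℂ) (y : n → ℂ) :
    euclNorm (H *ᵥ y) ≤ ‖H‖ * euclNorm y :=
  Matrix.l2_opNorm_mulVec H (WithLp.toLp 2 y)

open scoped Matrix.Norms.L2Operator in
lemma norm_le_of_euclNorm_mulVec_le (H : Matrix n n ℂ) {c : ℝ} (hc : 0 ≤ c)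
    (h : ∀ y, euclNorm (H *ᵥ y) ≤ c * euclNorm y) : ‖H‖ ≤ c := by
  rw [Matrix.l2_opNorm_def]
  exact ContinuousLinearMap.opNorm_le_bound _ hc fun y => h y.ofLp

end HermitianBound

/-! ### Truncated block Jacobi matrices and the zeros of det P_n -/

section Jacobi

variable {r : ℕ} {A B : ℕ → Matrix (Fin r) (Fin r) ℂ}

/-- The truncated block Jacobi matrix. -/
noncomputable def jacobi (A B : ℕ → Matrix (Fin r) (Fin r) ℂ) (n : ℕ) :
    Matrix (Fin n × Fin r) (Fin n × Fin r) ℂ :=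
  tridiag (fun i : Fin n => A i) (fun i : Fin n => B i)

lemma tridiag_mulVec {p : ℕ} (a b : Fin p → Matrix (Fin r) (Fin r) ℂ) (w : Fin p × Fin r → ℂ)
    (i : Fin p) (k : Fin r) :
    (tridiag a b *ᵥ w) (i, k) = (b i *ᵥ block w i) k
      + (∑ j : Fin p, if (i : ℕ) + 1 = j then (a j *ᵥ block w j) k else 0)
      + ∑ j : Fin p, if (i : ℕ) = (j : ℕ) + 1 then ((a i)ᴴ *ᵥ block w j) k else 0 := by
  simp only [Matrix.mulVec, dotProduct, Fintype.sum_prod_type, tridiag, add_mul,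
    Finset.sum_add_distrib, block]
  congr 1
  · congr 1
    · rw [Finset.sum_eq_single i]
      · simp
      · intro j _ hj; simp [Ne.symm hj]
      · simp
    · refine Finset.sum_congr rfl fun j _ => ?_
      split_ifs <;> simp
  · refine Finset.sum_congr rfl fun j _ => ?_
    split_ifs <;> simp

lemma jacobi_mulVec_zero {n : ℕ} (u : ℕ → Fin r → ℂ) (k : Fin r) (h : 0 < n) :
    (jacobi A B n *ᵥ fun s => u s.1 s.2) (⟨0, h⟩, k) =
      (B 0 *ᵥ u 0) k + if 1 < n then (A 1 *ᵥ u 1) k else 0 := by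
  rw [jacobi, tridiag_mulVec]
  have h2 : (∑ j : Fin n, if 0 = (j : ℕ) + 1 then ((A 0)ᴴ *ᵥ u j) k else 0) = 0 :=
    Finset.sum_eq_zero fun j _ => by simp
  have h1 : (∑ j : Fin n, if 0 + 1 = (j : ℕ) then (A j *ᵥ u j) k else 0) =
      if 1 < n then (A 1 *ᵥ u 1) k else 0 := by
    split_ifs with h'
    · rw [Finset.sum_eq_single (⟨1, h'⟩ : Fin n)]
      · simp
      · intro j _ hj
        rw [if_neg]; intro h0; apply hj; ext; simp; omega
      · simp
    · exact Finset.sum_eq_zero fun j _ => if_neg (by omega)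
  exact (congrArg₂ (· + ·) (congrArg₂ (· + ·) rfl h1) h2).trans (add_zero _)

lemma jacobi_mulVec_succ {n : ℕ} (u : ℕ → Fin r → ℂ) (i : ℕ) (k : Fin r) (h : i + 1 < n) :
    (jacobi A B n *ᵥ fun s => u s.1 s.2) (⟨i + 1, h⟩, k) =
      (B (i + 1) *ᵥ u (i + 1)) k + (if i + 2 < n then (A (i + 2) *ᵥ u (i + 2)) k else 0)
        + ((A (i + 1))ᴴ *ᵥ u i) k := by
  rw [jacobi, tridiag_mulVec]
  have h2 : (∑ j : Fin n, if i + 1 = (j : ℕ) + 1 then ((A (i + 1))ᴴ *ᵥ u j) k else 0) =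
      ((A (i + 1))ᴴ *ᵥ u i) k := by
    rw [Finset.sum_eq_single (⟨i, by omega⟩ : Fin n)]
    · simp
    · intro j _ hj
      rw [if_neg]; intro h0; apply hj; ext; simp; omega
    · simp
  have h1 : (∑ j : Fin n, if i + 1 + 1 = (j : ℕ) then (A j *ᵥ u j) k else 0) =
      if i + 2 < n then (A (i + 2) *ᵥ u (i + 2)) k else 0 := by
    split_ifs with h'
    · rw [Finset.sum_eq_single (⟨i + 2, h'⟩ : Fin n)]
      · simp
      · intro j _ hj
        rw [if_neg]; intro h0; apply hj; ext; simp; omega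
      · simp
    · exact Finset.sum_eq_zero fun j _ => if_neg (by omega)
  exact congrArg₂ (· + ·) (congrArg₂ (· + ·) rfl h1) h2

variable (hA : ∀ n, IsUnit (A (n + 1)).det)
include hA

/-- Eigenvalues of the truncated block Jacobi matrix are zeros of `det P n`. -/
lemma det_matPoly_eq_zero_of_jacobi_mulVec {n : ℕ} {x : ℂ} {w : Fin n × Fin r → ℂ} (hw : w ≠ 0)
    (h : jacobi A B n *ᵥ w = x • w) : (matPoly A B n x).det = 0 := by
  -- With the value 0 from n on, the truncated last row becomes an ordinary instance of the
  -- recurrence. Then u n = P_n u_0 = 0, and u_0 ≠ 0 since it determines w.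
  let u : ℕ → Fin r → ℂ := fun k => if hk : k < n then block w ⟨k, hk⟩ else 0
  have hwu : w = fun s => u s.1 s.2 := by
    ext ⟨i, k⟩; simp [u, block]
  have hu0 : ∀ k, n ≤ k → u k = 0 := fun k hk => by simp [u, not_lt.2 hk]
  have hif : ∀ (k l : ℕ) (C : Matrix (Fin r) (Fin r) ℂ) (m : Fin r),
      (if k < n then (C *ᵥ u k) m else 0) = (C *ᵥ u k) m := by
    intro k l C m
    split_ifs with hk
    · rfl
    · rw [hu0 k (not_lt.1 hk)]; simp
  have hrec : ∀ k, k ≤ n → u k = matPoly A B k x *ᵥ u 0 := by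
    intro k
    induction k using Nat.strong_induction_on with
    | _ k ih =>
      intro hk
      match k, ih, hk with
      | 0, _, _ => simp [matPoly]
      | 1, _, hk =>
        have h1 : A 1 *ᵥ u 1 = x • u 0 - B 0 *ᵥ u 0 := by
          ext m
          have := congrFun h (⟨0, hk⟩, m)
          rw [hwu, jacobi_mulVec_zero u m hk, hif 1 0] at this
          simp only [Pi.smul_apply, Pi.sub_apply] at this ⊢
          rw [← this]; ring
        have h2 := congrArg (fun t => (A 1)⁻¹ *ᵥ t) h1
        simp only [Matrix.mulVec_mulVec, Matrix.nonsing_inv_mul _ (hA 0), Matrix.one_mulVec] at h2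
        rw [h2, matPoly, ← Matrix.mulVec_mulVec, Matrix.sub_mulVec, Matrix.smul_mulVec,
          Matrix.one_mulVec]
      | k + 2, ih, hk =>
        have h1 : A (k + 2) *ᵥ u (k + 2) =
            x • u (k + 1) - B (k + 1) *ᵥ u (k + 1) - (A (k + 1))ᴴ *ᵥ u k := by
          ext m
          have := congrFun h (⟨k + 1, hk⟩, m)
          rw [hwu, jacobi_mulVec_succ u k m hk, hif (k + 2) 0] at this
          simp only [Pi.smul_apply, Pi.sub_apply] at this ⊢
          rw [← this]; ring
        have h2 := congrArg (fun t => (A (k + 2))⁻¹ *ᵥ t) h1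
        simp only [Matrix.mulVec_mulVec, Matrix.nonsing_inv_mul _ (hA (k + 1)),
          Matrix.one_mulVec] at h2
        rw [h2, matPoly, ih k (by omega) (by omega), ih (k + 1) (by omega) (by omega)]
        simp only [← Matrix.mulVec_mulVec, Matrix.sub_mulVec, Matrix.smul_mulVec]
  refine Matrix.exists_mulVec_eq_zero_iff.1 ⟨u 0, ?_, ?_⟩
  · intro h0
    apply hw
    rw [hwu]
    ext ⟨i, k⟩
    simp only [Pi.zero_apply]
    rw [hrec i i.2.le, h0, Matrix.mulVec_zero]; rfl
  · rw [← hrec n le_rfl, hu0 n le_rfl]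

/-- The points at distance at least `δ` from the interval `[-M, M]`. -/
def farSet (M δ : ℝ) : Set ℂ := {x | ∀ t ∈ Set.Icc (-M) M, δ ≤ ‖x - (t : ℂ)‖}

omit hA in
lemma conj_mem_farSet {M δ : ℝ} {x : ℂ} (hx : x ∈ farSet M δ) : star x ∈ farSet M δ := by
  intro t ht
  have h : star x - (t : ℂ) = star (x - (t : ℂ)) := by simp
  rw [h, norm_star]
  exact hx t ht

variable {M : ℝ} (hzeros : ∀ (n : ℕ) (x : ℂ), (matPoly A B n x).det = 0 → x ∈ realInterval M)

omit hA in
include hzeros in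
lemma isUnit_det_matPoly {δ : ℝ} (hδ : 0 < δ) {x : ℂ} (hx : x ∈ farSet M δ) (n : ℕ) :
    IsUnit (matPoly A B n x).det := by
  rw [isUnit_iff_ne_zero]
  intro h
  obtain ⟨t, ht, rfl⟩ := hzeros n x h
  have := hx t ht
  simp at this
  linarith

include hzeros in
/-- The resolvent estimate for the vectors `(P 0 ξ, …, P (n-1) ξ)`. -/
lemma sum_euclNorm_matPoly_le (hB : ∀ n, (B n).IsHermitian) {δ : ℝ} (hδ : 0 < δ) {x : ℂ}
    (hx : x ∈ farSet M δ) (n : ℕ) (ξ : Fin r → ℂ) :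
    δ ^ 2 * ∑ k ∈ Finset.range n, euclNorm (matPoly A B k x *ᵥ ξ) ^ 2 ≤
      euclNorm ((A n * matPoly A B n x) *ᵥ ξ) ^ 2 := by
  rcases Nat.eq_zero_or_pos n with rfl | hn
  · simpa using sq_nonneg _
  have hH : (jacobi A B n).IsHermitian := tridiag_isHermitian _ _ fun i => hB i
  let u : ℕ → Fin r → ℂ := fun k => matPoly A B k x *ᵥ ξ
  let y : Fin n × Fin r → ℂ := fun s => u s.1 s.2
  have key := le_euclNorm_sub_mulVec_of_isHermitian hH (x := x) hδ.le (fun t w hw h => by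
    obtain ⟨t', ht', h'⟩ := hzeros n t (det_matPoly_eq_zero_of_jacobi_mulVec hA hw h)
    have : t' = t := by exact_mod_cast h'
    exact hx t (this ▸ ht')) y
  -- The recurrence cancels every block row of (x - J) y except the last, where the truncation has
  -- cut off the term A_n P_n ξ.
  have hres : ∀ (i : Fin n), (fun k => (x • y - jacobi A B n *ᵥ y) (i, k)) =
      if (i : ℕ) + 1 = n then A n *ᵥ u n else 0 := by
    rintro ⟨i, hi⟩
    match i, hi with
    | 0, hi =>
      have h0 := congrArg (fun T => T *ᵥ ξ) (matPoly_recurrence_zero A B hA x)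
      simp only [Matrix.smul_mulVec, Matrix.add_mulVec, ← Matrix.mulVec_mulVec] at h0
      ext m
      have h1 := congrFun h0 m
      have h2 := jacobi_mulVec_zero (A := A) (B := B) u m hi
      simp only [Pi.smul_apply, Pi.add_apply, Pi.sub_apply] at h1 ⊢
      rw [h2]
      change x • (u 0) m - _ = _
      rw [h1]
      by_cases h : 1 < n
      · have : ¬ (0 + 1 = n) := by omega
        simp only [h, this, if_true, if_false, u]
        simp only [Pi.zero_apply]
        ring
      · have : 0 + 1 = n := by omega
        subst this
        simp [u]
    | i + 1, hi =>
      have h0 := congrArg (fun T => T *ᵥ ξ) (matPoly_recurrence_succ A B hA i x)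
      simp only [Matrix.smul_mulVec, Matrix.add_mulVec, ← Matrix.mulVec_mulVec] at h0
      ext m
      have h1 := congrFun h0 m
      have h2 := jacobi_mulVec_succ (A := A) (B := B) u i m hi
      simp only [Pi.smul_apply, Pi.add_apply, Pi.sub_apply] at h1 ⊢
      rw [h2]
      change x • (u (i + 1)) m - _ = _
      rw [h1]
      by_cases h : i + 2 < n
      · have : ¬ (i + 1 + 1 = n) := by omega
        simp only [h, this, if_true, if_false, u]
        simp only [Pi.zero_apply]
        ring
      · have : i + 1 + 1 = n := by omega
        subst this
        simp [u]
  have h2 := pow_le_pow_left₀ (mul_nonneg hδ.le (euclNorm_nonneg _)) key 2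
  rw [mul_pow, euclNorm_sq_prod, euclNorm_sq_prod] at h2
  simp only [hres] at h2
  have h3 : ∑ i : Fin n, euclNorm (if (i : ℕ) + 1 = n then A n *ᵥ u n else 0) ^ 2 =
      euclNorm (A n *ᵥ u n) ^ 2 := by
    rw [Finset.sum_eq_single (⟨n - 1, by omega⟩ : Fin n)]
    · rw [if_pos]; simp; omega
    · intro j _ hj
      rw [if_neg]
      · simp [euclNorm]
      · intro h0; apply hj; ext; simp; omega
    · simp
  rw [h3] at h2
  rw [← Matrix.mulVec_mulVec, Finset.sum_range]
  exact h2

end Jacobi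
end MatrixRatio

namespace MatrixRatio

/-! ### Geometric decay and comparison of shifted Green blocks -/

section Decay

open scoped Matrix.Norms.L2Operator

variable {r : ℕ} {A B : ℕ → Matrix (Fin r) (Fin r) ℂ}

/-- The rate of decay of `P k (A n P n)⁻¹` in `n - k`. -/
noncomputable def decayRate (δ α : ℝ) : ℝ := (√(1 + (δ / α) ^ 2))⁻¹

lemma decayRate_pos (δ α : ℝ) : 0 < decayRate δ α := by
  unfold decayRate; positivity

lemma decayRate_lt_one {δ α : ℝ} (hδ : 0 < δ) (hα : 0 < α) : decayRate δ α < 1 := by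
  unfold decayRate
  apply inv_lt_one_of_one_lt₀
  rw [Real.lt_sqrt (by norm_num)]
  have : 0 < (δ / α) ^ 2 := by positivity
  linarith

lemma decayRate_sq (δ α : ℝ) : decayRate δ α ^ 2 * (1 + (δ / α) ^ 2) = 1 := by
  unfold decayRate
  rw [inv_pow, Real.sq_sqrt (by positivity), inv_mul_cancel₀ (by positivity)]

variable {M δ α : ℝ}

/-- Let S_m be the sum of |P_k ξ|² over k < m. The resolvent estimate at size m bounds S_m by a
multiple of its next increment, so S grows by the factor 1 + (δ/α)² = τ⁻² at each step. At size n +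
1 it bounds S_{n+1} by |w|²/δ². Descending from n + 1 to k + 1 gives the decay. -/
lemma norm_matPoly_mul_inv_le (hA : ∀ n, IsUnit (A (n + 1)).det) (hB : ∀ n, (B n).IsHermitian)
    (hzeros : ∀ (n : ℕ) (x : ℂ), (matPoly A B n x).det = 0 → x ∈ realInterval M)
    (hδ : 0 < δ) (hα : 0 < α) (hAα : ∀ n, ‖A n‖ ≤ α) {x : ℂ} (hx : x ∈ farSet M δ) {k n : ℕ}
    (hkn : k ≤ n) :
    ‖matPoly A B k x * (A (n + 1) * matPoly A B (n + 1) x)⁻¹‖ ≤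
      δ⁻¹ * decayRate δ α ^ (n - k) := by
  set τ := decayRate δ α with hτ
  have hτ0 : 0 < τ := decayRate_pos _ _
  refine norm_le_of_euclNorm_mulVec_le _ (by positivity) fun w => ?_
  rw [← Matrix.mulVec_mulVec]
  set ξ := (A (n + 1) * matPoly A B (n + 1) x)⁻¹ *ᵥ w with hξ
  let S : ℕ → ℝ := fun m => ∑ k ∈ Finset.range m, euclNorm (matPoly A B k x *ᵥ ξ) ^ 2
  have hbound := fun m => sum_euclNorm_matPoly_le hA hzeros hB hδ hx m ξ
  have hS0 : ∀ m, 0 ≤ S m := fun m => Finset.sum_nonneg fun _ _ => sq_nonneg _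
  have hstep : ∀ m, S m ≤ τ ^ 2 * S (m + 1) := by
    intro m
    have h1 : S (m + 1) = S m + euclNorm (matPoly A B m x *ᵥ ξ) ^ 2 := Finset.sum_range_succ _ _
    have h2 : δ ^ 2 * S m ≤ α ^ 2 * euclNorm (matPoly A B m x *ᵥ ξ) ^ 2 := by
      refine (hbound m).trans ?_
      rw [← mul_pow, ← Matrix.mulVec_mulVec]
      refine pow_le_pow_left₀ (euclNorm_nonneg _) ((euclNorm_mulVec_le _ _).trans ?_) 2
      exact mul_le_mul_of_nonneg_right (hAα m) (euclNorm_nonneg _)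
    have h3 : (δ / α) ^ 2 * S m ≤ euclNorm (matPoly A B m x *ᵥ ξ) ^ 2 := by
      rw [div_pow, div_mul_eq_mul_div, div_le_iff₀ (by positivity)]
      linarith
    calc S m = τ ^ 2 * ((1 + (δ / α) ^ 2) * S m) := by
          rw [← mul_assoc, decayRate_sq, one_mul]
      _ ≤ τ ^ 2 * S (m + 1) := by
          refine mul_le_mul_of_nonneg_left ?_ (by positivity)
          rw [h1]; linarith
  have hiter : ∀ d m, S m ≤ (τ ^ 2) ^ d * S (m + d) := by
    intro d
    induction d with
    | zero => intro m; simp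
    | succ d ih =>
      intro m
      refine (ih m).trans ?_
      rw [pow_succ (τ ^ 2) d, mul_assoc, ← add_assoc]
      exact mul_le_mul_of_nonneg_left (hstep _) (by positivity)
  have hlast : δ ^ 2 * S (n + 1) ≤ euclNorm w ^ 2 := by
    refine (hbound (n + 1)).trans_eq ?_
    have hu : IsUnit (A (n + 1) * matPoly A B (n + 1) x).det := by
      rw [Matrix.det_mul]; exact (hA n).mul (isUnit_det_matPoly hzeros hδ hx _)
    rw [hξ, Matrix.mulVec_mulVec, Matrix.mul_nonsing_inv _ hu, Matrix.one_mulVec]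
  refine le_of_sq_le_sq ?_ (mul_nonneg (by positivity) (euclNorm_nonneg _))
  have h1 : euclNorm (matPoly A B k x *ᵥ ξ) ^ 2 ≤ S (k + 1) := by
    have : S (k + 1) = S k + euclNorm (matPoly A B k x *ᵥ ξ) ^ 2 := Finset.sum_range_succ _ _
    linarith [hS0 k]
  have h2 := hiter (n - k) (k + 1)
  rw [show k + 1 + (n - k) = n + 1 by omega] at h2
  calc euclNorm (matPoly A B k x *ᵥ ξ) ^ 2 ≤ (τ ^ 2) ^ (n - k) * S (n + 1) := h1.trans h2
    _ ≤ (τ ^ 2) ^ (n - k) * ((δ⁻¹) ^ 2 * euclNorm w ^ 2) := by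
        refine mul_le_mul_of_nonneg_left ?_ (by positivity)
        rw [inv_pow, inv_mul_eq_div, le_div_iff₀ (by positivity)]
        linarith
    _ = (δ⁻¹ * τ ^ (n - k) * euclNorm w) ^ 2 := by ring

/-- The last diagonal block of the resolvent of the truncated block Jacobi matrix. -/
noncomputable def greenBlock (A B : ℕ → Matrix (Fin r) (Fin r) ℂ) (n : ℕ) (x : ℂ) :
    Matrix (Fin r) (Fin r) ℂ :=
  matPoly A B n x * (A (n + 1) * matPoly A B (n + 1) x)⁻¹

variable (hA : ∀ n, IsUnit (A (n + 1)).det)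

include hA in
lemma greenBlock_zero (x : ℂ) :
    greenBlock A B 0 x = (x • (1 : Matrix (Fin r) (Fin r) ℂ) - B 0)⁻¹ := by
  rw [greenBlock, matPoly, matPoly, Matrix.mul_nonsing_inv_cancel_left _ _ (hA 0), Matrix.one_mul]

include hA in
-- This is the three-term recurrence divided by P_{n+1} on the right: one step of a matrix continued
-- fraction.
lemma greenBlock_succ (n : ℕ) (x : ℂ) (h : IsUnit (matPoly A B (n + 1) x).det) :
    greenBlock A B (n + 1) x = (x • (1 : Matrix (Fin r) (Fin r) ℂ) - B (n + 1) -
      (A (n + 1))ᴴ * greenBlock A B n x * A (n + 1))⁻¹ := by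
  have h1 : A (n + 2) * matPoly A B (n + 2) x = (x • (1 : Matrix (Fin r) (Fin r) ℂ) - B (n + 1) -
      (A (n + 1))ᴴ * greenBlock A B n x * A (n + 1)) * matPoly A B (n + 1) x := by
    rw [matPoly.eq_3, Matrix.mul_nonsing_inv_cancel_left _ _ (hA (n + 1)), greenBlock,
      Matrix.mul_inv_rev, Matrix.sub_mul, Matrix.sub_mul, Matrix.smul_mul, Matrix.one_mul]
    congr 1
    simp only [Matrix.mul_assoc]
    rw [Matrix.nonsing_inv_mul_cancel_left _ _ (hA n), Matrix.nonsing_inv_mul _ h, Matrix.mul_one]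
  rw [greenBlock, h1, Matrix.mul_inv_rev, Matrix.mul_nonsing_inv_cancel_left _ _ h]

variable (hB : ∀ n, (B n).IsHermitian)
  (hzeros : ∀ (n : ℕ) (x : ℂ), (matPoly A B n x).det = 0 → x ∈ realInterval M)

include hA hB hzeros in
-- Both sides start alike and satisfy the same continued fraction, because the B_n are Hermitian. It
-- makes estimates at the conjugate point available for factors standing on the left.
lemma conjTranspose_greenBlock (hδ : 0 < δ) {x : ℂ} (hx : x ∈ farSet M δ) (n : ℕ) :
    (greenBlock A B n x)ᴴ = greenBlock A B n (star x) := by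
  induction n with
  | zero =>
    rw [greenBlock_zero hA, greenBlock_zero hA, Matrix.conjTranspose_nonsing_inv,
      Matrix.conjTranspose_sub, Matrix.conjTranspose_smul, Matrix.conjTranspose_one, (hB 0).eq]
  | succ n ih =>
    rw [greenBlock_succ hA n x (isUnit_det_matPoly hzeros hδ hx _),
      greenBlock_succ hA n (star x) (isUnit_det_matPoly hzeros hδ (conj_mem_farSet hx) _),
      Matrix.conjTranspose_nonsing_inv, Matrix.conjTranspose_sub, Matrix.conjTranspose_sub,
      Matrix.conjTranspose_smul, Matrix.conjTranspose_one, (hB (n + 1)).eq,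
      Matrix.conjTranspose_mul, Matrix.conjTranspose_mul, Matrix.conjTranspose_conjTranspose, ih,
      Matrix.mul_assoc]

/-- The Wronskian of the sequence `P n` and the shifted sequence `P (n + s)`. -/
noncomputable def wronskian (A B : ℕ → Matrix (Fin r) (Fin r) ℂ) (s n : ℕ) (x : ℂ) :
    Matrix (Fin r) (Fin r) ℂ :=
  (matPoly A B (n + s) (star x))ᴴ * (A (n + 1) * matPoly A B (n + 1) x) -
    (A (n + s + 1) * matPoly A B (n + s + 1) (star x))ᴴ * matPoly A B n x

include hA hB in
-- The left factor is taken at the conjugate point so that, after the adjoint, the terms with x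
-- cancel. Only differences of coefficients at distance s remain; for s = 0 the Wronskian is
-- constant.
lemma wronskian_succ_sub (s n : ℕ) (x : ℂ) :
    wronskian A B s (n + 1) x - wronskian A B s n x =
      (matPoly A B (n + s + 1) (star x))ᴴ * (B (n + s + 1) - B (n + 1)) * matPoly A B (n + 1) x
      + (matPoly A B (n + s + 1) (star x))ᴴ * (A (n + s + 1) - A (n + 1))ᴴ * matPoly A B n x
      + (matPoly A B (n + s) (star x))ᴴ * (A (n + s + 1) - A (n + 1)) * matPoly A B (n + 1) x := by
  have h1 : A (n + 2) * matPoly A B (n + 2) x = x • matPoly A B (n + 1) x -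
      B (n + 1) * matPoly A B (n + 1) x - (A (n + 1))ᴴ * matPoly A B n x := by
    rw [matPoly_recurrence_succ A B hA n x]; abel
  have h2 : A (n + s + 2) * matPoly A B (n + s + 2) (star x) =
      star x • matPoly A B (n + s + 1) (star x) -
      B (n + s + 1) * matPoly A B (n + s + 1) (star x) -
        (A (n + s + 1))ᴴ * matPoly A B (n + s) (star x) := by
    rw [matPoly_recurrence_succ A B hA (n + s) (star x)]; abel
  rw [wronskian, wronskian, show n + 1 + s = n + s + 1 by omega, h1, h2]
  simp only [Matrix.conjTranspose_sub, Matrix.conjTranspose_mul, Matrix.conjTranspose_smul,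
    star_star, (hB (n + s + 1)).eq, Matrix.conjTranspose_conjTranspose, Matrix.mul_sub,
    Matrix.sub_mul, Matrix.mul_smul, Matrix.smul_mul, Matrix.mul_assoc]
  abel

include hA hB hzeros in
lemma wronskian_eq_greenBlock_sub (hδ : 0 < δ) {x : ℂ} (hx : x ∈ farSet M δ) (s n : ℕ) :
    ((A (n + s + 1) * matPoly A B (n + s + 1) (star x))⁻¹)ᴴ * wronskian A B s n x *
      (A (n + 1) * matPoly A B (n + 1) x)⁻¹ = greenBlock A B (n + s) x - greenBlock A B n x := by
  have hu : ∀ (m : ℕ) (y : ℂ), y ∈ farSet M δ →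
      IsUnit (A (m + 1) * matPoly A B (m + 1) y).det := by
    intro m y hy
    rw [Matrix.det_mul]; exact (hA m).mul (isUnit_det_matPoly hzeros hδ hy _)
  have h1 := conjTranspose_greenBlock hA hB hzeros hδ (conj_mem_farSet hx) (n + s)
  rw [star_star] at h1
  rw [← h1, greenBlock, greenBlock, wronskian, Matrix.mul_sub, Matrix.sub_mul,
    Matrix.conjTranspose_mul (matPoly A B (n + s) (star x))]
  congr 1
  · rw [Matrix.mul_assoc, Matrix.mul_assoc, Matrix.mul_nonsing_inv _ (hu n x hx), Matrix.mul_one]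
  · rw [← Matrix.mul_assoc, ← Matrix.conjTranspose_mul,
      Matrix.mul_nonsing_inv _ (hu (n + s) _ (conj_mem_farSet hx)), Matrix.conjTranspose_one,
      Matrix.one_mul]

include hA hB hzeros in
-- The Wronskian at n = N + d + 1 is the one at N plus its increments. Between Yᴴ and X, both outer
-- factors decay, so each contribution carries a power of τ². The two terms at N give 2 α (τ²)^d,
-- the three terms of each increment give 3 ε times a geometric series.
lemma norm_greenBlock_sub_le (hδ : 0 < δ) (hα : 0 < α) (hAα : ∀ n, ‖A n‖ ≤ α) {ε : ℝ} {s N : ℕ}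
    (hAε : ∀ k, N ≤ k → ‖A (k + s + 1) - A (k + 1)‖ ≤ ε)
    (hBε : ∀ k, N ≤ k → ‖B (k + s + 1) - B (k + 1)‖ ≤ ε) {x : ℂ} (hx : x ∈ farSet M δ) (d : ℕ) :
    ‖greenBlock A B (N + d + 1 + s) x - greenBlock A B (N + d + 1) x‖ ≤
      δ⁻¹ ^ 2 * (2 * α * (decayRate δ α ^ 2) ^ d + 3 * ε / (1 - decayRate δ α ^ 2)) := by
  set τ := decayRate δ α with hτ
  have hτ0 : 0 < τ := decayRate_pos _ _
  have hτ1 : τ < 1 := decayRate_lt_one hδ hα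
  have hε : 0 ≤ ε := (norm_nonneg _).trans (hAε N le_rfl)
  set n := N + d + 1 with hn
  set X := (A (n + 1) * matPoly A B (n + 1) x)⁻¹ with hX
  set Y := (A (n + s + 1) * matPoly A B (n + s + 1) (star x))⁻¹ with hY
  have hXk : ∀ k, k ≤ n → ‖matPoly A B k x * X‖ ≤ δ⁻¹ * τ ^ (n - k) := fun k hk =>
    norm_matPoly_mul_inv_le hA hB hzeros hδ hα hAα hx hk
  have hYk : ∀ k, k ≤ n → ‖Yᴴ * (matPoly A B (k + s) (star x))ᴴ‖ ≤ δ⁻¹ * τ ^ (n - k) := by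
    intro k hk
    rw [← Matrix.conjTranspose_mul, Matrix.l2_opNorm_conjTranspose]
    have := norm_matPoly_mul_inv_le hA hB hzeros hδ hα hAα (conj_mem_farSet hx)
      (show k + s ≤ n + s by omega)
    rwa [show n + s - (k + s) = n - k by omega] at this
  -- The indices on the two sides may differ by one; m is a common lower bound for both exponents.
  have htriple : ∀ (C : Matrix (Fin r) (Fin r) ℂ) (c : ℝ) (k l m : ℕ), ‖C‖ ≤ c → k ≤ n → l ≤ n →
      m ≤ n - k → m ≤ n - l →
      ‖Yᴴ * (matPoly A B (k + s) (star x))ᴴ * C * (matPoly A B l x * X)‖ ≤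
        δ⁻¹ ^ 2 * (c * (τ ^ 2) ^ m) := by
    intro C c k l m hC hk hl hmk hml
    have hc : 0 ≤ c := (norm_nonneg _).trans hC
    have h1 : ‖Yᴴ * (matPoly A B (k + s) (star x))ᴴ‖ ≤ δ⁻¹ * τ ^ m := (hYk k hk).trans
      (mul_le_mul_of_nonneg_left (pow_le_pow_of_le_one hτ0.le hτ1.le hmk) (by positivity))
    have h2 : ‖matPoly A B l x * X‖ ≤ δ⁻¹ * τ ^ m := (hXk l hl).trans
      (mul_le_mul_of_nonneg_left (pow_le_pow_of_le_one hτ0.le hτ1.le hml) (by positivity))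
    calc _ ≤ ‖Yᴴ * (matPoly A B (k + s) (star x))ᴴ‖ * ‖C‖ * ‖matPoly A B l x * X‖ :=
          (norm_mul_le _ _).trans (mul_le_mul_of_nonneg_right (norm_mul_le _ _) (norm_nonneg _))
      _ ≤ (δ⁻¹ * τ ^ m) * c * (δ⁻¹ * τ ^ m) := by gcongr
      _ = _ := by ring
  have hinit : ‖Yᴴ * wronskian A B s N x * X‖ ≤ δ⁻¹ ^ 2 * (2 * α * (τ ^ 2) ^ d) := by
    have e : Yᴴ * wronskian A B s N x * X =
        Yᴴ * (matPoly A B (N + s) (star x))ᴴ * A (N + 1) * (matPoly A B (N + 1) x * X) -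
        Yᴴ * (matPoly A B (N + 1 + s) (star x))ᴴ * (A (N + s + 1))ᴴ * (matPoly A B N x * X) := by
      rw [wronskian, Matrix.mul_sub, Matrix.sub_mul, Matrix.conjTranspose_mul,
        show N + 1 + s = N + s + 1 by omega]
      simp only [Matrix.mul_assoc]
    rw [e]
    refine (norm_sub_le _ _).trans ?_
    have h1 := htriple (A (N + 1)) α N (N + 1) d (hAα _) (by omega) (by omega) (by omega)
      (by omega)
    have h2 := htriple (A (N + s + 1))ᴴ α (N + 1) N d
      (by rw [Matrix.l2_opNorm_conjTranspose]; exact hAα _) (by omega) (by omega) (by omega)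
      (by omega)
    linarith
  have hstep : ∀ k, N ≤ k → k < n →
      ‖Yᴴ * wronskian A B s (k + 1) x * X - Yᴴ * wronskian A B s k x * X‖ ≤
        δ⁻¹ ^ 2 * (3 * ε * (τ ^ 2) ^ (n - 1 - k)) := by
    intro k hNk hkn
    have e : Yᴴ * wronskian A B s (k + 1) x * X - Yᴴ * wronskian A B s k x * X =
        Yᴴ * (matPoly A B (k + 1 + s) (star x))ᴴ * (B (k + s + 1) - B (k + 1)) *
          (matPoly A B (k + 1) x * X) +
        Yᴴ * (matPoly A B (k + 1 + s) (star x))ᴴ * (A (k + s + 1) - A (k + 1))ᴴ *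
          (matPoly A B k x * X) +
        Yᴴ * (matPoly A B (k + s) (star x))ᴴ * (A (k + s + 1) - A (k + 1)) *
          (matPoly A B (k + 1) x * X) := by
      rw [← Matrix.sub_mul, ← Matrix.mul_sub, wronskian_succ_sub hA hB,
        show k + 1 + s = k + s + 1 by omega]
      simp only [Matrix.mul_assoc, Matrix.mul_add, Matrix.add_mul]
    rw [e]
    refine (norm_add₃_le).trans ?_
    have h1 := htriple _ ε (k + 1) (k + 1) (n - 1 - k) (hBε k hNk) (by omega) (by omega)
      (by omega) (by omega)
    have h2 := htriple (A (k + s + 1) - A (k + 1))ᴴ ε (k + 1) k (n - 1 - k)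
      (by rw [Matrix.l2_opNorm_conjTranspose]; exact hAε k hNk) (by omega) (by omega) (by omega)
      (by omega)
    have h3 := htriple _ ε k (k + 1) (n - 1 - k) (hAε k hNk) (by omega) (by omega)
      (by omega) (by omega)
    linarith
  have hsum : ∀ j, j ≤ d + 1 → ‖Yᴴ * wronskian A B s (N + j) x * X‖ ≤
      δ⁻¹ ^ 2 * (2 * α * (τ ^ 2) ^ d + 3 * ε * ∑ i ∈ Finset.range j, (τ ^ 2) ^ (d - i)) := by
    intro j
    induction j with
    | zero => intro _; simpa using hinit
    | succ j ih =>
      intro hj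
      have h1 := ih (by omega)
      have h2 := hstep (N + j) (by omega) (by omega)
      rw [show n - 1 - (N + j) = d - j by omega] at h2
      have h3 := norm_le_norm_add_norm_sub' (Yᴴ * wronskian A B s (N + (j + 1)) x * X)
        (Yᴴ * wronskian A B s (N + j) x * X)
      rw [Finset.sum_range_succ]
      have h4 : N + j + 1 = N + (j + 1) := by omega
      rw [h4] at h2
      linarith
  have hfin := hsum (d + 1) le_rfl
  rw [show N + (d + 1) = n by omega, wronskian_eq_greenBlock_sub hA hB hzeros hδ hx] at hfin
  refine hfin.trans (mul_le_mul_of_nonneg_left ?_ (by positivity))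
  have hτ2 : τ ^ 2 < 1 := pow_lt_one₀ hτ0.le hτ1 (by norm_num)
  have hgeom : ∑ i ∈ Finset.range (d + 1), (τ ^ 2) ^ (d - i) ≤ 1 / (1 - τ ^ 2) := by
    have h1 := Finset.sum_range_reflect (fun i => (τ ^ 2) ^ i) (d + 1)
    simp only [Nat.add_sub_cancel] at h1
    rw [h1, le_div_iff₀ (by linarith), geom_sum_mul_neg]
    have : 0 ≤ (τ ^ 2) ^ (d + 1) := by positivity
    linarith
  have := mul_le_mul_of_nonneg_left hgeom (show 0 ≤ 3 * ε by positivity)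
  rw [mul_one_div] at this
  linarith

end Decay
end MatrixRatio

namespace MatrixRatio

/-! ### Asymptotically periodic sequences -/

section Periodic

/-- The periodic extension to `ℕ` of a family indexed by `Fin p`. -/
def cyc {p : ℕ} {X : Type*} (hp : 0 < p) (c : Fin p → X) (k : ℕ) : X := c ⟨k % p, Nat.mod_lt k hp⟩

variable {p : ℕ} {X : Type*} (hp : 0 < p) (c : Fin p → X)

lemma cyc_add_period (k : ℕ) : cyc hp c (k + p) = cyc hp c k := by simp [cyc]

lemma tendsto_cyc [TopologicalSpace X] {u : ℕ → X} {c : Fin p → X}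
    (h : ∀ j : Fin p, Tendsto (fun n : ℕ => u (p * n + j)) atTop (𝓝 (c j))) (k : ℕ) :
    Tendsto (fun n : ℕ => u (p * n + k)) atTop (𝓝 (cyc hp c k)) := by
  have h1 := (h ⟨k % p, Nat.mod_lt k hp⟩).comp (tendsto_add_atTop_nat (k / p))
  refine h1.congr fun n => ?_
  simp only [Function.comp]
  congr 1
  rw [mul_add, add_assoc, Nat.div_add_mod]

variable {E : Type*} [NormedAddCommGroup E] {u : ℕ → E} {c : Fin p → E}

lemma exists_norm_add_period_sub_le (hp : 0 < p)
    (h : ∀ j : Fin p, Tendsto (fun n : ℕ => u (p * n + j)) atTop (𝓝 (c j))) {ε : ℝ} (hε : 0 < ε) :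
    ∃ N, ∀ k, N ≤ k → ∀ m, ‖u (k + p * m) - u k‖ ≤ ε := by
  have h1 : ∀ j : Fin p, ∃ N, ∀ n, N ≤ n → ‖u (p * n + j) - c j‖ < ε / 2 := by
    intro j
    obtain ⟨N, hN⟩ := Metric.tendsto_atTop.1 (h j) (ε / 2) (by linarith)
    exact ⟨N, fun n hn => by simpa [dist_eq_norm] using hN n hn⟩
  choose N hN using h1
  have hle : ∀ k, p * (∑ j, N j) ≤ k → ‖u k - cyc hp c k‖ < ε / 2 := by
    intro k hk
    have h2 := hN ⟨k % p, Nat.mod_lt k hp⟩ (k / p) (by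
      refine (Finset.single_le_sum (f := N) (fun _ _ => Nat.zero_le _) (Finset.mem_univ _)).trans ?_
      rw [Nat.le_div_iff_mul_le hp, mul_comm]
      exact hk)
    simp only [Nat.div_add_mod] at h2
    exact h2
  refine ⟨p * ∑ j, N j, fun k hk m => ?_⟩
  have hc : cyc hp c (k + p * m) = cyc hp c k := by simp [cyc]
  have h2 := hle k hk
  have h3 := hle (k + p * m) (by omega)
  rw [hc] at h3
  have h4 := norm_sub_le_norm_sub_add_norm_sub (u (k + p * m)) (cyc hp c k) (u k)
  rw [norm_sub_rev (cyc hp c k) (u k)] at h4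
  linarith

lemma exists_norm_le_of_tendsto_period (hp : 0 < p)
    (h : ∀ j : Fin p, Tendsto (fun n : ℕ => u (p * n + j)) atTop (𝓝 (c j))) :
    ∃ α, 0 < α ∧ ∀ n, ‖u n‖ ≤ α := by
  have h1 : ∀ j : Fin p, ∃ C, ∀ n, ‖u (p * n + j)‖ ≤ C := by
    intro j
    obtain ⟨C, hC⟩ := (Metric.isBounded_range_of_tendsto _ (h j)).exists_norm_le
    exact ⟨C, fun n => hC _ ⟨n, rfl⟩⟩
  choose C hC using h1
  refine ⟨1 + ∑ j, |C j|, ?_, fun n => ?_⟩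
  · have : 0 ≤ ∑ j, |C j| := Finset.sum_nonneg fun _ _ => abs_nonneg _
    linarith
  · have h2 := hC ⟨n % p, Nat.mod_lt n hp⟩ (n / p)
    simp only [Nat.div_add_mod] at h2
    have h3 := Finset.single_le_sum (f := fun j => |C j|) (fun _ _ => abs_nonneg _)
      (Finset.mem_univ (⟨n % p, Nat.mod_lt n hp⟩ : Fin p))
    have h4 := le_abs_self (C ⟨n % p, Nat.mod_lt n hp⟩)
    linarith

end Periodic

lemma tendstoUniformlyOn_mul_of_bounded {S R : Type*} [NormedRing R] {F G : ℕ → S → R}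
    {f g : S → R} {s : Set S} (hF : TendstoUniformlyOn F f atTop s)
    (hG : TendstoUniformlyOn G g atTop s) (hf : ∃ c, ∀ x ∈ s, ‖f x‖ ≤ c)
    (hg : ∃ c, ∀ x ∈ s, ‖g x‖ ≤ c) :
    TendstoUniformlyOn (fun n x => F n x * G n x) (fun x => f x * g x) atTop s := by
  obtain ⟨c, hc⟩ := hf
  obtain ⟨d, hd⟩ := hg
  rw [Metric.tendstoUniformlyOn_iff] at hF hG ⊢
  intro ε hε
  set η := min 1 (ε / (2 * (|c| + |d| + 2))) with hη
  have hpos : 0 < |c| + |d| + 2 := by positivity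
  have hη0 : 0 < η := lt_min one_pos (by positivity)
  filter_upwards [hF η hη0, hG η hη0] with n h1 h2 x hx
  have h1 := h1 x hx
  have h2 := h2 x hx
  have hcx := (hc x hx).trans (le_abs_self c)
  have hdx := (hd x hx).trans (le_abs_self d)
  rw [dist_eq_norm] at h1 h2 ⊢
  have hGn : ‖G n x‖ ≤ |d| + 1 := by
    have := norm_le_norm_add_norm_sub (g x) (G n x)
    have : η ≤ 1 := min_le_left _ _
    linarith
  have hηε : η * (2 * (|c| + |d| + 2)) ≤ ε := by
    rw [← le_div_iff₀ (by positivity)]; exact min_le_right _ _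
  calc ‖f x * g x - F n x * G n x‖ = ‖f x * (g x - G n x) + (f x - F n x) * G n x‖ := by
        congr 1; noncomm_ring
    _ ≤ ‖f x‖ * ‖g x - G n x‖ + ‖f x - F n x‖ * ‖G n x‖ :=
        (norm_add_le _ _).trans (add_le_add (norm_mul_le _ _) (norm_mul_le _ _))
    _ ≤ |c| * η + η * (|d| + 1) := by gcongr
    _ < ε := by nlinarith

/-! ### Limits of the Green blocks and of the ratios -/

section Limit

open scoped Matrix.Norms.L2Operator

variable {r p : ℕ} {A B : ℕ → Matrix (Fin r) (Fin r) ℂ} {M : ℝ}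
  {a b : Fin p → Matrix (Fin r) (Fin r) ℂ}

lemma norm_greenBlock_le (hA : ∀ n, IsUnit (A (n + 1)).det) (hB : ∀ n, (B n).IsHermitian)
    (hzeros : ∀ (n : ℕ) (x : ℂ), (matPoly A B n x).det = 0 → x ∈ realInterval M) {α δ : ℝ}
    (hα : 0 < α) (hAα : ∀ n, ‖A n‖ ≤ α) (hδ : 0 < δ) {x : ℂ} (hx : x ∈ farSet M δ) (n : ℕ) :
    ‖greenBlock A B n x‖ ≤ δ⁻¹ := by
  simpa [greenBlock] using norm_matPoly_mul_inv_le hA hB hzeros hδ hα hAα hx (le_refl n)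

lemma uniformCauchySeqOn_greenBlock (hp : 0 < p) (hA : ∀ n, IsUnit (A (n + 1)).det)
    (hB : ∀ n, (B n).IsHermitian)
    (hzeros : ∀ (n : ℕ) (x : ℂ), (matPoly A B n x).det = 0 → x ∈ realInterval M)
    (hAlim : ∀ j : Fin p, Tendsto (fun n : ℕ => A (p * n + j)) atTop (𝓝 (a j)))
    (hBlim : ∀ j : Fin p, Tendsto (fun n : ℕ => B (p * n + j)) atTop (𝓝 (b j)))
    {δ : ℝ} (hδ : 0 < δ) (k : ℕ) :
    UniformCauchySeqOn (fun n x => greenBlock A B (p * n + k) x) atTop (farSet M δ) := by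
  obtain ⟨α, hα, hAα⟩ := exists_norm_le_of_tendsto_period hp hAlim
  rw [Metric.uniformCauchySeqOn_iff]
  intro ε hε
  set τ := decayRate δ α with hτ
  have hτ0 : 0 < τ := decayRate_pos _ _
  have hτ2 : τ ^ 2 < 1 := pow_lt_one₀ hτ0.le (decayRate_lt_one hδ hα) (by norm_num)
  have h1τ : 0 < 1 - τ ^ 2 := by linarith
  -- The constants 18 and 12 α make each of the two terms in `norm_greenBlock_sub_le` at most ε/6.
  -- Every late block is then within ε/3 of one reference block.
  set ε' := ε * (1 - τ ^ 2) * δ ^ 2 / 18 with hε'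
  have hε'0 : 0 < ε' := by positivity
  obtain ⟨N₁, hN₁⟩ := exists_norm_add_period_sub_le hp hAlim hε'0
  obtain ⟨N₂, hN₂⟩ := exists_norm_add_period_sub_le hp hBlim hε'0
  obtain ⟨d₀, hd₀⟩ := exists_pow_lt_of_lt_one (show 0 < ε * δ ^ 2 / (12 * α) by positivity) hτ2
  set N := max N₁ N₂ with hN
  set n₀ := N + d₀ + 1 with hn₀
  have hle : n₀ ≤ p * n₀ + k := by nlinarith
  obtain ⟨e, he⟩ := Nat.exists_eq_add_of_le hle
  have key : ∀ m x, x ∈ farSet M δ →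
      ‖greenBlock A B (p * (n₀ + m) + k) x - greenBlock A B (p * n₀ + k) x‖ ≤ ε / 3 := by
    intro m x hx
    have h := norm_greenBlock_sub_le hA hB hzeros hδ hα hAα (ε := ε') (s := p * m) (N := N)
      (fun k hk => by
        rw [show k + p * m + 1 = k + 1 + p * m by ring]
        exact hN₁ (k + 1) (by have := le_max_left N₁ N₂; omega) m)
      (fun k hk => by
        rw [show k + p * m + 1 = k + 1 + p * m by ring]
        exact hN₂ (k + 1) (by have := le_max_right N₁ N₂; omega) m) hx (d₀ + e)
    rw [show N + (d₀ + e) + 1 = p * n₀ + k by omega,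
      show p * n₀ + k + p * m = p * (n₀ + m) + k by ring] at h
    refine h.trans ?_
    rw [← hτ]
    have h2 : (τ ^ 2) ^ (d₀ + e) ≤ ε * δ ^ 2 / (12 * α) :=
      (pow_le_pow_of_le_one (by positivity) hτ2.le (Nat.le_add_right _ _)).trans hd₀.le
    calc δ⁻¹ ^ 2 * (2 * α * (τ ^ 2) ^ (d₀ + e) + 3 * ε' / (1 - τ ^ 2))
        ≤ δ⁻¹ ^ 2 * (2 * α * (ε * δ ^ 2 / (12 * α)) + 3 * ε' / (1 - τ ^ 2)) := by gcongr
      _ = ε / 3 := by rw [hε']; field_simp; norm_num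
  refine ⟨n₀, fun m hm n hn x hx => ?_⟩
  obtain ⟨m', rfl⟩ := Nat.exists_eq_add_of_le hm
  obtain ⟨n', rfl⟩ := Nat.exists_eq_add_of_le hn
  have h1 := key m' x hx
  have h2 := key n' x hx
  rw [← dist_eq_norm] at h1 h2
  have := dist_triangle_right (greenBlock A B (p * (n₀ + m') + k) x)
    (greenBlock A B (p * (n₀ + n') + k) x) (greenBlock A B (p * n₀ + k) x)
  linarith

/-- The limit of the diagonal resolvent blocks along `p n + k`. -/
noncomputable def greenLimit (A B : ℕ → Matrix (Fin r) (Fin r) ℂ) (p k : ℕ) (x : ℂ) :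
    Matrix (Fin r) (Fin r) ℂ :=
  limUnder atTop fun n => greenBlock A B (p * n + k) x

/-- The limit of `P (p n + k) (P (p n + k + i))⁻¹`. -/
noncomputable def ratioLimit (hp : 0 < p) (a : Fin p → Matrix (Fin r) (Fin r) ℂ)
    (ρ : ℕ → Matrix (Fin r) (Fin r) ℂ) (k : ℕ) : ℕ → Matrix (Fin r) (Fin r) ℂ
  | 0 => 1
  | i + 1 => ratioLimit hp a ρ k i * (ρ (k + i) * cyc hp a (k + i + 1))

variable (hp : 0 < p) (hA : ∀ n, IsUnit (A (n + 1)).det) (hB : ∀ n, (B n).IsHermitian)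
  (hzeros : ∀ (n : ℕ) (x : ℂ), (matPoly A B n x).det = 0 → x ∈ realInterval M)
  (hAlim : ∀ j : Fin p, Tendsto (fun n : ℕ => A (p * n + j)) atTop (𝓝 (a j)))
  (hBlim : ∀ j : Fin p, Tendsto (fun n : ℕ => B (p * n + j)) atTop (𝓝 (b j)))
  {δ : ℝ} (hδ : 0 < δ)

include hp hA hB hzeros hAlim hBlim hδ

lemma tendsto_greenBlock {x : ℂ} (hx : x ∈ farSet M δ) (k : ℕ) :
    Tendsto (fun n => greenBlock A B (p * n + k) x) atTop (𝓝 (greenLimit A B p k x)) :=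
  ((uniformCauchySeqOn_greenBlock hp hA hB hzeros hAlim hBlim hδ k).cauchySeq hx).tendsto_limUnder

lemma tendstoUniformlyOn_greenBlock (k : ℕ) :
    TendstoUniformlyOn (fun n x => greenBlock A B (p * n + k) x) (greenLimit A B p k) atTop
      (farSet M δ) :=
  (uniformCauchySeqOn_greenBlock hp hA hB hzeros hAlim hBlim hδ k).tendstoUniformlyOn_of_tendsto
    fun _ hx => tendsto_greenBlock hp hA hB hzeros hAlim hBlim hδ hx k

lemma norm_greenLimit_le {x : ℂ} (hx : x ∈ farSet M δ) (k : ℕ) :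
    ‖greenLimit A B p k x‖ ≤ δ⁻¹ := by
  obtain ⟨α, hα, hAα⟩ := exists_norm_le_of_tendsto_period hp hAlim
  exact le_of_tendsto (tendsto_greenBlock hp hA hB hzeros hAlim hBlim hδ hx k).norm
    (Eventually.of_forall fun n => norm_greenBlock_le hA hB hzeros hα hAα hδ hx _)

lemma greenLimit_add_period {x : ℂ} (hx : x ∈ farSet M δ) (k : ℕ) :
    greenLimit A B p (k + p) x = greenLimit A B p k x := by
  refine tendsto_nhds_unique (tendsto_greenBlock hp hA hB hzeros hAlim hBlim hδ hx (k + p)) ?_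
  refine ((tendsto_greenBlock hp hA hB hzeros hAlim hBlim hδ hx k).comp
    (tendsto_add_atTop_nat 1)).congr fun n => ?_
  simp only [Function.comp]
  rw [show p * (n + 1) + k = p * n + (k + p) by ring]

lemma conjTranspose_greenLimit {x : ℂ} (hx : x ∈ farSet M δ) (k : ℕ) :
    (greenLimit A B p k x)ᴴ = greenLimit A B p k (star x) := by
  refine tendsto_nhds_unique ?_
    (tendsto_greenBlock hp hA hB hzeros hAlim hBlim hδ (conj_mem_farSet hx) k)
  refine ((continuous_star.tendsto _).comp
    (tendsto_greenBlock hp hA hB hzeros hAlim hBlim hδ hx k)).congr fun n => ?_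
  exact conjTranspose_greenBlock hA hB hzeros hδ hx _

/-- The limit of the continued fraction step. Stated as a product equal to 1, it passes to the limit
by continuity of multiplication alone and yields the invertibility of the limits as a by-product. -/
lemma greenLimit_riccati {x : ℂ} (hx : x ∈ farSet M δ) (k : ℕ) :
    greenLimit A B p (k + 1) x * (x • (1 : Matrix (Fin r) (Fin r) ℂ) - cyc hp b (k + 1) -
      (cyc hp a (k + 1))ᴴ * greenLimit A B p k x * cyc hp a (k + 1)) = 1 := by
  have h1 := tendsto_greenBlock hp hA hB hzeros hAlim hBlim hδ hx (k + 1)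
  have h2 := tendsto_greenBlock hp hA hB hzeros hAlim hBlim hδ hx k
  have h3 := tendsto_cyc hp hAlim (k + 1)
  have h4 := tendsto_cyc hp hBlim (k + 1)
  have h5 : Tendsto (fun n => (A (p * n + (k + 1)))ᴴ) atTop (𝓝 (cyc hp a (k + 1))ᴴ) :=
    (continuous_star.tendsto _).comp h3
  have h6 := h1.mul (((tendsto_const_nhds (x := x • (1 : Matrix (Fin r) (Fin r) ℂ))).sub h4).sub
    ((h5.mul h2).mul h3))
  refine tendsto_nhds_unique h6 (tendsto_const_nhds.congr fun n => ?_)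
  have hu : IsUnit (greenBlock A B (p * n + k + 1) x).det := by
    rw [greenBlock, Matrix.det_mul]
    refine (isUnit_det_matPoly hzeros hδ hx _).mul (Matrix.isUnit_nonsing_inv_det _ ?_)
    rw [Matrix.det_mul]
    exact (hA _).mul (isUnit_det_matPoly hzeros hδ hx _)
  rw [← add_assoc]
  rw [greenBlock_succ hA _ x (isUnit_det_matPoly hzeros hδ hx _)] at hu ⊢
  rw [Matrix.nonsing_inv_mul _ (Matrix.isUnit_nonsing_inv_det_iff.1 hu)]

omit hA hB hAlim hBlim hp in
lemma matPoly_mul_inv_succ (hA : ∀ n, IsUnit (A (n + 1)).det) {x : ℂ} (hx : x ∈ farSet M δ)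
    (m i : ℕ) : matPoly A B m x * (matPoly A B (m + i + 1) x)⁻¹ =
      matPoly A B m x * (matPoly A B (m + i) x)⁻¹ *
        (greenBlock A B (m + i) x * A (m + i + 1)) := by
  rw [greenBlock, Matrix.mul_inv_rev, Matrix.mul_assoc, Matrix.mul_assoc, Matrix.mul_assoc,
    Matrix.nonsing_inv_mul _ (hA _), Matrix.mul_one,
    Matrix.nonsing_inv_mul_cancel_left _ _ (isUnit_det_matPoly hzeros hδ hx _)]

/-- P_m P_{m+i}⁻¹ telescopes into the factors G_{m+l} A_{m+l+1} with l < i. The bound is carried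
through the induction because a product of uniformly convergent sequences converges uniformly only
if the limits are bounded. -/
lemma tendstoUniformlyOn_ratioLimit (k i : ℕ) :
    (∃ c, ∀ x ∈ farSet M δ, ‖ratioLimit hp a (fun k => greenLimit A B p k x) k i‖ ≤ c) ∧
    TendstoUniformlyOn
      (fun n x => matPoly A B (p * n + k) x * (matPoly A B (p * n + k + i) x)⁻¹)
      (fun x => ratioLimit hp a (fun k => greenLimit A B p k x) k i) atTop (farSet M δ) := by
  induction i with
  | zero =>
    refine ⟨⟨‖(1 : Matrix (Fin r) (Fin r) ℂ)‖, fun x _ => le_rfl⟩, ?_⟩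
    rw [Metric.tendstoUniformlyOn_iff]
    refine fun ε hε => Eventually.of_forall fun n x hx => ?_
    simp only [add_zero, ratioLimit]
    rw [Matrix.mul_nonsing_inv _ (isUnit_det_matPoly hzeros hδ hx _), dist_self]
    exact hε
  | succ i ih =>
    obtain ⟨⟨c, hc⟩, hi⟩ := ih
    have hg : ∀ x ∈ farSet M δ, ‖greenLimit A B p (k + i) x‖ ≤ δ⁻¹ := fun x hx =>
      norm_greenLimit_le hp hA hB hzeros hAlim hBlim hδ hx _
    have hAc : TendstoUniformlyOn (fun n (_ : ℂ) => A (p * n + (k + i + 1)))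
        (fun _ => cyc hp a (k + i + 1)) atTop (farSet M δ) :=
      (tendsto_cyc hp hAlim (k + i + 1)).tendstoUniformlyOn_const _
    have hstep := tendstoUniformlyOn_mul_of_bounded
      (tendstoUniformlyOn_greenBlock hp hA hB hzeros hAlim hBlim hδ (k + i)) hAc ⟨_, hg⟩
      ⟨_, fun _ _ => le_rfl⟩
    have hb : ∀ x ∈ farSet M δ, ‖greenLimit A B p (k + i) x * cyc hp a (k + i + 1)‖ ≤
        δ⁻¹ * ‖cyc hp a (k + i + 1)‖ := fun x hx =>
      (norm_mul_le _ _).trans (mul_le_mul_of_nonneg_right (hg x hx) (norm_nonneg _))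
    refine ⟨⟨|c| * (δ⁻¹ * ‖cyc hp a (k + i + 1)‖), fun x hx => ?_⟩, ?_⟩
    · exact (norm_mul_le _ _).trans (mul_le_mul ((hc x hx).trans (le_abs_self c)) (hb x hx)
        (norm_nonneg _) (abs_nonneg _))
    · refine (tendstoUniformlyOn_mul_of_bounded hi hstep ⟨c, hc⟩ ⟨_, hb⟩).congr
        (Eventually.of_forall fun n x hx => ?_)
      simp only
      rw [← add_assoc (p * n + k) i 1, matPoly_mul_inv_succ hzeros hδ hA hx (p * n + k) i]
      simp only [add_assoc]

lemma tendsto_ratioLimit {x : ℂ} (hx : x ∈ farSet M δ) (k i : ℕ) :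
    Tendsto (fun n => matPoly A B (p * n + k) x * (matPoly A B (p * n + k + i) x)⁻¹) atTop
      (𝓝 (ratioLimit hp a (fun k => greenLimit A B p k x) k i)) :=
  (tendstoUniformlyOn_ratioLimit hp hA hB hzeros hAlim hBlim hδ k i).2.tendsto_at hx

/-- The decay estimate survives the limit. That C and τ do not depend on k and i is what later
bounds the spectral radius. -/
lemma exists_norm_ratioLimit_le {x : ℂ} (hx : x ∈ farSet M δ) :
    ∃ C τ : ℝ, 0 < τ ∧ τ < 1 ∧ ∀ k i,
      ‖ratioLimit hp a (fun k => greenLimit A B p k x) k (i + 1)‖ ≤ C * τ ^ i := by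
  obtain ⟨α, hα, hAα⟩ := exists_norm_le_of_tendsto_period hp hAlim
  refine ⟨δ⁻¹ * α, decayRate δ α, decayRate_pos _ _, decayRate_lt_one hδ hα, fun k i => ?_⟩
  refine le_of_tendsto (tendsto_ratioLimit hp hA hB hzeros hAlim hBlim hδ hx k (i + 1)).norm
    (Eventually.of_forall fun n => ?_)
  have h1 := norm_matPoly_mul_inv_le hA hB hzeros hδ hα hAα hx
    (show p * n + k ≤ p * n + k + i by omega)
  have h2 : matPoly A B (p * n + k) x * (matPoly A B (p * n + k + (i + 1)) x)⁻¹ =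
      matPoly A B (p * n + k) x * (A (p * n + k + i + 1) * matPoly A B (p * n + k + i + 1) x)⁻¹ *
        A (p * n + k + i + 1) := by
    rw [Matrix.mul_inv_rev, Matrix.mul_assoc, Matrix.mul_assoc, Matrix.nonsing_inv_mul _ (hA _),
      Matrix.mul_one, ← add_assoc]
  rw [h2]
  refine (norm_mul_le _ _).trans ((mul_le_mul h1 (hAα _) (norm_nonneg _) ?_).trans_eq ?_)
  · have := decayRate_pos δ α; positivity
  · rw [Nat.add_sub_cancel_left]; ring

end Limit
end MatrixRatio

namespace MatrixRatio

/-! ### Cyclic block matrices and their determinants -/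

section CyclicBlocks

variable {r p : ℕ}

/-- The cyclic successor in `Fin p`. -/
def cycNext (i : Fin p) : Fin p := ⟨((i : ℕ) + 1) % p, Nat.mod_lt _ i.pos⟩

lemma cycNext_surjective : Function.Surjective (cycNext : Fin p → Fin p) := by
  refine Finite.injective_iff_surjective.1 fun i j h => ?_
  have h1 : ((i : ℕ) + 1) % p = ((j : ℕ) + 1) % p := congrArg Fin.val h
  have hi := i.2
  have hj := j.2
  ext
  rcases Nat.lt_or_ge ((i : ℕ) + 1) p with h2 | h2 <;>
    rcases Nat.lt_or_ge ((j : ℕ) + 1) p with h3 | h3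
  · rw [Nat.mod_eq_of_lt h2, Nat.mod_eq_of_lt h3] at h1; omega
  · rw [Nat.mod_eq_of_lt h2, show (j : ℕ) + 1 = p by omega, Nat.mod_self] at h1; omega
  · rw [Nat.mod_eq_of_lt h3, show (i : ℕ) + 1 = p by omega, Nat.mod_self] at h1; omega
  · omega

lemma cycNext_injective : Function.Injective (cycNext : Fin p → Fin p) :=
  Finite.injective_iff_surjective.2 cycNext_surjective

/-- The block diagonal matrix with given blocks. -/
def blockDiag (c : Fin p → Matrix (Fin r) (Fin r) ℂ) :
    Matrix (Fin p × Fin r) (Fin p × Fin r) ℂ :=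
  Matrix.of fun s t => if s.1 = t.1 then c s.1 s.2 t.2 else 0

/-- The matrix with block `c i` in position `(i, i+1)` for `i + 1 < p` and block `w c (p-1)` in
position `(p-1, 0)`. -/
def cycMat (c : Fin p → Matrix (Fin r) (Fin r) ℂ) (w : ℂ) :
    Matrix (Fin p × Fin r) (Fin p × Fin r) ℂ :=
  Matrix.of fun s t =>
    if t.1 = cycNext s.1 then (if (s.1 : ℕ) + 1 = p then w else 1) * c s.1 s.2 t.2 else 0

lemma block_blockDiag_mulVec (c : Fin p → Matrix (Fin r) (Fin r) ℂ) (v : Fin p × Fin r → ℂ)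
    (i : Fin p) : block (blockDiag c *ᵥ v) i = c i *ᵥ block v i := by
  ext k
  simp only [block, Matrix.mulVec, dotProduct, Fintype.sum_prod_type, blockDiag, Matrix.of_apply]
  rw [Finset.sum_eq_single i]
  · simp
  · intro j _ hj; simp [Ne.symm hj]
  · simp

lemma block_cycMat_mulVec (c : Fin p → Matrix (Fin r) (Fin r) ℂ) (w : ℂ) (v : Fin p × Fin r → ℂ)
    (i : Fin p) : block (cycMat c w *ᵥ v) i =
      (if (i : ℕ) + 1 = p then w else 1) • c i *ᵥ block v (cycNext i) := by
  ext k
  simp only [block, Matrix.mulVec, dotProduct, Fintype.sum_prod_type, cycMat, Matrix.of_apply,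
    Pi.smul_apply, smul_eq_mul]
  rw [Finset.sum_eq_single (cycNext i)]
  · simp [Finset.mul_sum, mul_assoc]
  · intro j _ hj; simp [hj]
  · simp

lemma block_cycMat_conjTranspose_mulVec (c : Fin p → Matrix (Fin r) (Fin r) ℂ) (w : ℂ)
    (v : Fin p × Fin r → ℂ) (i : Fin p) : block ((cycMat c w)ᴴ *ᵥ v) (cycNext i) =
      (if (i : ℕ) + 1 = p then star w else 1) • (c i)ᴴ *ᵥ block v i := by
  ext k
  simp only [block, Matrix.mulVec, dotProduct, Fintype.sum_prod_type, cycMat, Matrix.of_apply,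
    Pi.smul_apply, smul_eq_mul, Matrix.conjTranspose_apply]
  rw [Finset.sum_eq_single i]
  · by_cases h : (i : ℕ) + 1 = p <;> simp [h, Finset.mul_sum, mul_assoc]
  · intro j _ hj
    have : cycNext i ≠ cycNext j := fun h => hj (cycNext_injective h).symm
    simp [this]
  · simp

lemma ext_block {v w : Fin p × Fin r → ℂ} (h : ∀ i, block v i = block w i) : v = w := by
  ext ⟨i, k⟩
  exact congrFun (h i) k

lemma det_blockDiag (c : Fin p → Matrix (Fin r) (Fin r) ℂ) :
    (blockDiag c).det = ∏ i, (c i).det := by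
  rw [← Matrix.det_blockDiagonal, ← Matrix.det_submatrix_equiv_self (Equiv.prodComm (Fin p) (Fin r))]
  congr 1

lemma blockDiag_mul_cycMat (c d : Fin p → Matrix (Fin r) (Fin r) ℂ) (w : ℂ) :
    blockDiag c * cycMat d w = cycMat (fun i => c i * d i) w := by
  refine Matrix.ext_of_mulVec_single fun s => ext_block fun i => ?_
  rw [← Matrix.mulVec_mulVec, block_blockDiag_mulVec, block_cycMat_mulVec, block_cycMat_mulVec,
    Matrix.mulVec_smul, Matrix.mulVec_mulVec]

/-- The determinant of a cyclic block matrix, when `y` satisfies the backward recursion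
`y i = c i * y (i + 1)`, `y (p - 1) = 1`. -/
lemma det_one_sub_cycMat (hp : 0 < p) (c : Fin p → Matrix (Fin r) (Fin r) ℂ) (w : ℂ)
    (y : Fin p → Matrix (Fin r) (Fin r) ℂ)
    (hy : ∀ i : Fin p, (i : ℕ) + 1 < p → y i = c i * y (cycNext i))
    (hlast : y ⟨p - 1, by omega⟩ = 1) :
    (1 - cycMat c w).det =
      (1 - w • (c ⟨p - 1, by omega⟩ * y ⟨0, hp⟩)).det := by
  let S := cycMat c 0
  let Y : Matrix (Fin p × Fin r) (Fin r) ℂ := Matrix.of fun s k => y s.1 s.2 k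
  let V : Matrix (Fin r) (Fin p × Fin r) ℂ := Matrix.of fun k t =>
    if (t.1 : ℕ) = 0 then c ⟨p - 1, by omega⟩ k t.2 else 0
  have hYv : ∀ (u : Fin r → ℂ) (i : Fin p), block (Y *ᵥ u) i = y i *ᵥ u := fun u i => rfl
  have hVv : ∀ v : Fin p × Fin r → ℂ, V *ᵥ v = c ⟨p - 1, by omega⟩ *ᵥ block v ⟨0, hp⟩ := by
    intro v
    ext k
    simp only [block, Matrix.mulVec, dotProduct, Fintype.sum_prod_type, V, Matrix.of_apply]
    rw [Finset.sum_eq_single (⟨0, hp⟩ : Fin p)]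
    · simp
    · intro j _ hj
      have : (j : ℕ) ≠ 0 := fun h => hj (Fin.ext h)
      simp [this]
    · simp
  -- By the backward recursion, (1 - S) Y is the identity in the last block and zero elsewhere. So
  -- the corner block is (1 - S) (w Y) V, a perturbation of rank at most r, and det(1 - UV) = det(1
  -- - VU) reduces the determinant to size r. The factor 1 - S is block unitriangular.
  have hfac : 1 - cycMat c w = (1 - S) * (1 - (w • Y) * V) := by
    refine Matrix.ext_of_mulVec_single fun s => ?_
    generalize (Pi.single s 1 : Fin p × Fin r → ℂ) = v
    rw [← Matrix.mulVec_mulVec]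
    simp only [Matrix.sub_mulVec, Matrix.one_mulVec, Matrix.smul_mul, Matrix.smul_mulVec,
      ← Matrix.mulVec_mulVec, Matrix.mulVec_sub, Matrix.mulVec_smul]
    refine ext_block fun i => ?_
    have e : ∀ (f g : Fin p × Fin r → ℂ), block (f - g) i = block f i - block g i := fun _ _ => rfl
    have e' : ∀ (t : ℂ) (f : Fin p × Fin r → ℂ), block (t • f) i = t • block f i := fun _ _ => rfl
    simp only [e, e', S, block_cycMat_mulVec, hYv]
    by_cases hi : (i : ℕ) + 1 = p
    · have hi' : i = ⟨p - 1, by omega⟩ := by ext; simp; omega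
      have hn : cycNext i = ⟨0, hp⟩ := by ext; simp [cycNext, hi]
      simp only [hi, if_true, zero_smul, hn, hVv]
      rw [hi', hlast, Matrix.one_mulVec]
      simp
    · have hlt : (i : ℕ) + 1 < p := by have := i.2; omega
      simp only [hi, if_false, one_smul]
      rw [hy i hlt, ← Matrix.mulVec_mulVec]
      module
  have hS : (1 - S).det = 1 := by
    have htri : (1 - S).BlockTriangular (fun s : Fin p × Fin r => s.1) := by
      intro s t hst
      have h1 : s ≠ t := by rintro rfl; exact lt_irrefl _ hst
      rw [Matrix.sub_apply, Matrix.one_apply_ne h1, zero_sub, neg_eq_zero]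
      simp only [S, cycMat, Matrix.of_apply]
      by_cases h : t.1 = cycNext s.1
      · by_cases hs : (s.1 : ℕ) + 1 = p
        · simp [hs]
        · exfalso
          have h2 : (s.1 : ℕ) + 1 < p := by have := s.1.2; omega
          have h3 : (t.1 : ℕ) = s.1 + 1 := by
            rw [h]; simp [cycNext, Nat.mod_eq_of_lt h2]
          have h4 : (t.1 : ℕ) < s.1 := hst
          omega
      · simp [h]
    rw [htri.det]
    refine Finset.prod_eq_one fun i _ => ?_
    have : (1 - S).toSquareBlock (fun s : Fin p × Fin r => s.1) i = 1 := by
      ext ⟨s, hs⟩ ⟨t, ht⟩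
      rw [Matrix.toSquareBlock_def, Matrix.of_apply, Matrix.sub_apply]
      have : S s t = 0 := by
        simp only [S, cycMat, Matrix.of_apply]
        by_cases h : t.1 = cycNext s.1
        · by_cases hs' : (s.1 : ℕ) + 1 = p
          · simp [hs']
          · exfalso
            have h2 : (s.1 : ℕ) + 1 < p := by have := s.1.2; omega
            have h3 : (t.1 : ℕ) = s.1 + 1 := by
              rw [h]; simp [cycNext, Nat.mod_eq_of_lt h2]
            have h4 : t.1 = s.1 := by
              rw [show s.1 = i from hs, show t.1 = i from ht]
            rw [h4] at h3
            omega
        · simp [h]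
      rw [this, sub_zero]
      by_cases h : s = t
      · subst h; simp
      · rw [Matrix.one_apply_ne h, Matrix.one_apply_ne (by simpa using h)]
    rw [this, Matrix.det_one]
  rw [hfac, Matrix.det_mul, hS, one_mul, Matrix.det_one_sub_mul_comm, Matrix.mul_smul]
  congr 3
  refine Matrix.ext_of_mulVec_single fun s => ?_
  rw [← Matrix.mulVec_mulVec, hVv, hYv, Matrix.mulVec_mulVec]

end CyclicBlocks

/-! ### Factorization of the symbol by a periodic Riccati solution -/

section Factorization

variable {r p : ℕ} (hp : 0 < p) (a b : Fin p → Matrix (Fin r) (Fin r) ℂ)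

/-- On the cycle of blocks the corners are ordinary neighbours across the edge from p - 1 to 0, the
only place where z enters. This treats all p ≥ 1 alike, including p ≤ 2. -/
lemma symbol_eq_cycMat (z x : ℂ) :
    symbol a b z x = blockDiag b - x • 1 + cycMat (fun i => a (cycNext i)) z⁻¹ +
      (cycMat (fun i => a (cycNext i)) (star z))ᴴ := by
  have h1 : ∀ (w : ℂ) (s t : Fin p × Fin r), cycMat (fun i => a (cycNext i)) w s t =
      (if (s.1 : ℕ) + 1 = t.1 then a t.1 s.2 t.2 else 0) + w * corner a s t := by
    intro w s t
    simp only [cycMat, Matrix.of_apply, corner]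
    have hs := s.1.2
    have ht := t.1.2
    by_cases hsp : (s.1 : ℕ) + 1 = p
    · have hn : ¬ ((s.1 : ℕ) + 1 = t.1) := by omega
      have hiff : t.1 = cycNext s.1 ↔ (t.1 : ℕ) = 0 := by
        rw [Fin.ext_iff]; simp [cycNext, hsp]
      by_cases ht0 : (t.1 : ℕ) = 0
      · rw [if_pos (hiff.2 ht0), if_pos hsp, if_neg hn, if_pos ⟨hsp, ht0⟩, zero_add,
          hiff.2 ht0]
      · rw [if_neg (fun h => ht0 (hiff.1 h)), if_neg hn, if_neg (fun h => ht0 h.2)]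
        simp
    · have hlt : (s.1 : ℕ) + 1 < p := by omega
      have hiff : t.1 = cycNext s.1 ↔ (s.1 : ℕ) + 1 = t.1 := by
        rw [Fin.ext_iff]; simp [cycNext, Nat.mod_eq_of_lt hlt, eq_comm]
      by_cases hst : (s.1 : ℕ) + 1 = t.1
      · rw [if_pos (hiff.2 hst), if_neg hsp, if_pos hst, if_neg (fun h => hsp h.1), mul_zero,
          add_zero, one_mul, ← hiff.2 hst]
      · rw [if_neg (fun h => hst (hiff.1 h)), if_neg hst, if_neg (fun h => hsp h.1)]
        simp
  ext s t
  simp only [symbol, Matrix.add_apply, Matrix.sub_apply, Matrix.smul_apply, smul_eq_mul,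
    Matrix.conjTranspose_apply, h1, tridiag, blockDiag, Matrix.of_apply, star_add, star_mul',
    star_star]
  have h2 : star (if (t.1 : ℕ) + 1 = s.1 then a s.1 t.2 s.2 else 0) =
      if (s.1 : ℕ) = t.1 + 1 then star (a s.1 t.2 s.2) else 0 := by
    by_cases h : (t.1 : ℕ) + 1 = s.1
    · simp [h]
    · simp [h, Ne.symm h]
  rw [h2]
  ring

lemma ratioLimit_add (ρ : ℕ → Matrix (Fin r) (Fin r) ℂ) (k i j : ℕ) :
    ratioLimit hp a ρ k (i + j) = ratioLimit hp a ρ k i * ratioLimit hp a ρ (k + i) j := by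
  induction j with
  | zero => simp [ratioLimit]
  | succ j ih =>
    rw [← add_assoc, ratioLimit, ih, ratioLimit, Matrix.mul_assoc, add_assoc k i j]

lemma ratioLimit_one (ρ : ℕ → Matrix (Fin r) (Fin r) ℂ) (k : ℕ) :
    ratioLimit hp a ρ k 1 = ρ k * cyc hp a (k + 1) := by
  simp [ratioLimit]

lemma det_ratioLimit (ρ : ℕ → Matrix (Fin r) (Fin r) ℂ) (k i : ℕ) :
    (ratioLimit hp a ρ k i).det =
      ∏ l ∈ Finset.range i, ((ρ (k + l)).det * (cyc hp a (k + l + 1)).det) := by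
  induction i with
  | zero => simp [ratioLimit]
  | succ i ih => rw [ratioLimit, Matrix.det_mul, ih, Finset.prod_range_succ, Matrix.det_mul]

variable {ρ : ℕ → Matrix (Fin r) (Fin r) ℂ} (hper : ∀ k, ρ (k + p) = ρ k)

include hper

lemma ratioLimit_add_period (k i : ℕ) :
    ratioLimit hp a ρ (k + p) i = ratioLimit hp a ρ k i := by
  induction i with
  | zero => rfl
  | succ i ih =>
    rw [ratioLimit, ratioLimit, ih, show k + p + i = k + i + p by ring, hper,
      show k + i + p + 1 = k + i + 1 + p by ring, cyc_add_period]

lemma ratioLimit_mul_period (k m : ℕ) :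
    ratioLimit hp a ρ k (m * p) = ratioLimit hp a ρ k p ^ m := by
  induction m with
  | zero => simp [ratioLimit]
  | succ m ih =>
    have h : ∀ m, ratioLimit hp a ρ (k + m * p) p = ratioLimit hp a ρ k p := by
      intro m
      induction m with
      | zero => simp
      | succ m ih => rw [Nat.succ_mul, ← add_assoc, ratioLimit_add_period hp a hper, ih]
    rw [Nat.succ_mul, ratioLimit_add, ih, h, pow_succ]

lemma ratioLimit_last_eq : ratioLimit hp a ρ (p - 1) p =
    (ρ (p - 1) * a ⟨0, hp⟩) * ratioLimit hp a ρ 0 (p - 1) := by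
  have h : ratioLimit hp a ρ (p - 1) (1 + (p - 1)) = _ := ratioLimit_add hp a ρ (p - 1) 1 (p - 1)
  have e : p - 1 + 1 = 0 + p := by omega
  rw [show 1 + (p - 1) = p by omega, ratioLimit_one, e, ratioLimit_add_period hp a hper] at h
  rw [h]
  congr 2
  simp [cyc]

lemma det_ratioLimit_last : (ratioLimit hp a ρ (p - 1) p).det =
    (∏ i : Fin p, (ρ i).det) * ∏ i : Fin p, (a (cycNext i)).det := by
  rw [ratioLimit_last_eq hp a hper, Matrix.det_mul, Matrix.det_mul, det_ratioLimit]
  have h1 : ∏ l ∈ Finset.range p, ((ρ l).det * (cyc hp a (l + 1)).det) =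
      (∏ i : Fin p, (ρ i).det) * ∏ i : Fin p, (a (cycNext i)).det := by
    rw [Finset.prod_range, Finset.prod_mul_distrib]
    rfl
  rw [← h1]
  obtain ⟨q, rfl⟩ : ∃ q, p = q + 1 := ⟨p - 1, by omega⟩
  rw [Finset.prod_range_succ, mul_comm]
  simp [cyc]

/-- The determinant of `1 - D N`. -/
lemma det_one_sub_cycMat_eq (w : ℂ) :
    (1 - cycMat (fun i : Fin p => ρ i * a (cycNext i)) w).det =
      (1 - w • ratioLimit hp a ρ (p - 1) p).det := by
  rw [det_one_sub_cycMat hp _ w (fun i => ratioLimit hp a ρ i (p - 1 - i)), ratioLimit_last_eq hp a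
    hper]
  · congr 4
    have : cycNext (⟨p - 1, by omega⟩ : Fin p) = ⟨0, hp⟩ := by
      ext; simp [cycNext, Nat.sub_add_cancel (show 1 ≤ p from hp)]
    rw [this]
  · intro i hi
    have h1 : p - 1 - (i : ℕ) = 1 + (p - 1 - (i + 1)) := by omega
    have h2 : ((cycNext i : Fin p) : ℕ) = i + 1 := by simp [cycNext, Nat.mod_eq_of_lt hi]
    rw [h2, h1, ratioLimit_add, ratioLimit_one]
    rfl
  · simp [ratioLimit]

variable {x : ℂ} (hric : ∀ k, ρ (k + 1) * (x • (1 : Matrix (Fin r) (Fin r) ℂ) - cyc hp b (k + 1) -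
      (cyc hp a (k + 1))ᴴ * ρ k * cyc hp a (k + 1)) = 1)

include hric

omit hper in
lemma isUnit_det_of_riccati_succ (k : ℕ) : IsUnit (ρ (k + 1)).det :=
  Matrix.isUnit_det_of_right_inverse (hric k)

lemma isUnit_det_of_riccati (k : ℕ) : IsUnit (ρ k).det := by
  rw [← hper k, show k + p = (k + p - 1) + 1 by omega]
  exact isUnit_det_of_riccati_succ hp a b hric _

omit hper in
lemma inv_eq_of_riccati (k : ℕ) : (ρ (k + 1))⁻¹ = x • (1 : Matrix (Fin r) (Fin r) ℂ) -
    cyc hp b (k + 1) - (cyc hp a (k + 1))ᴴ * ρ k * cyc hp a (k + 1) :=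
  Matrix.inv_eq_right_inv (hric k)

/-- The factorization of the symbol. -/
lemma neg_symbol_eq_mul {z : ℂ} (hz : z ≠ 0) : -symbol a b z x =
    (1 - (cycMat (fun i => (ρ i)ᴴ * a (cycNext i)) (star z))ᴴ) *
      (blockDiag (fun i : Fin p => (ρ i)⁻¹) *
        (1 - cycMat (fun i : Fin p => ρ i * a (cycNext i)) z⁻¹)) := by
  have hu := isUnit_det_of_riccati hp a b hper hric
  have hcc : ∀ i : Fin p, ((ρ i)ᴴ * a (cycNext i))ᴴ = (a (cycNext i))ᴴ * ρ i := fun i => by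
    rw [Matrix.conjTranspose_mul, Matrix.conjTranspose_conjTranspose]
  refine Matrix.ext_of_mulVec_single fun s => ?_
  generalize (Pi.single s 1 : Fin p × Fin r → ℂ) = v
  rw [symbol_eq_cycMat, Matrix.mul_sub, Matrix.mul_one, blockDiag_mul_cycMat,
    ← Matrix.mulVec_mulVec]
  simp only [Matrix.nonsing_inv_mul_cancel_left _ _ (hu _)]
  simp only [Matrix.sub_mulVec, Matrix.one_mulVec, Matrix.neg_mulVec, Matrix.add_mulVec,
    Matrix.smul_mulVec]
  refine ext_block fun i => ?_
  obtain ⟨i, rfl⟩ := cycNext_surjective i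
  have e : ∀ (f g : Fin p × Fin r → ℂ) j, block (f - g) j = block f j - block g j :=
    fun _ _ _ => rfl
  have e1 : ∀ (f g : Fin p × Fin r → ℂ) j, block (f + g) j = block f j + block g j :=
    fun _ _ _ => rfl
  have e2 : ∀ (f : Fin p × Fin r → ℂ) j, block (-f) j = -block f j := fun _ _ => rfl
  have e3 : ∀ (t : ℂ) (f : Fin p × Fin r → ℂ) j, block (t • f) j = t • block f j :=
    fun _ _ _ => rfl
  -- In the product the diagonal block at i + 1 is ρ_{i+1}⁻¹ + a_{i+1}ᴴ ρ_i a_{i+1}, and the Riccati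
  -- equation says that this is x - b_{i+1}. The wrap-around at i = p - 1 uses periodicity, and
  -- there the factors z and z⁻¹ cancel.
  have hinv : (ρ ((cycNext i : Fin p) : ℕ))⁻¹ = x • (1 : Matrix (Fin r) (Fin r) ℂ) -
      b (cycNext i) - (a (cycNext i))ᴴ * ρ i * a (cycNext i) := by
    have h1 := inv_eq_of_riccati hp a b hric i
    have h2 : ρ ((cycNext i : Fin p) : ℕ) = ρ (i + 1) := by
      rcases Nat.lt_or_ge ((i : ℕ) + 1) p with h | h
      · simp [cycNext, Nat.mod_eq_of_lt h]
      · have : (i : ℕ) + 1 = 0 + p := by have := i.2; omega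
        rw [this, hper]; simp [cycNext, this]
    rw [h2, h1]
    rfl
  simp only [e, e1, e2, e3, block_blockDiag_mulVec, block_cycMat_mulVec,
    block_cycMat_conjTranspose_mulVec, star_star, hinv, hcc, Matrix.sub_mulVec,
    Matrix.smul_mulVec, Matrix.one_mulVec]
  simp only [Matrix.mulVec_sub, Matrix.mulVec_smul, Matrix.mulVec_mulVec, smul_sub, smul_smul]
  have hw : (if (i : ℕ) + 1 = p then z else 1) * (if (i : ℕ) + 1 = p then z⁻¹ else 1) = 1 := by
    split_ifs
    · exact mul_inv_cancel₀ hz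
    · simp
  rw [hw, one_smul, Matrix.mul_assoc (a (cycNext i))ᴴ (ρ i) (ρ i)⁻¹,
    Matrix.mul_nonsing_inv _ (hu _), Matrix.mul_one]
  abel

end Factorization
end MatrixRatio

namespace MatrixRatio

/-! ### Eigenvectors and roots separated by the unit circle -/

section LinearAlgebra

lemma linearIndependent_of_eigenvectors {ι V : Type*} [Fintype ι] [AddCommGroup V] [Module ℂ V]
    (f : Module.End ℂ V) (μ : ι → ℂ) (w : ι → V) (hw : ∀ i, f (w i) = μ i • w i)
    (h : ∀ k, LinearIndependent ℂ (fun i : {i // μ i = μ k} => w i)) : LinearIndependent ℂ w := by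
  classical
  rw [Fintype.linearIndependent_iff]
  intro c hc k
  let u : ℂ → V := fun ζ => ∑ i with μ i = ζ, c i • w i
  have hu : ∀ ζ, u ζ ∈ f.eigenspace ζ := by
    intro ζ
    refine Submodule.sum_mem _ fun i hi => Submodule.smul_mem _ _ ?_
    rw [Module.End.mem_eigenspace_iff, hw, (Finset.mem_filter.1 hi).2]
  have hsum : ∑ ζ ∈ Finset.univ.image μ, u ζ = 0 := by
    rw [← hc]
    exact Finset.sum_fiberwise_of_maps_to (fun i _ => Finset.mem_image_of_mem μ (Finset.mem_univ i))
      fun i => c i • w i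
  have hzero := (iSupIndep_iff_finsetSum_eq_zero_imp_eq_zero _).1 f.eigenspaces_iSupIndep
    (Finset.univ.image μ) u (fun ζ _ => hu ζ) hsum (μ k)
    (Finset.mem_image_of_mem μ (Finset.mem_univ k))
  have h2 := Fintype.linearIndependent_iff.1 (h k) (fun i => c i) ?_ ⟨k, rfl⟩
  · exact h2
  · rw [← hzero]
    exact (Finset.sum_subtype _ (by simp) (fun i => c i • w i)).symm

/-- Exactly r entries have modulus below 1, so in a list sorted by modulus they occupy the first r
places. However ties are broken, this set of places is the same. -/
lemma small_roots_of_split {r : ℕ} {z : Fin (2 * r) → ℂ} (hmono : Monotone fun k => ‖z k‖)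
    {s t : Multiset ℂ} (hst : Finset.univ.val.map z = s + t) (hs : s.card = r)
    (hs1 : ∀ μ ∈ s, ‖μ‖ < 1) (ht1 : ∀ μ ∈ t, 1 < ‖μ‖) :
    (∀ k : Fin r, ‖z (small k)‖ < 1) ∧ Finset.univ.val.map (fun k : Fin r => z (small k)) = s := by
  classical
  let S : Finset (Fin (2 * r)) := {k | ‖z k‖ < 1}
  have hfilter : S.val.map z = s := by
    have h1 : S.val.map z = (Finset.univ.val.map z).filter (fun μ => ‖μ‖ < 1) := by
      rw [Multiset.filter_map]; rfl
    rw [h1, hst, Multiset.filter_add, Multiset.filter_eq_self.2 hs1,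
      Multiset.filter_eq_nil.2 fun μ hμ => not_lt.2 (ht1 μ hμ).le, add_zero]
  have hcard : S.card = r := by
    refine Eq.trans ?_ hs
    rw [← hfilter, Multiset.card_map]; rfl
  have hmem : ∀ k : Fin r, small k ∈ S := by
    intro k
    by_contra hk
    have hsub : S ⊆ Finset.Iio (small k) := by
      intro l hl
      rw [Finset.mem_Iio]
      by_contra hlk
      apply hk
      have h1 : ‖z l‖ < 1 := (Finset.mem_filter.1 hl).2
      exact Finset.mem_filter.2 ⟨Finset.mem_univ _, (hmono (not_lt.1 hlk)).trans_lt h1⟩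
    have := Finset.card_le_card hsub
    rw [hcard, Fin.card_Iio] at this
    have h2 : ((small k : Fin (2 * r)) : ℕ) = k := rfl
    have := k.2
    omega
  refine ⟨fun k => (Finset.mem_filter.1 (hmem k)).2, ?_⟩
  have hinj : Function.Injective (small : Fin r → Fin (2 * r)) := fun k l h => by
    simpa [small] using h
  have hS : S = Finset.univ.map ⟨small, hinj⟩ := by
    refine (Finset.eq_of_subset_of_card_le ?_ ?_).symm
    · intro l hl
      obtain ⟨k, _, rfl⟩ := Finset.mem_map.1 hl
      exact hmem k
    · rw [hcard, Finset.card_map, Finset.card_univ, Fintype.card_fin]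
  rw [← hfilter, hS, Finset.map_val, Multiset.map_map]
  rfl

lemma det_one_sub_smul_ne_zero {r : ℕ} {T : Matrix (Fin r) (Fin r) ℂ}
    (hT : ∀ (μ : ℂ) (w : Fin r → ℂ), w ≠ 0 → T *ᵥ w = μ • w → ‖μ‖ < 1) {w : ℂ} (hw : ‖w‖ ≤ 1) :
    (1 - w • T).det ≠ 0 := by
  intro h
  obtain ⟨u, hu, hu'⟩ := Matrix.exists_mulVec_eq_zero_iff.2 h
  rw [Matrix.sub_mulVec, Matrix.one_mulVec, Matrix.smul_mulVec, sub_eq_zero] at hu'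
  have hw0 : w ≠ 0 := by rintro rfl; rw [zero_smul] at hu'; exact hu hu'
  have h1 : T *ᵥ u = w⁻¹ • u := by
    rw [hu', smul_smul, inv_mul_cancel₀ hw0, one_smul, ← hu']
  have h2 := hT _ _ hu h1
  rw [norm_inv] at h2
  have h3 : 1 ≤ ‖w‖⁻¹ := (one_le_inv₀ (norm_pos_iff.2 hw0)).2 hw
  linarith

end LinearAlgebra

/-! ### The roots of det F outside the interval -/

section Roots

open Polynomial

lemma prod_det_cycNext_ne_zero {r p : ℕ} {a : Fin p → Matrix (Fin r) (Fin r) ℂ}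
    (ha : ∀ j, IsUnit (a j).det) : (∏ i : Fin p, (a (cycNext i)).det) ≠ 0 :=
  Finset.prod_ne_zero_iff.2 fun _ _ => (ha _).ne_zero

variable {r p : ℕ} (hp : 0 < p) (a b : Fin p → Matrix (Fin r) (Fin r) ℂ)
  {ρ : ℕ → Matrix (Fin r) (Fin r) ℂ} (hper : ∀ k, ρ (k + p) = ρ k)
  {x : ℂ} (hric : ∀ k, ρ (k + 1) * (x • (1 : Matrix (Fin r) (Fin r) ℂ) - cyc hp b (k + 1) -
      (cyc hp a (k + 1))ᴴ * ρ k * cyc hp a (k + 1)) = 1)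

include hper hric

lemma det_symbol {z : ℂ} (hz : z ≠ 0) : (symbol a b z x).det =
    (-1) ^ (p * r) * (star (1 - star z • ratioLimit hp a (fun k => (ρ k)ᴴ) (p - 1) p).det *
      ((∏ i : Fin p, (ρ i).det)⁻¹ * (1 - z⁻¹ • ratioLimit hp a ρ (p - 1) p).det)) := by
  have h := congrArg Matrix.det (neg_symbol_eq_mul hp a b hper hric hz)
  have hper' : ∀ k, (fun k => (ρ k)ᴴ) (k + p) = (fun k => (ρ k)ᴴ) k := fun k => by
    simp only [hper]
  rw [Matrix.det_neg, Matrix.det_mul, Matrix.det_mul, det_blockDiag,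
    det_one_sub_cycMat_eq hp a hper] at h
  have h1 : (1 - (cycMat (fun i : Fin p => (ρ i)ᴴ * a (cycNext i)) (star z))ᴴ).det =
      star (1 - star z • ratioLimit hp a (fun k => (ρ k)ᴴ) (p - 1) p).det := by
    rw [← det_one_sub_cycMat_eq hp a hper', ← Matrix.det_conjTranspose, Matrix.conjTranspose_sub,
      Matrix.conjTranspose_one]
  have h2 : ∏ i : Fin p, ((ρ i)⁻¹).det = (∏ i : Fin p, (ρ i).det)⁻¹ := by
    rw [← Finset.prod_inv_distrib]
    exact Finset.prod_congr rfl fun i _ => by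
      rw [Matrix.det_nonsing_inv, Ring.inverse_eq_inv]
  rw [h1, h2, Fintype.card_prod, Fintype.card_fin, Fintype.card_fin] at h
  rw [← h, ← mul_assoc, ← mul_pow]
  simp

variable (ha : ∀ j, IsUnit (a j).det)

include ha in
lemma isUnit_det_ratioLimit (k i : ℕ) : IsUnit (ratioLimit hp a ρ k i).det := by
  rw [det_ratioLimit]
  refine isUnit_iff_ne_zero.2 (Finset.prod_ne_zero_iff.2 fun l _ => ?_)
  exact mul_ne_zero (isUnit_det_of_riccati hp a b hper hric _).ne_zero (ha _).ne_zero

include ha in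
/-- The root polynomial splits into the characteristic polynomials of the limit matrix and of the
inverse of the adjoint of its counterpart at the conjugate point. -/
lemma rootPoly_eq_mul_charpoly : rootPoly a b x =
    C ((-1) ^ (p * r + r) * star (∏ i : Fin p, (a (cycNext i)).det)) *
      ((ratioLimit hp a ρ (p - 1) p).charpoly *
        ((ratioLimit hp a (fun k => (ρ k)ᴴ) (p - 1) p)ᴴ)⁻¹.charpoly) := by
  refine eq_of_infinite_eval_eq _ _ (Set.Infinite.mono (s := {0}ᶜ) (fun z hz => ?_)
    (Set.finite_singleton (0 : ℂ)).infinite_compl)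
  have hz : z ≠ 0 := hz
  set T := ratioLimit hp a ρ (p - 1) p with hT
  set T' := ratioLimit hp a (fun k => (ρ k)ᴴ) (p - 1) p with hT'
  have hper' : ∀ k, (fun k => (ρ k)ᴴ) (k + p) = (fun k => (ρ k)ᴴ) k := fun k => by
    simp only [hper]
  have hρ : (∏ i : Fin p, (ρ i).det) ≠ 0 := Finset.prod_ne_zero_iff.2 fun i _ =>
    (isUnit_det_of_riccati hp a b hper hric i).ne_zero
  have ha' := prod_det_cycNext_ne_zero ha
  have hdetT' : T'.det = star (∏ i : Fin p, (ρ i).det) * ∏ i : Fin p, (a (cycNext i)).det := by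
    rw [hT', det_ratioLimit_last hp a hper', star_prod]
    simp only [Matrix.det_conjTranspose]
  have hunit : IsUnit (T'ᴴ).det := by
    rw [Matrix.det_conjTranspose, hdetT']
    refine isUnit_iff_ne_zero.2 ?_
    simp only [star_mul', star_star]
    exact mul_ne_zero hρ (star_ne_zero.2 ha')
  change eval z _ = eval z _
  rw [eval_rootPoly a b hp x z hz, det_symbol hp a b hper hric hz, eval_mul, eval_C, eval_mul,
    Matrix.eval_charpoly, Matrix.eval_charpoly]
  have h1 : (Matrix.scalar (Fin r) z - T).det = z ^ r * (1 - z⁻¹ • T).det := by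
    have : Matrix.scalar (Fin r) z - T = z • (1 - z⁻¹ • T) := by
      rw [smul_sub, smul_smul, mul_inv_cancel₀ hz, one_smul, Matrix.smul_one_eq_diagonal]
      rfl
    rw [this, Matrix.det_smul, Fintype.card_fin]
  have h2 : star (1 - star z • T').det =
      (-1) ^ r * (star T'.det * (Matrix.scalar (Fin r) z - (T'ᴴ)⁻¹).det) := by
    have : (1 - star z • T')ᴴ = -(T'ᴴ * (Matrix.scalar (Fin r) z - (T'ᴴ)⁻¹)) := by
      rw [Matrix.mul_sub, Matrix.mul_nonsing_inv _ hunit, Matrix.conjTranspose_sub,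
        Matrix.conjTranspose_one, Matrix.conjTranspose_smul, star_star, neg_sub]
      congr 1
      ext i j
      simp [Matrix.scalar_apply, Matrix.mul_diagonal, mul_comm]
    rw [← Matrix.det_conjTranspose, this, Matrix.det_neg, Matrix.det_mul,
      Matrix.det_conjTranspose, Fintype.card_fin]
  rw [h1, h2, hdetT']
  simp only [star_mul', star_star]
  field_simp
  ring

variable (hspec : ∀ (μ : ℂ) (w : Fin r → ℂ), w ≠ 0 →
    ratioLimit hp a ρ (p - 1) p *ᵥ w = μ • w → ‖μ‖ < 1)
  (hspec' : ∀ (μ : ℂ) (w : Fin r → ℂ), w ≠ 0 →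
    ratioLimit hp a (fun k => (ρ k)ᴴ) (p - 1) p *ᵥ w = μ • w → ‖μ‖ < 1)

include ha in
lemma natDegree_rootPoly_of_riccati : (rootPoly a b x).natDegree = 2 * r := by
  rw [rootPoly_eq_mul_charpoly hp a b hper hric ha, natDegree_C_mul, natDegree_mul,
    Matrix.charpoly_natDegree_eq_dim, Matrix.charpoly_natDegree_eq_dim, Fintype.card_fin, two_mul]
  · exact (Matrix.charpoly_monic _).ne_zero
  · exact (Matrix.charpoly_monic _).ne_zero
  · exact mul_ne_zero (by simp) (star_ne_zero.2 (prod_det_cycNext_ne_zero ha))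

include ha in
-- The point is that neither ρ nor x occurs in the value. The same holds for the constant
-- coefficient below, and this carries both to the x in [-M, M], where no Riccati solution is
-- available.
lemma leadingCoeff_rootPoly_of_riccati : (rootPoly a b x).coeff (2 * r) =
    (-1) ^ (p * r + r) * star (∏ i : Fin p, (a (cycNext i)).det) := by
  rw [← natDegree_rootPoly_of_riccati hp a b hper hric ha, coeff_natDegree,
    rootPoly_eq_mul_charpoly hp a b hper hric ha, leadingCoeff_mul, leadingCoeff_mul,
    leadingCoeff_C, (Matrix.charpoly_monic _).leadingCoeff, (Matrix.charpoly_monic _).leadingCoeff]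
  ring

include ha in
lemma coeff_zero_rootPoly_of_riccati : (rootPoly a b x).coeff 0 =
    (-1) ^ (p * r + r) * ∏ i : Fin p, (a (cycNext i)).det := by
  have hper' : ∀ k, (fun k => (ρ k)ᴴ) (k + p) = (fun k => (ρ k)ᴴ) k := fun k => by
    simp only [hper]
  have hρ : (∏ i : Fin p, (ρ i).det) ≠ 0 := Finset.prod_ne_zero_iff.2 fun i _ =>
    (isUnit_det_of_riccati hp a b hper hric i).ne_zero
  have ha' := prod_det_cycNext_ne_zero ha
  rw [rootPoly_eq_mul_charpoly hp a b hper hric ha, coeff_zero_eq_eval_zero, eval_mul, eval_mul,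
    eval_C, Matrix.eval_charpoly, Matrix.eval_charpoly, map_zero, zero_sub, zero_sub,
    Matrix.det_neg, Matrix.det_neg, Matrix.det_nonsing_inv, Ring.inverse_eq_inv,
    Matrix.det_conjTranspose, det_ratioLimit_last hp a hper, det_ratioLimit_last hp a hper',
    Fintype.card_fin]
  simp only [star_mul', star_prod, Matrix.det_conjTranspose, star_star]
  rw [← star_prod]
  have ha'' := star_ne_zero.2 ha'
  have h1 : ((-1 : ℂ) ^ r) * (-1) ^ r = 1 := by rw [← mul_pow]; simp
  field_simp
  linear_combination h1

include ha hspec hspec' in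
-- The factor charpoly(T) has its r roots inside the unit disk. The roots of the other factor are
-- inverses of conjugates of eigenvalues of T', hence outside.
lemma IsOrderedRoots.small_roots {z : Fin (2 * r) → ℂ} (hz : IsOrderedRoots a b x z) :
    (∀ k : Fin r, ‖z (small k)‖ < 1) ∧
      ∏ k : Fin r, z (small k) = (ratioLimit hp a ρ (p - 1) p).det := by
  set T := ratioLimit hp a ρ (p - 1) p with hT
  set T' := ratioLimit hp a (fun k => (ρ k)ᴴ) (p - 1) p with hT'
  have hroots := hz.roots_eq
  rw [rootPoly_eq_mul_charpoly hp a b hper hric ha, roots_C_mul, roots_mul] at hroots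
  · have hper' : ∀ k, (fun k => (ρ k)ᴴ) (k + p) = (fun k => (ρ k)ᴴ) k := fun k => by
      simp only [hper]
    have hunit : IsUnit (T'ᴴ).det := by
      rw [Matrix.det_conjTranspose, hT', det_ratioLimit_last hp a hper']
      refine isUnit_iff_ne_zero.2 ?_
      simp only [star_mul', star_prod, Matrix.det_conjTranspose, star_star]
      refine mul_ne_zero ?_ ?_
      · exact Finset.prod_ne_zero_iff.2 fun i _ =>
          (isUnit_det_of_riccati hp a b hper hric i).ne_zero
      · exact Finset.prod_ne_zero_iff.2 fun i _ => by simpa using (ha _).ne_zero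
    have key := small_roots_of_split hz.norm_monotone hroots ?_ ?_ ?_
    · refine ⟨key.1, ?_⟩
      rw [Matrix.det_eq_prod_roots_charpoly, ← key.2]
      rfl
    · rw [← (IsAlgClosed.splits _).natDegree_eq_card_roots, Matrix.charpoly_natDegree_eq_dim,
        Fintype.card_fin]
    · intro μ hμ
      have h1 : T.charpoly.eval μ = 0 := isRoot_of_mem_roots hμ
      rw [Matrix.eval_charpoly] at h1
      obtain ⟨w, hw, hw'⟩ := Matrix.exists_mulVec_eq_zero_iff.2 h1
      refine hspec μ w hw ?_
      rw [Matrix.sub_mulVec, sub_eq_zero] at hw'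
      rw [← hw']
      ext i
      simp [Matrix.scalar_apply, Matrix.mulVec_diagonal]
    · intro μ hμ
      have h1 : ((T'ᴴ)⁻¹).charpoly.eval μ = 0 := isRoot_of_mem_roots hμ
      rw [Matrix.eval_charpoly] at h1
      by_contra hle
      have h2 := det_one_sub_smul_ne_zero hspec' (w := star μ) (by
        rw [norm_star]; exact not_lt.1 hle)
      apply h2
      rw [← star_eq_zero, ← Matrix.det_conjTranspose]
      have : (1 - star μ • T')ᴴ = -(T'ᴴ * (Matrix.scalar (Fin r) μ - (T'ᴴ)⁻¹)) := by
        rw [Matrix.mul_sub, Matrix.mul_nonsing_inv _ hunit, Matrix.conjTranspose_sub,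
          Matrix.conjTranspose_one, Matrix.conjTranspose_smul, star_star, neg_sub]
        congr 1
        ext i j
        simp [Matrix.scalar_apply, Matrix.mul_diagonal, mul_comm]
      rw [this, Matrix.det_neg, Matrix.det_mul, h1, mul_zero, mul_zero]
  · exact mul_ne_zero (Matrix.charpoly_monic _).ne_zero (Matrix.charpoly_monic _).ne_zero
  · exact mul_ne_zero (by simp) (star_ne_zero.2 (prod_det_cycNext_ne_zero ha))

end Roots

/-! ### From null vectors of the symbol to eigenvectors of the limit -/

section Eigenvectors

variable {r p : ℕ} (hp : 0 < p) {a b : Fin p → Matrix (Fin r) (Fin r) ℂ}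
  {ρ : ℕ → Matrix (Fin r) (Fin r) ℂ} (hper : ∀ k, ρ (k + p) = ρ k)

/-- The quasi-periodic extension of a block vector to all block indices. -/
noncomputable def quasiPeriodic (ζ : ℂ) (v : Fin p × Fin r → ℂ) (k : ℕ) : Fin r → ℂ :=
  ζ⁻¹ ^ (k / p) • block v ⟨k % p, Nat.mod_lt k hp⟩

include hper in
lemma quasiPeriodic_succ {ζ : ℂ} {v : Fin p × Fin r → ℂ}
    (hv : (1 - cycMat (fun i : Fin p => ρ i * a (cycNext i)) ζ⁻¹) *ᵥ v = 0) (k : ℕ) :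
    quasiPeriodic hp ζ v k = (ρ k * cyc hp a (k + 1)) *ᵥ quasiPeriodic hp ζ v (k + 1) := by
  have hblock : ∀ i : Fin p, block v i =
      (if (i : ℕ) + 1 = p then ζ⁻¹ else 1) • (ρ i * a (cycNext i)) *ᵥ block v (cycNext i) := by
    intro i
    rw [Matrix.sub_mulVec, Matrix.one_mulVec, sub_eq_zero] at hv
    exact (congrArg (fun u => block u i) hv).trans (block_cycMat_mulVec _ _ _ _)
  have hρ : ∀ q i, ρ (p * q + i) = ρ i := by
    intro q i
    induction q with
    | zero => simp
    | succ q ih => rw [Nat.mul_succ, add_right_comm, hper, ih]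
  obtain ⟨q, i, hi, rfl⟩ : ∃ q i, i < p ∧ k = p * q + i :=
    ⟨k / p, k % p, Nat.mod_lt k hp, (Nat.div_add_mod k p).symm⟩
  have e1 : quasiPeriodic hp ζ v (p * q + i) = ζ⁻¹ ^ q • block v ⟨i, hi⟩ := by
    simp [quasiPeriodic, Nat.mul_add_div hp, Nat.div_eq_of_lt hi, Nat.mod_eq_of_lt hi]
  have e2 : cyc hp a (p * q + i + 1) = a (cycNext ⟨i, hi⟩) := by
    simp [cyc, cycNext, add_assoc]
  rw [e1, e2, hρ, hblock]
  rcases Nat.lt_or_ge (i + 1) p with h | h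
  · have e3 : quasiPeriodic hp ζ v (p * q + i + 1) = ζ⁻¹ ^ q • block v (cycNext ⟨i, hi⟩) := by
      simp [quasiPeriodic, add_assoc, Nat.mul_add_div hp, Nat.div_eq_of_lt h, cycNext]
    have h' : ¬ (i + 1 = p) := by omega
    simp only [e3, Matrix.mulVec_smul, h', if_false, one_smul]
  · have h' : i + 1 = p := by omega
    have e3 : quasiPeriodic hp ζ v (p * q + i + 1) = ζ⁻¹ ^ (q + 1) • block v (cycNext ⟨i, hi⟩) := by
      simp only [quasiPeriodic, add_assoc, Nat.mul_add_div hp, cycNext, h', Nat.mul_add_mod,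
        Nat.div_self hp]
    simp only [e3, Matrix.mulVec_smul, h', if_true, smul_smul, pow_succ]

include hper in
lemma quasiPeriodic_eq_ratioLimit {ζ : ℂ} {v : Fin p × Fin r → ℂ}
    (hv : (1 - cycMat (fun i : Fin p => ρ i * a (cycNext i)) ζ⁻¹) *ᵥ v = 0) (k i : ℕ) :
    quasiPeriodic hp ζ v k = ratioLimit hp a ρ k i *ᵥ quasiPeriodic hp ζ v (k + i) := by
  induction i with
  | zero => simp [ratioLimit]
  | succ i ih =>
    rw [ih, ratioLimit, ← Matrix.mulVec_mulVec, quasiPeriodic_succ hp hper hv (k + i)]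
    rfl

lemma quasiPeriodic_coe (ζ : ℂ) (v : Fin p × Fin r → ℂ) (j : Fin p) :
    quasiPeriodic hp ζ v j = block v j := by
  simp [quasiPeriodic, Nat.div_eq_of_lt j.2, Nat.mod_eq_of_lt j.2]

include hper in
-- Along the quasi-periodic extension u of v the limit ratio maps u_{j+p} to u_j, while u_{j+p} =
-- ζ⁻¹ u_j.
lemma ratioLimit_mulVec_block {ζ : ℂ} (hζ : ζ ≠ 0) {v : Fin p × Fin r → ℂ}
    (hv : (1 - cycMat (fun i : Fin p => ρ i * a (cycNext i)) ζ⁻¹) *ᵥ v = 0) (j : Fin p) :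
    ratioLimit hp a ρ j p *ᵥ block v j = ζ • block v j := by
  have h := quasiPeriodic_eq_ratioLimit hp hper hv j p
  have e : quasiPeriodic hp ζ v (j + p) = ζ⁻¹ • block v j := by
    simp [quasiPeriodic, Nat.add_div_right _ hp, Nat.div_eq_of_lt j.2, Nat.mod_eq_of_lt j.2]
  rw [quasiPeriodic_coe, e, Matrix.mulVec_smul] at h
  rw [h, smul_smul, mul_inv_cancel₀ hζ, one_smul, ← h]

include hper in
-- Any two values of the quasi-periodic extension are linked by an invertible product, so taking the
-- j-th block is injective on null vectors of the right factor.
lemma eq_zero_of_block_eq_zero (hunit : ∀ k i, IsUnit (ratioLimit hp a ρ k i).det) {ζ : ℂ}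
    (hζ : ζ ≠ 0) {v : Fin p × Fin r → ℂ}
    (hv : (1 - cycMat (fun i : Fin p => ρ i * a (cycNext i)) ζ⁻¹) *ᵥ v = 0) (j : Fin p)
    (h0 : block v j = 0) : v = 0 := by
  refine ext_block fun i => ?_
  have h := quasiPeriodic_eq_ratioLimit hp hper hv j (p + i - j)
  rw [quasiPeriodic_coe, h0, show (j : ℕ) + (p + i - j) = i + p by omega] at h
  have h1 : quasiPeriodic hp ζ v (i + p) = 0 := by
    have := congrArg (fun t => (ratioLimit hp a ρ j (p + i - j))⁻¹ *ᵥ t) h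
    simpa only [Matrix.mulVec_mulVec, Matrix.nonsing_inv_mul _ (hunit _ _), Matrix.one_mulVec,
      Matrix.mulVec_zero, eq_comm] using this
  have e : quasiPeriodic hp ζ v (i + p) = ζ⁻¹ • block v i := by
    simp [quasiPeriodic, Nat.add_div_right _ hp, Nat.div_eq_of_lt i.2, Nat.mod_eq_of_lt i.2]
  rw [e] at h1
  exact (smul_eq_zero.1 h1).resolve_left (inv_ne_zero hζ)

variable {x : ℂ} (hric : ∀ k, ρ (k + 1) * (x • (1 : Matrix (Fin r) (Fin r) ℂ) - cyc hp b (k + 1) -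
      (cyc hp a (k + 1))ᴴ * ρ k * cyc hp a (k + 1)) = 1)
  (ha : ∀ j, IsUnit (a j).det)
  (hspec : ∀ (μ : ℂ) (w : Fin r → ℂ), w ≠ 0 →
    ratioLimit hp a ρ (p - 1) p *ᵥ w = μ • w → ‖μ‖ < 1)
  (hspec' : ∀ (μ : ℂ) (w : Fin r → ℂ), w ≠ 0 →
    ratioLimit hp a (fun k => (ρ k)ᴴ) (p - 1) p *ᵥ w = μ • w → ‖μ‖ < 1)

include hper hric hspec' in
/-- Null vectors of the symbol at points of the unit disk are null vectors of the right factor. -/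
lemma cycMat_mulVec_eq_zero_of_symbol {ζ : ℂ} (hζ : ζ ≠ 0) (hζ1 : ‖ζ‖ < 1)
    {v : Fin p × Fin r → ℂ} (hv : symbol a b ζ x *ᵥ v = 0) :
    (1 - cycMat (fun i : Fin p => ρ i * a (cycNext i)) ζ⁻¹) *ᵥ v = 0 := by
  have hper' : ∀ k, (fun k => (ρ k)ᴴ) (k + p) = (fun k => (ρ k)ᴴ) k := fun k => by
    simp only [hper]
  have hunit1 : IsUnit
      (1 - (cycMat (fun i : Fin p => (ρ i)ᴴ * a (cycNext i)) (star ζ))ᴴ).det := by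
    have h1 : (1 - (cycMat (fun i : Fin p => (ρ i)ᴴ * a (cycNext i)) (star ζ))ᴴ).det =
        star (1 - star ζ • ratioLimit hp a (fun k => (ρ k)ᴴ) (p - 1) p).det := by
      rw [← det_one_sub_cycMat_eq hp a hper', ← Matrix.det_conjTranspose,
        Matrix.conjTranspose_sub, Matrix.conjTranspose_one]
    rw [h1, isUnit_iff_ne_zero, Ne, star_eq_zero]
    exact det_one_sub_smul_ne_zero hspec' (by rw [norm_star]; exact hζ1.le)
  have hunit2 : IsUnit (blockDiag fun i : Fin p => (ρ i)⁻¹).det := by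
    rw [det_blockDiag, isUnit_iff_ne_zero, Finset.prod_ne_zero_iff]
    exact fun i _ => (Matrix.isUnit_nonsing_inv_det _
      (isUnit_det_of_riccati hp a b hper hric i)).ne_zero
  have h := congrArg (fun T => T *ᵥ v) (neg_symbol_eq_mul hp a b hper hric hζ)
  simp only [Matrix.neg_mulVec, hv, neg_zero] at h
  rw [← Matrix.mulVec_mulVec, ← Matrix.mulVec_mulVec] at h
  have h3 := (Matrix.mulVec_injective_iff_isUnit.2 ((Matrix.isUnit_iff_isUnit_det _).2 hunit1))
    (h.symm.trans (Matrix.mulVec_zero _).symm)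
  exact (Matrix.mulVec_injective_iff_isUnit.2 ((Matrix.isUnit_iff_isUnit_det _).2 hunit2))
    (h3.trans (Matrix.mulVec_zero _).symm)

include hper hric hspec hspec' ha in
/-- The blocks of the null vectors belonging to the small roots are linearly independent
eigenvectors of the limit matrix. -/
lemma IsNullSystem.block_eigenvectors {z : Fin (2 * r) → ℂ} {v : Fin (2 * r) → Fin p × Fin r → ℂ}
    (hz : IsOrderedRoots a b x z) (hv : IsNullSystem a b x z v) (j : Fin p) :
    LinearIndependent ℂ (fun k : Fin r => block (v (small k)) j) ∧
      ∀ k : Fin r, ratioLimit hp a ρ j p *ᵥ block (v (small k)) j =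
        z (small k) • block (v (small k)) j := by
  have hsmall := (hz.small_roots hp a b hper hric ha hspec hspec').1
  have hz0 : ∀ k, z k ≠ 0 := by
    intro k hk
    have h1 := hz.eval_eq_zero k
    rw [hk, ← Polynomial.coeff_zero_eq_eval_zero, coeff_zero_rootPoly_of_riccati hp a b hper hric ha]
      at h1
    exact mul_ne_zero (by simp) (Finset.prod_ne_zero_iff.2 fun i _ => (ha _).ne_zero) h1
  have hker : ∀ k : Fin r,
      (1 - cycMat (fun i : Fin p => ρ i * a (cycNext i)) (z (small k))⁻¹) *ᵥ v (small k) = 0 :=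
    fun k => cycMat_mulVec_eq_zero_of_symbol hp hper hric hspec' (hz0 _) (hsmall k) (hv.null _)
  have heig : ∀ k : Fin r, ratioLimit hp a ρ j p *ᵥ block (v (small k)) j =
        z (small k) • block (v (small k)) j := fun k =>
    ratioLimit_mulVec_block hp hper (hz0 _) (hker k) j
  refine ⟨?_, heig⟩
  refine linearIndependent_of_eigenvectors (ratioLimit hp a ρ j p).mulVecLin
    (fun k => z (small k)) _ heig fun k => ?_
  have hinj : Function.Injective (fun l : {l : Fin r // z (small l) = z (small k)} =>
      (⟨small l.1, l.2⟩ : {l // z l = z (small k)})) := by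
    intro l m hlm
    ext
    simpa [small, Fin.ext_iff] using hlm
  have hLI := (hv.linearIndependent hz (small k)).comp _ hinj
  rw [Fintype.linearIndependent_iff] at hLI ⊢
  intro c hc
  refine hLI c ?_
  -- Within one root, a combination of the v's is again a null vector of the right factor, so it
  -- vanishes as soon as its j-th block does.
  refine eq_zero_of_block_eq_zero hp hper (isUnit_det_ratioLimit hp a b hper hric ha)
    (hz0 (small k)) ?_ j ?_
  · rw [Matrix.mulVec_sum]
    refine Finset.sum_eq_zero fun l _ => ?_
    have := hker l.1
    rw [l.2] at this
    rw [Matrix.mulVec_smul]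
    simp only [Function.comp]
    rw [this, smul_zero]
  · rw [← hc]
    ext i
    simp [block, Finset.sum_apply]

end Eigenvectors
end MatrixRatio

namespace MatrixRatio

/-! ### Compact sets off the interval and uniform convergence -/

section Complement

variable {M : ℝ}

lemma exists_subset_farSet {K : Set ℂ} (hK : IsCompact K) (hKM : K ⊆ (realInterval M)ᶜ) :
    ∃ δ, 0 < δ ∧ K ⊆ farSet M δ := by
  have hI : IsClosed (realInterval M) :=
    (isCompact_Icc.image Complex.continuous_ofReal).isClosed
  obtain ⟨δ, hδ, h⟩ := Metric.exists_pos_forall_lt_edist hK hI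
    (Set.disjoint_left.2 fun x hx hx' => hKM hx hx')
  refine ⟨δ, hδ, fun x hx t ht => ?_⟩
  have h1 := h x hx t ⟨t, ht, rfl⟩
  rw [edist_nndist, ENNReal.coe_lt_coe] at h1
  rw [← dist_eq_norm]
  exact_mod_cast h1.le

lemma exists_mem_farSet {x : ℂ} (hx : x ∉ realInterval M) : ∃ δ, 0 < δ ∧ x ∈ farSet M δ := by
  obtain ⟨δ, hδ, h⟩ := exists_subset_farSet (isCompact_singleton (x := x))
    (Set.singleton_subset_iff.2 hx)
  exact ⟨δ, hδ, h rfl⟩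

lemma infinite_compl_realInterval : ((realInterval M)ᶜ).Infinite := by
  refine Set.infinite_of_injective_forall_mem (f := fun n : ℕ => ((n : ℂ) + 1) * Complex.I) ?_ ?_
  · intro m n h
    have := mul_right_cancel₀ Complex.I_ne_zero h
    exact_mod_cast add_right_cancel this
  · rintro n ⟨t, _, ht⟩
    have := congrArg Complex.im ht
    simp at this
    have h2 : (0 : ℝ) ≤ n := Nat.cast_nonneg n
    linarith

end Complement

section UniformConvergence

lemma tendstoUniformlyOn_comp_of_bounded {S E F : Type*} [NormedAddCommGroup E] [ProperSpace E]
    [PseudoMetricSpace F] {G : ℕ → S → E} {g : S → E} {s : Set S}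
    (hG : TendstoUniformlyOn G g atTop s) (hg : ∃ c, ∀ x ∈ s, ‖g x‖ ≤ c) {f : E → F}
    (hf : Continuous f) :
    TendstoUniformlyOn (fun n x => f (G n x)) (fun x => f (g x)) atTop s := by
  obtain ⟨c, hc⟩ := hg
  have hu := (isCompact_closedBall (0 : E) (c + 1)).uniformContinuousOn_of_continuous
    hf.continuousOn
  rw [Metric.uniformContinuousOn_iff] at hu
  rw [Metric.tendstoUniformlyOn_iff] at hG ⊢
  intro ε hε
  obtain ⟨η, hη, hη'⟩ := hu ε hε
  filter_upwards [hG (min η 1) (lt_min hη one_pos)] with n hn x hx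
  have h1 := hn x hx
  have h2 := hc x hx
  refine hη' _ ?_ _ ?_ (h1.trans_le (min_le_left _ _))
  · rw [mem_closedBall_zero_iff]; linarith
  · rw [mem_closedBall_zero_iff]
    have h3 := h1.trans_le (min_le_right _ _)
    rw [dist_eq_norm] at h3
    have h4 := norm_le_norm_add_norm_sub (g x) (G n x)
    linarith

lemma tendstoUniformlyOn_of_residues {S F : Type*} [PseudoMetricSpace F] {p : ℕ} (hp : 0 < p)
    {G : ℕ → S → F} {g : S → F} {s : Set S}
    (h : ∀ j : Fin p, TendstoUniformlyOn (fun n x => G (p * n + j) x) g atTop s) :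
    TendstoUniformlyOn G g atTop s := by
  rw [Metric.tendstoUniformlyOn_iff]
  intro ε hε
  have h1 : ∀ᶠ n in atTop, ∀ j : Fin p, ∀ x ∈ s, dist (g x) (G (p * n + j) x) < ε :=
    eventually_all.2 fun j => Metric.tendstoUniformlyOn_iff.1 (h j) ε hε
  obtain ⟨N, hN⟩ := eventually_atTop.1 h1
  refine eventually_atTop.2 ⟨p * N, fun n hn x hx => ?_⟩
  have h2 := hN (n / p) ((Nat.le_div_iff_mul_le hp).2 (by rwa [mul_comm])) ⟨n % p, Nat.mod_lt n hp⟩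
    x hx
  simpa only [Nat.div_add_mod] using h2

end UniformConvergence

/-! ### Assembly of the theorem -/

section Main

open scoped Matrix.Norms.L2Operator

variable {r p : ℕ} {A B : ℕ → Matrix (Fin r) (Fin r) ℂ} {M : ℝ}
  {a b : Fin p → Matrix (Fin r) (Fin r) ℂ}

/-- The m-th power of the product over one period is the product over m p steps, which tends to 0,
whereas μ^m w would not if |μ| ≥ 1. -/
lemma norm_lt_one_of_ratioLimit_decay (hp : 0 < p) {ρ : ℕ → Matrix (Fin r) (Fin r) ℂ}
    (hper : ∀ k, ρ (k + p) = ρ k) {C τ : ℝ} (hτ0 : 0 < τ) (hτ1 : τ < 1)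
    (h : ∀ k i, ‖ratioLimit hp a ρ k (i + 1)‖ ≤ C * τ ^ i) (k : ℕ) (μ : ℂ) (w : Fin r → ℂ)
    (hw : w ≠ 0) (hμ : ratioLimit hp a ρ k p *ᵥ w = μ • w) : ‖μ‖ < 1 := by
  by_contra hlt
  have hμ1 : 1 ≤ ‖μ‖ := not_lt.1 hlt
  have hw0 : 0 < euclNorm w := by
    refine norm_pos_iff.2 fun h0 => hw ?_
    simpa using h0
  obtain ⟨m, hm⟩ := exists_pow_lt_of_lt_one (show 0 < 1 / (|C| + 1) by positivity) hτ1
  obtain ⟨i, hi⟩ : ∃ i, (m + 1) * p = i + 1 := ⟨(m + 1) * p - 1, by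
    have := Nat.mul_pos (Nat.succ_pos m) hp
    simp only [Nat.succ_eq_add_one] at this
    omega⟩
  have hmi : m ≤ i := by nlinarith
  have hpow : ∀ q, ratioLimit hp a ρ k p ^ q *ᵥ w = μ ^ q • w := by
    intro q
    induction q with
    | zero => simp
    | succ q ih =>
      rw [pow_succ, ← Matrix.mulVec_mulVec, hμ, Matrix.mulVec_smul, ih, smul_smul, pow_succ']
  have h1 := hpow (m + 1)
  rw [← ratioLimit_mul_period hp a hper, hi] at h1
  have h2 := euclNorm_mulVec_le (ratioLimit hp a ρ k (i + 1)) w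
  have h3 : euclNorm (μ ^ (m + 1) • w) = ‖μ‖ ^ (m + 1) * euclNorm w := by
    rw [euclNorm, WithLp.toLp_smul, norm_smul, norm_pow]; rfl
  rw [h1, h3] at h2
  have h4 : ‖μ‖ ^ (m + 1) ≤ C * τ ^ i := (le_of_mul_le_mul_right h2 hw0).trans (h k i)
  have h5 : (1 : ℝ) ≤ ‖μ‖ ^ (m + 1) := one_le_pow₀ hμ1
  have h6 : C * τ ^ i ≤ |C| * τ ^ m := mul_le_mul (le_abs_self C)
    (pow_le_pow_of_le_one hτ0.le hτ1.le hmi) (by positivity) (abs_nonneg C)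
  rw [lt_div_iff₀ (by positivity)] at hm
  nlinarith [pow_pos hτ0 m]

/-- Period products with different starting points are similar: L_j U = U L_{p-1}, with U the
invertible product from j to p - 1. -/
lemma det_ratioLimit_eq_last (hp : 0 < p) {ρ : ℕ → Matrix (Fin r) (Fin r) ℂ}
    (hper : ∀ k, ρ (k + p) = ρ k) (hunit : ∀ k i, IsUnit (ratioLimit hp a ρ k i).det) (j : Fin p) :
    (ratioLimit hp a ρ j p).det = (ratioLimit hp a ρ (p - 1) p).det := by
  have h1 := ratioLimit_add hp a ρ j (p - 1 - j) p
  have h2 := ratioLimit_add hp a ρ j p (p - 1 - j)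
  have hj := j.2
  rw [show (j : ℕ) + (p - 1 - j) = p - 1 by omega] at h1
  rw [add_comm p, h1, ratioLimit_add_period hp a hper] at h2
  have h3 := congrArg Matrix.det h2
  rw [Matrix.det_mul, Matrix.det_mul, mul_comm] at h3
  exact (mul_right_cancel₀ (hunit _ _).ne_zero h3).symm

lemma norm_apply_le_euclNorm {n : Type*} [Fintype n] (v : n → ℂ) (i : n) : ‖v i‖ ≤ euclNorm v :=
  PiLp.norm_apply_le (WithLp.toLp 2 v : EuclideanSpace ℂ n) i

lemma euclNorm_block_le (v : Fin p × Fin r → ℂ) (j : Fin p) : euclNorm (block v j) ≤ euclNorm v := by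
  refine le_of_sq_le_sq ?_ (euclNorm_nonneg _)
  rw [euclNorm_sq_prod v]
  exact Finset.single_le_sum (f := fun i => euclNorm (fun k => v (i, k)) ^ 2)
    (fun _ _ => sq_nonneg _) (Finset.mem_univ j)

/-- Each coefficient is a polynomial in x, so a constant value off the interval, an infinite set, is
its value everywhere. -/
lemma coeff_rootPoly_eq_of_forall_compl (n : ℕ) (c : ℂ)
    (h : ∀ x ∉ realInterval M, (rootPoly a b x).coeff n = c) (x : ℂ) :
    (rootPoly a b x).coeff n = c := by
  have hcoeff : ∀ x, (rootPoly a b x).coeff n = ((rootPolyParam a b).coeff n).eval x := by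
    intro x
    rw [← rootPolyParam_map, Polynomial.coeff_map, Polynomial.coe_evalRingHom]
  have heq : (rootPolyParam a b).coeff n = Polynomial.C c := by
    refine Polynomial.eq_of_infinite_eval_eq _ _
      (infinite_compl_realInterval.mono fun x (hx : x ∉ realInterval M) => ?_)
    change Polynomial.eval x _ = Polynomial.eval x _
    rw [← hcoeff, h x hx, Polynomial.eval_C]
  rw [hcoeff, heq, Polynomial.eval_C]

variable (hp : 0 < p) (hA : ∀ n, IsUnit (A (n + 1)).det) (hB : ∀ n, (B n).IsHermitian)
  (hzeros : ∀ (n : ℕ) (x : ℂ), (matPoly A B n x).det = 0 → x ∈ realInterval M)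
  (ha : ∀ j, IsUnit (a j).det)
  (hAlim : ∀ j : Fin p, Tendsto (fun n : ℕ => A (p * n + j)) atTop (𝓝 (a j)))
  (hBlim : ∀ j : Fin p, Tendsto (fun n : ℕ => B (p * n + j)) atTop (𝓝 (b j)))

include hp hA hB hzeros hAlim hBlim

lemma norm_lt_one_of_eigenvector {δ : ℝ} (hδ : 0 < δ) {x : ℂ} (hx : x ∈ farSet M δ) (μ : ℂ)
    (w : Fin r → ℂ) (hw : w ≠ 0)
    (hμ : ratioLimit hp a (fun k => greenLimit A B p k x) (p - 1) p *ᵥ w = μ • w) : ‖μ‖ < 1 := by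
  obtain ⟨C, τ, hτ0, hτ1, h⟩ := exists_norm_ratioLimit_le hp hA hB hzeros hAlim hBlim hδ hx
  exact norm_lt_one_of_ratioLimit_decay hp
    (greenLimit_add_period hp hA hB hzeros hAlim hBlim hδ hx) hτ0 hτ1 h _ μ w hw hμ

lemma norm_lt_one_of_eigenvector_conjTranspose {δ : ℝ} (hδ : 0 < δ) {x : ℂ} (hx : x ∈ farSet M δ)
    (μ : ℂ) (w : Fin r → ℂ) (hw : w ≠ 0)
    (hμ : ratioLimit hp a (fun k => (greenLimit A B p k x)ᴴ) (p - 1) p *ᵥ w = μ • w) :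
    ‖μ‖ < 1 := by
  simp only [conjTranspose_greenLimit hp hA hB hzeros hAlim hBlim hδ hx] at hμ
  exact norm_lt_one_of_eigenvector hp hA hB hzeros hAlim hBlim hδ (conj_mem_farSet hx) μ w hw hμ

/-- Outside the interval, the limits of the blocks of the Green's functions form a periodic
solution of the Riccati equation, whose products over a period have spectral radius below one. -/
lemma exists_riccati_solution {x : ℂ} (hx : x ∉ realInterval M) :
    ∃ ρ : ℕ → Matrix (Fin r) (Fin r) ℂ, (ρ = fun k => greenLimit A B p k x) ∧
      (∀ k, ρ (k + p) = ρ k) ∧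
      (∀ k, ρ (k + 1) * (x • (1 : Matrix (Fin r) (Fin r) ℂ) - cyc hp b (k + 1) -
        (cyc hp a (k + 1))ᴴ * ρ k * cyc hp a (k + 1)) = 1) ∧
      (∀ (μ : ℂ) (w : Fin r → ℂ), w ≠ 0 →
        ratioLimit hp a ρ (p - 1) p *ᵥ w = μ • w → ‖μ‖ < 1) ∧
      ∀ (μ : ℂ) (w : Fin r → ℂ), w ≠ 0 →
        ratioLimit hp a (fun k => (ρ k)ᴴ) (p - 1) p *ᵥ w = μ • w → ‖μ‖ < 1 := by
  obtain ⟨δ, hδ, hxδ⟩ := exists_mem_farSet hx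
  exact ⟨_, rfl, greenLimit_add_period hp hA hB hzeros hAlim hBlim hδ hxδ,
    greenLimit_riccati hp hA hB hzeros hAlim hBlim hδ hxδ,
    norm_lt_one_of_eigenvector hp hA hB hzeros hAlim hBlim hδ hxδ,
    norm_lt_one_of_eigenvector_conjTranspose hp hA hB hzeros hAlim hBlim hδ hxδ⟩

include ha

lemma natDegree_rootPoly (x : ℂ) : (rootPoly a b x).natDegree = 2 * r := by
  refine le_antisymm (Polynomial.natDegree_le_iff_coeff_eq_zero.2 fun n hn => ?_)
    (Polynomial.le_natDegree_of_ne_zero ?_)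
  · refine coeff_rootPoly_eq_of_forall_compl (M := M) n 0 (fun y hy => ?_) x
    obtain ⟨ρ, -, hper, hric, -⟩ := exists_riccati_solution hp hA hB hzeros hAlim hBlim hy
    refine Polynomial.coeff_eq_zero_of_natDegree_lt ?_
    rwa [natDegree_rootPoly_of_riccati hp a b hper hric ha]
  · rw [coeff_rootPoly_eq_of_forall_compl (M := M) (2 * r)
      ((-1) ^ (p * r + r) * star (∏ i : Fin p, (a (cycNext i)).det)) (fun y hy => by
        obtain ⟨ρ, -, hper, hric, -⟩ := exists_riccati_solution hp hA hB hzeros hAlim hBlim hy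
        exact leadingCoeff_rootPoly_of_riccati hp a b hper hric ha) x]
    exact mul_ne_zero (by simp) (star_ne_zero.2 (prod_det_cycNext_ne_zero ha))

lemma coeff_zero_rootPoly_ne_zero (x : ℂ) : (rootPoly a b x).coeff 0 ≠ 0 := by
  rw [coeff_rootPoly_eq_of_forall_compl (M := M) 0
    ((-1) ^ (p * r + r) * ∏ i : Fin p, (a (cycNext i)).det) (fun y hy => by
      obtain ⟨ρ, -, hper, hric, -⟩ := exists_riccati_solution hp hA hB hzeros hAlim hBlim hy
      exact coeff_zero_rootPoly_of_riccati hp a b hper hric ha) x]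
  exact mul_ne_zero (by simp) (prod_det_cycNext_ne_zero ha)

lemma block_eigenvectors_of_notMem {x : ℂ} (hx : x ∉ realInterval M) {z : Fin (2 * r) → ℂ}
    {v : Fin (2 * r) → Fin p × Fin r → ℂ} (hz : IsOrderedRoots a b x z)
    (hv : IsNullSystem a b x z v) (j : Fin p) :
    LinearIndependent ℂ (fun k : Fin r => block (v (small k)) j) ∧
      ∀ k : Fin r, ratioLimit hp a (fun k => greenLimit A B p k x) j p *ᵥ block (v (small k)) j =
        z (small k) • block (v (small k)) j := by
  obtain ⟨ρ, hρ, hper, hric, hspec, hspec'⟩ :=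
    exists_riccati_solution hp hA hB hzeros hAlim hBlim hx
  rw [← hρ]
  exact IsNullSystem.block_eigenvectors hp hper hric ha hspec hspec' hz hv j

lemma isDiagonalizable_ratioLimit {x : ℂ} (hx : x ∉ realInterval M ∪ exceptionalSet a b)
    (j : Fin p) :
    IsDiagonalizable (ratioLimit hp a (fun k => greenLimit A B p k x) j p) := by
  have hxM : x ∉ realInterval M := fun h => hx (Or.inl h)
  obtain ⟨z, v, hz, hv⟩ : ∃ z v, IsOrderedRoots a b x z ∧ IsNullSystem a b x z v := by
    by_contra h
    exact hx (Or.inr h)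
  obtain ⟨hLI, heig⟩ := block_eigenvectors_of_notMem hp hA hB hzeros ha hAlim hBlim hxM hz hv j
  let V : Matrix (Fin r) (Fin r) ℂ := Matrix.of fun i k => block (v (small k)) j i
  have hV : IsUnit V.det :=
    (Matrix.isUnit_iff_isUnit_det _).1 (Matrix.linearIndependent_cols_iff_isUnit.1 hLI)
  refine ⟨V, fun k => z (small k), hV, ?_⟩
  have hmul : ratioLimit hp a (fun k => greenLimit A B p k x) j p * V =
      V * Matrix.diagonal fun k => z (small k) := by
    ext i k
    have := congrFun (heig k) i
    rw [Matrix.mul_diagonal]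
    simp only [Pi.smul_apply, smul_eq_mul] at this
    exact (this : _ = _ * V i k).trans (mul_comm _ _)
  rw [← hmul, Matrix.mul_nonsing_inv_cancel_right _ _ hV]

omit ha in
lemma tendstoUniformlyOn_ratio (j : Fin p) {K : Set ℂ} (hK : IsCompact K)
    (hKM : K ⊆ (realInterval M)ᶜ) :
    TendstoUniformlyOn (fun n x => ratio A B j n x)
      (fun x => ratioLimit hp a (fun k => greenLimit A B p k x) j p) atTop K := by
  obtain ⟨δ, hδ, hKδ⟩ := exists_subset_farSet hK hKM
  exact (tendstoUniformlyOn_ratioLimit hp hA hB hzeros hAlim hBlim hδ j p).2.mono hKδ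

/-- Since z v_j = L_j v_j and |v_j| ≤ 1, the error is at most the operator norm of the ratio minus
L_j. No continuity of z or v in x is involved. -/
lemma tendstoUniformlyOn_ratio_mulVec {z : ℂ → Fin (2 * r) → ℂ}
    {v : ℂ → Fin (2 * r) → Fin p × Fin r → ℂ} {K : Set ℂ} (hK : IsCompact K)
    (hKM : K ⊆ (realInterval M)ᶜ) (hz : ∀ x, IsOrderedRoots a b x (z x))
    (hv : ∀ x ∈ K, IsNullSystem a b x (z x) (v x)) (j : Fin p) :
    TendstoUniformlyOn
      (fun n (q : Fin r × ℂ) => ratio A B j n q.2 *ᵥ block (v q.2 (small q.1)) j)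
      (fun q => z q.2 (small q.1) • block (v q.2 (small q.1)) j) atTop (Set.univ ×ˢ K) := by
  have h := tendstoUniformlyOn_ratio hp hA hB hzeros hAlim hBlim j hK hKM
  rw [Metric.tendstoUniformlyOn_iff] at h ⊢
  intro ε hε
  filter_upwards [h ε hε] with n hn
  rintro ⟨k, x⟩ ⟨-, hx⟩
  have h1 := hn x hx
  simp only
  rw [← (block_eigenvectors_of_notMem hp hA hB hzeros ha hAlim hBlim (hKM hx) (hz x) (hv x hx)
    j).2 k, dist_eq_norm, ← Matrix.sub_mulVec]
  rw [dist_eq_norm] at h1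
  refine lt_of_le_of_lt ?_ h1
  have h2 : euclNorm (block (v x (small k)) j) ≤ 1 :=
    (euclNorm_block_le _ _).trans_eq ((hv x hx).norm_one _)
  refine (pi_norm_le_iff_of_nonneg (norm_nonneg _)).2 fun i => ?_
  refine (norm_apply_le_euclNorm _ i).trans ((euclNorm_mulVec_le _ _).trans ?_)
  exact mul_le_of_le_one_right (norm_nonneg _) h2

/-- The product of the small roots is det T by the splitting of `rootPoly`. No eigenvectors enter,
so the exceptional points need not be removed. -/
lemma tendstoUniformlyOn_det_ratio {z : ℂ → Fin (2 * r) → ℂ}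
    (hz : ∀ x, IsOrderedRoots a b x (z x)) {K : Set ℂ} (hK : IsCompact K)
    (hKM : K ⊆ (realInterval M)ᶜ) :
    TendstoUniformlyOn (fun n x => (matPoly A B n x).det / (matPoly A B (n + p) x).det)
      (fun x => ∏ k : Fin r, z x (small k)) atTop K := by
  obtain ⟨δ, hδ, hKδ⟩ := exists_subset_farSet hK hKM
  have : ProperSpace (Matrix (Fin r) (Fin r) ℂ) := FiniteDimensional.proper ℂ _
  refine tendstoUniformlyOn_of_residues hp fun j => ?_
  obtain ⟨hbdd, hlim⟩ := tendstoUniformlyOn_ratioLimit hp hA hB hzeros hAlim hBlim hδ j p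
  have h1 := (tendstoUniformlyOn_comp_of_bounded hlim hbdd
    (f := Matrix.det) (continuous_id.matrix_det)).mono hKδ
  refine (h1.congr (Eventually.of_forall fun n x _ => ?_)).congr_right fun x hx => ?_
  · simp only
    rw [Matrix.det_mul, Matrix.det_nonsing_inv, Ring.inverse_eq_inv, div_eq_mul_inv]
  · obtain ⟨ρ, hρ, hper, hric, hspec, hspec'⟩ :=
      exists_riccati_solution hp hA hB hzeros hAlim hBlim (hKM hx)
    simp only
    rw [← hρ, det_ratioLimit_eq_last hp hper (isUnit_det_ratioLimit hp a b hper hric ha) j]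
    exact ((hz x).small_roots hp a b hper hric ha hspec hspec').2.symm

end Main
end MatrixRatio
theorem theorem3p4 (r p : ℕ) (hr : 0 < r) (hp : 0 < p)
    (A B : ℕ → Matrix (Fin r) (Fin r) ℂ)
    (hA : ∀ n, IsUnit (A (n + 1)).det) (hB : ∀ n, (B n).IsHermitian)
    (a b : Fin p → Matrix (Fin r) (Fin r) ℂ)
    (ha : ∀ j, IsUnit (a j).det)
    (hAlim : ∀ j : Fin p, Tendsto (fun n : ℕ => A (p * n + j)) atTop (𝓝 (a j)))
    (hBlim : ∀ j : Fin p, Tendsto (fun n : ℕ => B (p * n + j)) atTop (𝓝 (b j)))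
    (M : ℝ) (hM : 0 < M)
    (hzeros : ∀ (n : ℕ) (x : ℂ), (matPoly A B n x).det = 0 → x ∈ realInterval M) :
    (∀ x, ∃ z : Fin (2 * r) → ℂ, IsOrderedRoots a b x z) ∧ (exceptionalSet a b).Finite ∧
    ∃ L : Fin p → ℂ → Matrix (Fin r) (Fin r) ℂ,
      (∀ j, ∀ x ∉ realInterval M ∪ exceptionalSet a b,
        Tendsto (fun n => ratio A B j n x) atTop (𝓝 (L j x)) ∧ IsDiagonalizable (L j x)) ∧
      (∀ j, ∀ K : Set ℂ, IsCompact K → K ⊆ (realInterval M ∪ exceptionalSet a b)ᶜ →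
        TendstoUniformlyOn (fun n x => ratio A B j n x) (L j) atTop K) ∧
      ∀ z : ℂ → Fin (2 * r) → ℂ, (∀ x, IsOrderedRoots a b x (z x)) →
        (∀ v : ℂ → Fin (2 * r) → Fin p × Fin r → ℂ,
          (∀ x ∉ exceptionalSet a b, IsNullSystem a b x (z x) (v x)) →
          ∀ j : Fin p,
            (∀ x ∉ realInterval M ∪ exceptionalSet a b,
              LinearIndependent ℂ (fun k : Fin r => block (v x (small k)) j) ∧
              ∀ k : Fin r, L j x *ᵥ block (v x (small k)) j =
                z x (small k) • block (v x (small k)) j) ∧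
            (∀ K : Set ℂ, IsCompact K → K ⊆ (realInterval M ∪ exceptionalSet a b)ᶜ →
              TendstoUniformlyOn
                (fun n (q : Fin r × ℂ) => ratio A B j n q.2 *ᵥ block (v q.2 (small q.1)) j)
                (fun q => z q.2 (small q.1) • block (v q.2 (small q.1)) j)
                atTop (Set.univ ×ˢ K))) ∧
        (∀ K : Set ℂ, IsCompact K → K ⊆ (realInterval M)ᶜ →
          TendstoUniformlyOn
            (fun n x => (matPoly A B n x).det / (matPoly A B (n + p) x).det)
            (fun x => ∏ k : Fin r, z x (small k)) atTop K) := by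
  have hdeg := natDegree_rootPoly hp hA hB hzeros ha hAlim hBlim
  have hb : ∀ j, (b j).IsHermitian := fun j => by
    have h1 : Tendsto (fun n => (B (p * n + j))ᴴ) atTop (𝓝 (b j)ᴴ) :=
      (continuous_star.tendsto _).comp (hBlim j)
    exact tendsto_nhds_unique (h1.congr fun n => (hB _).eq) (hBlim j)
  -- The witness for L is built from the Green limits alone. It does not depend on the choice of
  -- roots or null vectors, and its convergence holds on the whole complement of the interval; S
  -- matters only for diagonalizability and the eigenvectors.
  refine ⟨fun x => exists_isOrderedRoots (hdeg x), exceptionalSet_finite hb hr hp hdeg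
    (coeff_zero_rootPoly_ne_zero hp hA hB hzeros ha hAlim hBlim),
    fun j x => ratioLimit hp a (fun k => greenLimit A B p k x) j p, fun j x hx => ⟨?_, ?_⟩,
    fun j K hK hKS => ?_, fun z hz => ⟨fun v hv j => ⟨fun x hx => ?_, fun K hK hKS => ?_⟩, ?_⟩⟩
  · exact (tendstoUniformlyOn_ratio hp hA hB hzeros hAlim hBlim j isCompact_singleton
      (Set.singleton_subset_iff.2 fun h => hx (Or.inl h))).tendsto_at rfl
  · exact isDiagonalizable_ratioLimit hp hA hB hzeros ha hAlim hBlim hx j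
  · exact tendstoUniformlyOn_ratio hp hA hB hzeros hAlim hBlim j hK
      fun x hx h => hKS hx (Or.inl h)
  · exact block_eigenvectors_of_notMem hp hA hB hzeros ha hAlim hBlim (fun h => hx (Or.inl h))
      (hz x) (hv x fun h => hx (Or.inr h)) j
  · exact tendstoUniformlyOn_ratio_mulVec hp hA hB hzeros ha hAlim hBlim hK
      (fun x hx h => hKS hx (Or.inl h)) hz (fun x hx => hv x fun h => hKS hx (Or.inr h)) j
  · exact fun K hK hKM => tendstoUniformlyOn_det_ratio hp hA hB hzeros ha hAlim hBlim hz hK hKM
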